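/- Let $F$ be an infinite field of characteristic not $2$, let $V$ be an $F$-vector space of finite dimension $n>0$, and let $s$ be a symplectic form on $V$, i.e. a nondegenerate alternating bilinear form. Let $\mathrm{Sp}(s)$ be the group of all linear automorphisms $u$ of $V$ such that $s(u(x),u(y))=s(x,y)$ for all $x,y\in V$. An involution of $\mathrm{Sp}(s)$ is an element $i\in\mathrm{Sp}(s)$ with $i^2=\mathrm{id}$ (so $\mathrm{id}$ is allowed). (a) If $4$ divides $n$, then every element of $\mathrm{Sp}(s)$ is the product of four involutions of $\mathrm{Sp}(s)$, and there is an element of $\mathrm{Sp}(s)$ that is not the product of $k$ involutions of $\mathrm{Sp}(s)$ for any $k<4$. (b) If $n\equiv 2 \pmod 4$ and $n>2$, then every element of $\mathrm{Sp}(s)$ is the product of five involutions of $\mathrm{Sp}(s)$, and there is an element of $\mathrm{Sp}(s)$ that is not the product of $k$ involutions of $\mathrm{Sp}(s)$ for any $k<4$. -/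

import Mathlib

/-- A symplectic form: a nondegenerate alternating bilinear form. -/
structure IsSymplecticForm {F V : Type*} [Field F] [AddCommGroup V] [Module F V]
    (s : LinearMap.BilinForm F V) : Prop where
  alt : s.IsAlt
  nondegenerate : s.Nondegenerate

/-- The isometry group of the bilinear form `s`; it is the symplectic group `Sp(s)` when `s` is
a symplectic form. -/
def Sp {F V : Type*} [Field F] [AddCommGroup V] [Module F V]
    (s : LinearMap.BilinForm F V) : Subgroup (V ≃ₗ[F] V) where
  carrier := {u | ∀ x y, s (u x) (u y) = s x y}
  mul_mem' := by
    intro a b ha hb x y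
    exact (ha (b x) (b y)).trans (hb x y)
  one_mem' := fun _ _ => rfl
  inv_mem' := by
    intro a ha x y
    have h := ha (a⁻¹ x) (a⁻¹ y)
    have e : ∀ z, a (a⁻¹ z) = z := fun z => a.apply_symm_apply z
    rw [e, e] at h
    exact h.symm

/-- An element of a group is `k`-reflectional if it is the product of `k` involutions of that
group, where an involution is an element of order `1` or `2`. -/
def IsReflectional {G : Type*} [Group G] (k : ℕ) (g : G) : Prop :=
  ∃ i : Fin k → G, (∀ j, i j ^ 2 = 1) ∧ g = (List.ofFn i).prod

/-! An involution of Sp(s) is self-adjoint for s, and an isometry `a` reversed by such an involution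
j is the product j · (j a) of two involutions. So four involutions suffice once u = a b with `a` and
`b` reversible. The factors used here are diagonalizable with eigenvalues θ, θ⁻¹ on d hyperbolic
pairs and reversible on the orthogonal complement of these pairs. If d is even, the pairs can be
matched two by two and the whole factor is reversible (`HasHypSplit.isReversible`). If d is odd this
construction is not available: on a plane the only self-adjoint involutions are scalars. The proof
is therefore a count of d modulo 2.

Put w = u + u⁻¹, which is self-adjoint. Let L be a maximal totally isotropic subspace that is stable
under w and has L + uL nondegenerate; then V is the orthogonal sum of L ⊕ uL and some U'
(`exists_maximal_isModelSubspace`). On L ⊕ uL ≅ L × L, u is (p, q) ↦ (-q, p + Wq) and factors with d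
= dim L (`hasFactorization_model`). On U', where no such subspace is left, u is reversible (d = 0),
and if U' ≠ 0 it also factors with d = 1 (`isReversible_and_hasFactorization_of_no_model`). The
reason is that there u or -u has a unipotent part splitting off hyperbolic pieces A ⊕ A*, on which u
is ± the extension of a cyclic unipotent map of A (`exists_dual_pair`, `exists_unipotent_piece`).
Hence d can be made even unless dim L is odd and U' = 0; in that case n = 2 dim L ≡ 2 mod 4.

In this last case, for n > 2, one extra involution i gives u = i a b with d = dim L - 1
(`exists_involution_mul_model`), hence five involutions.

For the lower bound, a transvection is never a product of three involutions
(`not_isReflectional_transvection`): writing it as i j k and using s(y, j y) = 0 gives an identity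
between products of linear forms that cannot hold. -/

/-- The linear map `a` preserves the bilinear form `s`. -/
def PreservesForm {F V : Type*} [Field F] [AddCommGroup V] [Module F V]
    (s : LinearMap.BilinForm F V) (a : V →ₗ[F] V) : Prop :=
  ∀ x y, s (a x) (a y) = s x y

/-- For hyperbolic families `x` and `y`, the orthogonal projection on their span. -/
def hypProj {F V ι : Type*} [Field F] [AddCommGroup V] [Module F V] [Fintype ι]
    (s : LinearMap.BilinForm F V) (x y : ι → V) (v : V) : V :=
  ∑ i, (s v (y i) • x i - s v (x i) • y i)

/-- A splitting of an isometry `a`: hyperbolic families of eigenvectors for `θ` and `θ⁻¹`, and a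
partial involution `j` that reverses `a` on the orthogonal complement of these families. -/
structure HypSplit {F V : Type*} [Field F] [AddCommGroup V] [Module F V]
    (s : LinearMap.BilinForm F V) (θ : F) (a : V →ₗ[F] V)
    (ι : Type) [Fintype ι] [DecidableEq ι] where
  x : ι → V
  y : ι → V
  j : V →ₗ[F] V
  hxx : ∀ i k, s (x i) (x k) = 0
  hyy : ∀ i k, s (y i) (y k) = 0
  hxy : ∀ i k, s (x i) (y k) = if i = k then 1 else 0
  ax : ∀ i, a (x i) = θ • x i
  ay : ∀ i, a (y i) = θ⁻¹ • y i
  adj : ∀ v w, s (j v) w = s v (j w)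
  jx : ∀ i, j (x i) = 0
  jy : ∀ i, j (y i) = 0
  jj : ∀ v, j (j v) = v - hypProj s x y v
  jaja : ∀ v, j (a (j (a v))) = v - hypProj s x y v

/-- The isometry `a` has a splitting with `d` hyperbolic pairs. -/
def HasHypSplit {F V : Type*} [Field F] [AddCommGroup V] [Module F V]
    (s : LinearMap.BilinForm F V) (θ : F) (a : V →ₗ[F] V) (d : ℕ) : Prop :=
  ∃ (ι : Type) (_ : Fintype ι) (_ : DecidableEq ι), Fintype.card ι = d ∧
    Nonempty (HypSplit s θ a ι)

/-- `u` is the product of two isometries having splittings with `d` hyperbolic pairs. -/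
def HasFactorization {F V : Type*} [Field F] [AddCommGroup V] [Module F V]
    (s : LinearMap.BilinForm F V) (u : V →ₗ[F] V) (α γ : F) (d : ℕ) : Prop :=
  ∃ a b : V →ₗ[F] V, PreservesForm s a ∧ PreservesForm s b ∧ (∀ v, u v = a (b v)) ∧
    HasHypSplit s α a d ∧ HasHypSplit s γ b d

/-- `a` is reversed by a self-adjoint involution. -/
def IsReversible {F V : Type*} [Field F] [AddCommGroup V] [Module F V]
    (s : LinearMap.BilinForm F V) (a : V →ₗ[F] V) : Prop :=
  ∃ j : V →ₗ[F] V, (∀ v w, s (j v) w = s v (j w)) ∧ (∀ v, j (j v) = v) ∧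
    ∀ v, j (a (j (a v))) = v

/-- The orthogonal sum of two bilinear forms. -/
def prodForm {F V W : Type*} [Field F] [AddCommGroup V] [Module F V] [AddCommGroup W] [Module F W]
    (s : LinearMap.BilinForm F V) (t : LinearMap.BilinForm F W) :
    LinearMap.BilinForm F (V × W) :=
  s.compl₁₂ (LinearMap.fst F V W) (LinearMap.fst F V W) +
    t.compl₁₂ (LinearMap.snd F V W) (LinearMap.snd F V W)

/-! ### Splittings, reversibility and orthogonal sums -/

section splittings

variable {F V W : Type*} [Field F] [AddCommGroup V] [Module F V] [AddCommGroup W] [Module F W]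
  {s : LinearMap.BilinForm F V} {t : LinearMap.BilinForm F W} {θ α γ : F}

@[simp] theorem prodForm_apply (p q : V × W) :
    prodForm s t p q = s p.1 q.1 + t p.2 q.2 := rfl

theorem LinearMap.BilinForm.IsAlt.swap (h : s.IsAlt) (x y : V) : s x y = - s y x :=
  (h.neg_eq y x).symm

/-- Swapping the θ-line of one pair with the θ⁻¹-line of another reverses `a`. Matching the pairs
two by two, with opposite signs inside each match, makes this swap self-adjoint; it is then added to
the partial involution `j`. -/
theorem HasHypSplit.isReversible (hs : s.IsAlt) (hθ : θ ≠ 0) {a : V →ₗ[F] V}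
    (ha : PreservesForm s a) {d : ℕ} (hd : Even d) (h : HasHypSplit s θ a d) :
    IsReversible s a := by
  obtain ⟨ι, _, _, hc, ⟨S⟩⟩ := h
  obtain ⟨r, hr⟩ := hd
  -- A fixed-point-free pairing of the indices, with signs ±1 that differ on the two members of a
  -- couple. This is where `d` has to be even.
  obtain ⟨τ, c, hτ, hcτ, hcc⟩ : ∃ (τ : ι ≃ ι) (c : ι → F),
      (∀ i, τ (τ i) = i) ∧ (∀ i, c (τ i) = - c i) ∧ ∀ i, c i * c i = 1 := by
    have e : ι ≃ Fin r ⊕ Fin r := Fintype.equivOfCardEq (by simp [hc, hr])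
    refine ⟨e.trans ((Equiv.sumComm _ _).trans e.symm),
      fun i => Sum.elim (fun _ => 1) (fun _ => -1) (e i), ?_, ?_, ?_⟩
    · intro i; simp
    · intro i
      rcases h : e i with k | k <;> simp [h]
    · intro i
      beta_reduce
      rcases e i with k | k <;> simp
  have hyx : ∀ i k, s (S.y i) (S.x k) = if i = k then -1 else 0 := by
    intro i k
    rw [hs.swap, S.hxy]
    by_cases h : i = k <;> simp [h, eq_comm]
  -- On the hyperbolic part: x_i ↦ c_i y_{τ i} and y_i ↦ -c_i x_{τ i}. The antisymmetry of c under τ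
  -- gives both self-adjointness and q² = projection.
  let q : V →ₗ[F] V := ∑ i, c i • ((s.flip (S.y i)).smulRight (S.y (τ i)) +
    (s.flip (S.x i)).smulRight (S.x (τ i)))
  have hq : ∀ v, q v = ∑ i, c i • (s v (S.y i) • S.y (τ i) + s v (S.x i) • S.x (τ i)) := by
    intro v; simp [q]
  have qx : ∀ i, q (S.x i) = c i • S.y (τ i) := by
    intro i; simp [hq, S.hxx, S.hxy]
  have qy : ∀ i, q (S.y i) = - c i • S.x (τ i) := by
    intro i; simp [hq, S.hyy, hyx]
  have qadj : ∀ v w, s (q v) w = s v (q w) := by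
    intro v w
    simp only [hq, map_sum, LinearMap.sum_apply, map_smul, LinearMap.smul_apply, map_add,
      LinearMap.add_apply, smul_eq_mul]
    refine Fintype.sum_equiv τ _ _ fun i => ?_
    rw [hcτ, hτ, hs.swap (S.y (τ i)) w, hs.swap (S.x (τ i)) w]
    ring
  have qq : ∀ v, q (q v) = hypProj s S.x S.y v := by
    intro v
    rw [hq v, hypProj, map_sum]
    refine Finset.sum_congr rfl fun i _ => ?_
    rw [map_smul, map_add, map_smul, map_smul, qx, qy, hcτ, hτ]
    have := hcc i
    simp only [neg_neg, smul_add, smul_smul, sub_eq_add_neg, ← neg_smul]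
    congr 2
    · linear_combination (s v (S.y i)) * this
    · linear_combination -(s v (S.x i)) * this
  have jq : ∀ v, S.j (q v) = 0 := by
    intro v; simp [hq, S.jx, S.jy]
  have qj : ∀ v, q (S.j v) = 0 := by
    intro v; simp [hq, S.adj, S.jx, S.jy]
  have say : ∀ v i, s (a v) (S.y i) = θ * s v (S.y i) := by
    intro v i
    have := ha v (S.y i)
    rw [S.ay, map_smul, smul_eq_mul] at this
    rw [← this]; field_simp
  have sax : ∀ v i, s (a v) (S.x i) = θ⁻¹ * s v (S.x i) := by
    intro v i
    have := ha v (S.x i)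
    rw [S.ax, map_smul, smul_eq_mul] at this
    rw [← this]; field_simp
  have qaj : ∀ v, q (a (S.j v)) = 0 := by
    intro v; simp [hq, say, sax, S.adj, S.jx, S.jy]
  have jaq : ∀ v, S.j (a (q v)) = 0 := by
    intro v; simp [hq, S.jx, S.jy, S.ax, S.ay]
  have aqa : ∀ v, a (q (a v)) = q v := by
    intro v
    rw [hq, hq, map_sum]
    refine Finset.sum_congr rfl fun i _ => ?_
    rw [say, sax, map_smul, map_add, map_smul, map_smul, S.ay, S.ax, smul_smul, smul_smul]
    congr 3 <;> field_simp
  refine ⟨S.j + q, ?_, ?_, ?_⟩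
  · intro v w; simp [S.adj, qadj]
  · intro v; simp [S.jj, qq, jq, qj]
  · intro v
    simp only [LinearMap.add_apply, map_add, S.jaja, qaj, aqa, qq]
    simp [jq]

theorem IsReversible.hasHypSplit {a : V →ₗ[F] V} (h : IsReversible s a) :
    HasHypSplit s θ a 0 := by
  obtain ⟨j, h1, h2, h3⟩ := h
  exact ⟨Empty, inferInstance, inferInstance, rfl,
    ⟨⟨fun i => i.elim, fun i => i.elim, j, fun i => i.elim, fun i => i.elim, fun i => i.elim,
      fun i => i.elim, fun i => i.elim, h1, fun i => i.elim, fun i => i.elim,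
      fun v => by simp [h2, hypProj], fun v => by simp [h3, hypProj]⟩⟩⟩

/-- The trivial factorization u = u · id; it completes a summand without changing the number of
hyperbolic pairs. -/
theorem IsReversible.hasFactorization {u : V →ₗ[F] V} (hu : PreservesForm s u)
    (h : IsReversible s u) : HasFactorization s u α γ 0 :=
  ⟨u, LinearMap.id, hu, fun _ _ => rfl, fun _ => rfl, h.hasHypSplit,
    IsReversible.hasHypSplit ⟨LinearMap.id, fun _ _ => rfl, fun _ => rfl, fun _ => rfl⟩⟩

theorem HasHypSplit.neg {a : V →ₗ[F] V} {d : ℕ} (h : HasHypSplit s θ a d) :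
    HasHypSplit s (-θ) (-a) d := by
  obtain ⟨ι, i1, i2, hc, ⟨S⟩⟩ := h
  exact ⟨ι, i1, i2, hc, ⟨⟨S.x, S.y, S.j, S.hxx, S.hyy, S.hxy, fun i => by simp [S.ax],
    fun i => by simp [S.ay, inv_neg], S.adj, S.jx, S.jy, S.jj, fun v => by simp [S.jaja]⟩⟩⟩

/-- Replacing (x, y) by (y, -x) exchanges the two eigenvalues; the sign keeps the pairs hyperbolic.
-/
theorem HasHypSplit.inv (hs : s.IsAlt) {a : V →ₗ[F] V} {d : ℕ} (h : HasHypSplit s θ⁻¹ a d) :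
    HasHypSplit s θ a d := by
  obtain ⟨ι, i1, i2, hc, ⟨S⟩⟩ := h
  have hP : ∀ v, hypProj s S.y (fun i => - S.x i) v = hypProj s S.x S.y v := by
    intro v
    refine Finset.sum_congr rfl fun i _ => ?_
    simp only [map_neg, smul_neg, neg_smul]; abel
  refine ⟨ι, i1, i2, hc, ⟨⟨S.y, fun i => - S.x i, S.j, S.hyy, fun i k => by simp [S.hxx],
    fun i k => ?_, fun i => by simp [S.ay], fun i => by simp [S.ax], S.adj, S.jy,
    fun i => by simp [S.jx], fun v => by rw [S.jj, hP], fun v => by rw [S.jaja, hP]⟩⟩⟩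
  rw [map_neg, ← hs.swap, S.hxy]
  simp [eq_comm]

theorem HasHypSplit.congr {a : V →ₗ[F] V} {a' : W →ₗ[F] W} {d : ℕ} (e : V ≃ₗ[F] W)
    (he : ∀ x y, t (e x) (e y) = s x y) (ha : ∀ v, a' (e v) = e (a v))
    (h : HasHypSplit s θ a d) : HasHypSplit t θ a' d := by
  obtain ⟨ι, i1, i2, hc, ⟨S⟩⟩ := h
  have hP : ∀ v, hypProj t (fun i => e (S.x i)) (fun i => e (S.y i)) (e v)
      = e (hypProj s S.x S.y v) := by
    intro v; simp [hypProj, he]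
  have key : ∀ P : W → Prop, (∀ v, P (e v)) → ∀ w, P w := fun P h w => by
    simpa using h (e.symm w)
  refine ⟨ι, i1, i2, hc, ⟨⟨fun i => e (S.x i), fun i => e (S.y i),
    e.toLinearMap ∘ₗ S.j ∘ₗ e.symm.toLinearMap, fun i k => by rw [he, S.hxx],
    fun i k => by rw [he, S.hyy], fun i k => by rw [he, S.hxy],
    fun i => by rw [ha, S.ax, map_smul], fun i => by rw [ha, S.ay, map_smul],
    key _ fun v => key _ fun w => ?_, fun i => by simp [S.jx], fun i => by simp [S.jy],
    key _ fun v => ?_, key _ fun v => ?_⟩⟩⟩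
  · simp [he, S.adj]
  · rw [hP]; simp [S.jj]
  · rw [hP]; simp [S.jaja, ha]

theorem PreservesForm.congr {a : V →ₗ[F] V} (e : V ≃ₗ[F] W)
    (he : ∀ x y, t (e x) (e y) = s x y) (ha : PreservesForm s a) :
    PreservesForm t (e.toLinearMap ∘ₗ a ∘ₗ e.symm.toLinearMap) := by
  intro x y
  have h1 : ∀ x y, s (e.symm x) (e.symm y) = t x y := fun x y => by rw [← he]; simp
  simp [he, ha (e.symm x), h1]

theorem HasFactorization.congr {u : V →ₗ[F] V} {u' : W →ₗ[F] W} {d : ℕ} (e : V ≃ₗ[F] W)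
    (he : ∀ x y, t (e x) (e y) = s x y) (hu : ∀ v, u' (e v) = e (u v))
    (h : HasFactorization s u α γ d) : HasFactorization t u' α γ d := by
  obtain ⟨a, b, ha, hb, hab, h1, h2⟩ := h
  refine ⟨_, _, ha.congr e he, hb.congr e he, fun w => ?_,
    h1.congr e he fun v => by simp, h2.congr e he fun v => by simp⟩
  have := hu (e.symm w)
  simp only [LinearEquiv.apply_symm_apply] at this
  simp [this, hab]

theorem IsReversible.congr {a : V →ₗ[F] V} {a' : W →ₗ[F] W} (e : V ≃ₗ[F] W)
    (he : ∀ x y, t (e x) (e y) = s x y) (ha : ∀ v, a' (e v) = e (a v))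
    (h : IsReversible s a) : IsReversible t a' := by
  obtain ⟨j, h1, h2, h3⟩ := h
  have key : ∀ P : W → Prop, (∀ v, P (e v)) → ∀ w, P w := fun P h w => by
    simpa using h (e.symm w)
  refine ⟨e.toLinearMap ∘ₗ j ∘ₗ e.symm.toLinearMap, key _ fun v => key _ fun w => ?_,
    key _ fun v => ?_, key _ fun v => ?_⟩
  · simp [he, h1]
  · simp [h2]
  · simp [h3, ha]

theorem HasHypSplit.prod {a : V →ₗ[F] V} {b : W →ₗ[F] W} {d e : ℕ}
    (h : HasHypSplit s θ a d) (h' : HasHypSplit t θ b e) :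
    HasHypSplit (prodForm s t) θ (a.prodMap b) (d + e) := by
  obtain ⟨ι, i1, i2, hc, ⟨S⟩⟩ := h
  obtain ⟨κ, k1, k2, hc', ⟨T⟩⟩ := h'
  have hP : ∀ v, hypProj (prodForm s t) (Sum.elim (fun i => (S.x i, 0)) (fun i => (0, T.x i)))
      (Sum.elim (fun i => (S.y i, 0)) (fun i => (0, T.y i))) v =
      (hypProj s S.x S.y v.1, hypProj t T.x T.y v.2) := by
    intro v
    simp only [hypProj, Fintype.sum_sum_type, Sum.elim_inl, Sum.elim_inr, prodForm_apply,
      map_zero, add_zero, zero_add, Prod.smul_mk, smul_zero, Prod.mk_sub_mk, sub_zero]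
    ext
    · simp [Prod.fst_sum]
    · simp [Prod.snd_sum]
  refine ⟨ι ⊕ κ, inferInstance, inferInstance, by simp [hc, hc'],
    ⟨⟨Sum.elim (fun i => (S.x i, 0)) (fun i => (0, T.x i)),
      Sum.elim (fun i => (S.y i, 0)) (fun i => (0, T.y i)), S.j.prodMap T.j,
      ?_, ?_, ?_, ?_, ?_, ?_, ?_, ?_, ?_, ?_⟩⟩⟩
  · rintro (i | i) (k | k) <;> simp [S.hxx, T.hxx]
  · rintro (i | i) (k | k) <;> simp [S.hyy, T.hyy]
  · rintro (i | i) (k | k) <;> simp [S.hxy, T.hxy]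
  · rintro (i | i) <;> simp [S.ax, T.ax]
  · rintro (i | i) <;> simp [S.ay, T.ay]
  · intro v w; simp [S.adj, T.adj]
  · rintro (i | i) <;> simp [S.jx, T.jx]
  · rintro (i | i) <;> simp [S.jy, T.jy]
  · intro v; rw [hP]; ext <;> simp [S.jj, T.jj]
  · intro v; rw [hP]; ext <;> simp [S.jaja, T.jaja]

/-- The numbers of pairs add up, so a summand with d = 1 can correct the parity of another one. -/
theorem HasFactorization.prod {u : V →ₗ[F] V} {v : W →ₗ[F] W} {d e : ℕ}
    (h : HasFactorization s u α γ d) (h' : HasFactorization t v α γ e) :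
    HasFactorization (prodForm s t) (u.prodMap v) α γ (d + e) := by
  obtain ⟨a, b, ha, hb, hab, h1, h2⟩ := h
  obtain ⟨a', b', ha', hb', hab', h1', h2'⟩ := h'
  refine ⟨a.prodMap a', b.prodMap b', fun x y => ?_, fun x y => ?_, fun x => ?_,
    h1.prod h1', h2.prod h2'⟩
  · simp [ha x.1, ha' x.2]
  · simp [hb x.1, hb' x.2]
  · simp [hab, hab']

theorem IsReversible.prod {u : V →ₗ[F] V} {v : W →ₗ[F] W}
    (h : IsReversible s u) (h' : IsReversible t v) :
    IsReversible (prodForm s t) (u.prodMap v) := by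
  obtain ⟨i, h1, h2, h3⟩ := h
  obtain ⟨j, h1', h2', h3'⟩ := h'
  refine ⟨i.prodMap j, fun x y => ?_, fun x => ?_, fun x => ?_⟩
  · simp [h1, h1']
  · simp [h2, h2']
  · simp [h3, h3']

theorem HasFactorization.neg {u : V →ₗ[F] V} {d : ℕ} (h : HasFactorization s u α γ d) :
    HasFactorization s (-u) α (-γ) d := by
  obtain ⟨a, b, ha, hb, hab, h1, h2⟩ := h
  exact ⟨a, -b, ha, fun x y => by simp [hb x y], fun v => by simp [hab], h1, h2.neg⟩

theorem IsReversible.neg {u : V →ₗ[F] V} (h : IsReversible s u) : IsReversible s (-u) := by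
  obtain ⟨j, h1, h2, h3⟩ := h
  exact ⟨j, h1, h2, fun v => by simp [h3]⟩

end splittings

/-- The symplectic form on `L × L` attached to a symmetric form `β` on `L`. -/
def modelForm {F L : Type*} [Field F] [AddCommGroup L] [Module F L]
    (β : LinearMap.BilinForm F L) : LinearMap.BilinForm F (L × L) :=
  β.compl₁₂ (LinearMap.fst F L L) (LinearMap.snd F L L) -
    (β.compl₁₂ (LinearMap.fst F L L) (LinearMap.snd F L L)).flip

/-! ### Splittings read off from eigenspaces -/

section eigenspaces

variable {F V : Type*} [Field F] [AddCommGroup V] [Module F V]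
  {s : LinearMap.BilinForm F V}

theorem PreservesForm.apply_eq_zero {a : V →ₗ[F] V} (ha : PreservesForm s a) {l m : F}
    (hlm : l * m ≠ 1) {x y : V} (hx : a x = l • x) (hy : a y = m • y) : s x y = 0 := by
  have h := ha x y
  rw [hx, hy] at h
  simp only [map_smul, LinearMap.smul_apply, smul_eq_mul] at h
  have h2 : (l * m - 1) * s x y = 0 := by linear_combination h
  exact (mul_eq_zero.1 h2).resolve_left (sub_ne_zero.2 hlm)

/-- Each space embeds in the dual of the other, so the dimensions agree and injectivity is
bijectivity. -/
theorem bijective_domRestrict₁₂ [FiniteDimensional F V] (X Y : Submodule F V)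
    (nX : ∀ x ∈ X, (∀ y ∈ Y, s x y = 0) → x = 0) (nY : ∀ y ∈ Y, (∀ x ∈ X, s x y = 0) → y = 0) :
    Function.Bijective (s.flip.domRestrict₁₂ Y X : Y →ₗ[F] Module.Dual F X) := by
  have iB : Function.Injective (s.flip.domRestrict₁₂ Y X : Y →ₗ[F] Module.Dual F X) := by
    rw [injective_iff_map_eq_zero]
    intro y hy
    have := nY y y.2 fun x hx => DFunLike.congr_fun hy (⟨x, hx⟩ : X)
    exact_mod_cast this
  have iB' : Function.Injective (s.domRestrict₁₂ X Y : X →ₗ[F] Module.Dual F Y) := by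
    rw [injective_iff_map_eq_zero]
    intro x hx
    have := nX x x.2 fun y hy => DFunLike.congr_fun hx (⟨y, hy⟩ : Y)
    exact_mod_cast this
  have e1 := LinearMap.finrank_le_finrank_of_injective iB
  have e2 := LinearMap.finrank_le_finrank_of_injective iB'
  rw [Subspace.dual_finrank_eq] at e1 e2
  exact ⟨iB, (LinearMap.injective_iff_surjective_of_finrank_eq_finrank
    (by rw [Subspace.dual_finrank_eq]; exact le_antisymm e1 e2)).1 iB⟩

/-- Eigenspaces of an isometry are orthogonal unless the product of the eigenvalues is 1. So X and Y
are isotropic and dual to each other, and Z is orthogonal to both. A basis of X with its dual basis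
in Y gives the pairs; the projection onto Z serves as `j`, because ε² = 1. -/
theorem hasHypSplit_of_eigenspaces [FiniteDimensional F V] (hs : s.IsAlt)
    (hnd : ∀ v, (∀ w, s v w = 0) → v = 0) {a : V →ₗ[F] V} (ha : PreservesForm s a) {θ ε : F}
    (hθ2 : θ * θ ≠ 1) (hε : ε * ε = 1) (X Y Z : Submodule F V)
    (hX : ∀ x ∈ X, a x = θ • x) (hY : ∀ x ∈ Y, a x = θ⁻¹ • x) (hZ : ∀ x ∈ Z, a x = ε • x)
    (htop : ∀ v, v ∈ X ⊔ Y ⊔ Z) : HasHypSplit s θ a (Module.finrank F X) := by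
  have hθ' : θ⁻¹ * θ⁻¹ ≠ 1 := by
    rw [← mul_inv]; simpa only [ne_eq, inv_eq_one] using hθ2
  have hθε : θ * ε ≠ 1 := fun h => hθ2 (by linear_combination (θ * ε + 1) * h - θ * θ * hε)
  have hθε' : θ⁻¹ * ε ≠ 1 := fun h => hθ' (by
    linear_combination (θ⁻¹ * ε + 1) * h - θ⁻¹ * θ⁻¹ * hε)
  have XX : ∀ x ∈ X, ∀ y ∈ X, s x y = 0 := fun x hx y hy =>
    ha.apply_eq_zero hθ2 (hX x hx) (hX y hy)
  have YY : ∀ x ∈ Y, ∀ y ∈ Y, s x y = 0 := fun x hx y hy =>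
    ha.apply_eq_zero hθ' (hY x hx) (hY y hy)
  have XZ : ∀ x ∈ X, ∀ y ∈ Z, s x y = 0 := fun x hx y hy =>
    ha.apply_eq_zero hθε (hX x hx) (hZ y hy)
  have YZ : ∀ x ∈ Y, ∀ y ∈ Z, s x y = 0 := fun x hx y hy =>
    ha.apply_eq_zero hθε' (hY x hx) (hZ y hy)
  have dec : ∀ v, ∃ x ∈ X, ∃ y ∈ Y, ∃ z ∈ Z, x + y + z = v := by
    intro v
    obtain ⟨t, ht, z, hz, rfl⟩ := Submodule.mem_sup.1 (htop v)
    obtain ⟨x, hx, y, hy, rfl⟩ := Submodule.mem_sup.1 ht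
    exact ⟨x, hx, y, hy, z, hz, rfl⟩
  have nX : ∀ x ∈ X, (∀ y ∈ Y, s x y = 0) → x = 0 := by
    intro x hx h
    refine hnd x fun w => ?_
    obtain ⟨x', hx', y, hy, z, hz, rfl⟩ := dec w
    simp [XX x hx x' hx', h y hy, XZ x hx z hz]
  have nY : ∀ y ∈ Y, (∀ x ∈ X, s x y = 0) → y = 0 := by
    intro y hy h
    refine hnd y fun w => ?_
    obtain ⟨x', hx', y', hy', z, hz, rfl⟩ := dec w
    simp [hs.swap y x', h x' hx', YY y hy y' hy', YZ y hy z hz]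
  let B : Y →ₗ[F] Module.Dual F X := (s.flip.domRestrict₁₂ Y X)
  have hB : ∀ y x, B y x = s x y := fun _ _ => rfl
  have sB : Function.Surjective B := (bijective_domRestrict₁₂ X Y nX nY).2
  let bX := Module.finBasis F X
  choose y hy using fun k => sB (bX.coord k)
  have hxy : ∀ i k, s (bX i) (y k) = if i = k then 1 else 0 := by
    intro i k
    rw [← hB, hy]
    simp [Finsupp.single_apply]
  have PX : ∀ v ∈ X, hypProj s (fun i => (bX i : V)) (fun i => (y i : V)) v = v := by
    intro v hv
    have h1 : ∀ i, s v (y i) = bX.repr ⟨v, hv⟩ i := by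
      intro i
      have := hB (y i) ⟨v, hv⟩
      rw [hy] at this
      exact this.symm
    have h2 : _ = v := congrArg Subtype.val (bX.sum_repr ⟨v, hv⟩)
    simp only [Submodule.coe_sum, Submodule.coe_smul] at h2
    simp only [hypProj, h1, XX v hv _ (bX _).2, zero_smul, sub_zero]
    exact h2
  have PY : ∀ v ∈ Y, hypProj s (fun i => (bX i : V)) (fun i => (y i : V)) v = v := by
    intro v hv
    have hm : hypProj s (fun i => (bX i : V)) (fun i => (y i : V)) v ∈ Y := by
      rw [hypProj]
      refine Submodule.sum_mem _ fun i _ => ?_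
      rw [YY v hv _ (y i).2, zero_smul, zero_sub]
      exact Y.neg_mem (Y.smul_mem _ (y i).2)
    refine sub_eq_zero.1 (nY _ (Y.sub_mem hm hv) ?_)
    have hb : ∀ k, s (bX k) (hypProj s (fun i => (bX i : V)) (fun i => (y i : V)) v - v) = 0 := by
      intro k
      simp [hypProj, YY v hv, hxy, hs.swap v (bX k)]
    intro x hx
    have h2 : _ = x := congrArg Subtype.val (bX.sum_repr ⟨x, hx⟩)
    rw [← h2]
    simp only [Submodule.coe_sum, Submodule.coe_smul, map_sum, LinearMap.sum_apply, map_smul,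
      LinearMap.smul_apply, hb, smul_zero, Finset.sum_const_zero]
  have PZ : ∀ v ∈ Z, hypProj s (fun i => (bX i : V)) (fun i => (y i : V)) v = 0 := by
    intro v hv
    simp [hypProj, hs.swap v, XZ _ (bX _).2 v hv, YZ _ (y _).2 v hv]
  let j : V →ₗ[F] V := LinearMap.id -
    ∑ i, ((s.flip (y i)).smulRight (bX i : V) - (s.flip (bX i)).smulRight (y i : V))
  have hj : ∀ v, j v = v - hypProj s (fun i => (bX i : V)) (fun i => (y i : V)) v := by
    intro v
    simp [j, hypProj]
  have jX : ∀ v ∈ X, j v = 0 := fun v hv => by rw [hj, PX v hv, sub_self]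
  have jY : ∀ v ∈ Y, j v = 0 := fun v hv => by rw [hj, PY v hv, sub_self]
  have jZ : ∀ v ∈ Z, j v = v := fun v hv => by rw [hj, PZ v hv, sub_zero]
  refine ⟨Fin (Module.finrank F X), inferInstance, inferInstance, by simp,
    ⟨⟨fun i => bX i, fun i => y i, j, fun i k => XX _ (bX i).2 _ (bX k).2,
      fun i k => YY _ (y i).2 _ (y k).2, hxy, fun i => hX _ (bX i).2, fun i => hY _ (y i).2,
      ?_, fun i => jX _ (bX i).2, fun i => jY _ (y i).2, ?_, ?_⟩⟩⟩
  · intro v w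
    obtain ⟨x, hx, y, hy, z, hz, rfl⟩ := dec v
    obtain ⟨x', hx', y', hy', z', hz', rfl⟩ := dec w
    simp only [map_add, jX x hx, jY y hy, jZ z hz, jX x' hx', jY y' hy', jZ z' hz', zero_add,
      LinearMap.add_apply, hs.swap z x', hs.swap z y', XZ x hx z' hz', YZ y hy z' hz',
      XZ x' hx' z hz, YZ y' hy' z hz]
    simp
  · intro v
    rw [← hj]
    obtain ⟨x, hx, y, hy, z, hz, rfl⟩ := dec v
    simp only [map_add, jX x hx, jY y hy, jZ z hz, zero_add]
  · intro v
    rw [← hj]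
    obtain ⟨x, hx, y, hy, z, hz, rfl⟩ := dec v
    simp only [map_add, hX x hx, hY y hy, hZ z hz, map_smul, jX x hx, jY y hy, jZ z hz, zero_add,
      smul_zero, smul_smul, hε, one_smul]

end eigenspaces

/-! ### The model space L × L and its factorization -/

section model

variable {F L : Type*} [Field F] [AddCommGroup L] [Module F L] {β : LinearMap.BilinForm F L}

@[simp] theorem modelForm_apply (p q : L × L) :
    modelForm β p q = β p.1 q.2 - β q.1 p.2 := rfl

theorem modelForm_isAlt : (modelForm β).IsAlt := fun p => by simp

theorem modelForm_nondegenerate (hβ : ∀ p q, β p q = β q p)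
    (hnd : ∀ p, (∀ q, β p q = 0) → p = 0) (v : L × L) (h : ∀ w, modelForm β v w = 0) :
    v = 0 := by
  refine Prod.ext (hnd _ fun q => ?_) (hnd _ fun q => ?_)
  · simpa using h (0, q)
  · have := h (q, 0)
    rw [hβ]
    simpa using this

/-- The factor `a` is the 2 × 2 scalar matrix with rows (0, -γ⁻¹) and (γ, α + α⁻¹), of determinant 1
and eigenvalues α, α⁻¹. Then b = a⁻¹u is block triangular with diagonal γ⁻¹, γ, and it is an
isometry because W is β-symmetric. Since α² and γ² differ from 1, both are diagonalizable, with
eigenspaces of dimension dim L. -/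
theorem hasFactorization_model [FiniteDimensional F L] (hβ : ∀ p q, β p q = β q p)
    (hnd : ∀ p, (∀ q, β p q = 0) → p = 0) (W : L →ₗ[F] L) (hW : ∀ p q, β (W p) q = β p (W q))
    (u : L × L →ₗ[F] L × L) (hu : ∀ p, u p = (-p.2, p.1 + W p.2)) {α γ : F}
    (hα : α ≠ 0) (hα2 : α * α ≠ 1) (hγ : γ ≠ 0) (hγ2 : γ * γ ≠ 1) :
    HasFactorization (modelForm β) u α γ (Module.finrank F L) := by
  have hα3 : α - α⁻¹ ≠ 0 := fun h => hα2 (by field_simp at h; linear_combination h)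
  have hγ3 : γ - γ⁻¹ ≠ 0 := fun h => hγ2 (by field_simp at h; linear_combination h)
  let a : L × L →ₗ[F] L × L := (-γ⁻¹ • LinearMap.snd F L L).prod
    (γ • LinearMap.fst F L L + (α + α⁻¹) • LinearMap.snd F L L)
  have ha : ∀ p, a p = (-γ⁻¹ • p.2, γ • p.1 + (α + α⁻¹) • p.2) := fun _ => rfl
  let b : L × L →ₗ[F] L × L := (γ⁻¹ • LinearMap.fst F L L +
    γ⁻¹ • W ∘ₗ LinearMap.snd F L L - (α + α⁻¹) • LinearMap.snd F L L).prod
    (γ • LinearMap.snd F L L)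
  have hb : ∀ p, b p = (γ⁻¹ • p.1 + γ⁻¹ • W p.2 - (α + α⁻¹) • p.2, γ • p.2) := fun _ => rfl
  have pa : PreservesForm (modelForm β) a := by
    rintro ⟨p, q⟩ ⟨p', q'⟩
    simp only [ha, modelForm_apply, map_add, map_smul, LinearMap.smul_apply, smul_eq_mul,
      hβ q' p, hβ q' q, hβ q p']
    field_simp
    ring
  have pb : PreservesForm (modelForm β) b := by
    rintro ⟨p, q⟩ ⟨p', q'⟩
    simp only [hb, modelForm_apply, map_add, map_sub, LinearMap.add_apply, LinearMap.sub_apply,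
      map_smul, LinearMap.smul_apply, smul_eq_mul, hβ q' q, hW q' q, hβ q' (W q), hW q q']
    field_simp
    ring
  have fr : ∀ g : L →ₗ[F] L × L, Function.Injective g →
      Module.finrank F (LinearMap.range g) = Module.finrank F L := fun g hg =>
    LinearMap.finrank_range_of_inj hg
  refine ⟨a, b, pa, pb, ?_, ?_, ?_⟩
  · rintro ⟨p, q⟩
    rw [hu, ha, hb]
    refine Prod.ext ?_ ?_
    · simp [smul_smul, hγ]
    · simp only [smul_add, smul_sub, smul_smul, mul_inv_cancel₀ hγ, one_smul]
      module
  · let g1 : L →ₗ[F] L × L := LinearMap.id.prod (-(α * γ) • LinearMap.id)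
    let g2 : L →ₗ[F] L × L := LinearMap.id.prod (-(α⁻¹ * γ) • LinearMap.id)
    have h1 : ∀ p, g1 p = (p, -(α * γ) • p) := fun _ => rfl
    have h2 : ∀ p, g2 p = (p, -(α⁻¹ * γ) • p) := fun _ => rfl
    rw [← fr g1 fun p q h => congrArg Prod.fst h]
    refine hasHypSplit_of_eigenspaces modelForm_isAlt (modelForm_nondegenerate hβ hnd) pa hα2
      (one_mul 1) (LinearMap.range g1) (LinearMap.range g2) ⊥ ?_ ?_ (by simp) ?_
    · rintro _ ⟨p, rfl⟩
      rw [h1, ha]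
      refine Prod.ext ?_ ?_ <;> dsimp only [Prod.smul_mk] <;> match_scalars <;> field_simp
      ring
    · rintro _ ⟨p, rfl⟩
      rw [h2, ha]
      refine Prod.ext ?_ ?_ <;> dsimp only [Prod.smul_mk] <;> match_scalars <;> field_simp
      ring
    · rintro ⟨p, q⟩
      rw [sup_bot_eq]
      refine Submodule.mem_sup.2 ⟨_, ⟨-(α - α⁻¹)⁻¹ • (γ⁻¹ • q + α⁻¹ • p), rfl⟩, _,
        ⟨(α - α⁻¹)⁻¹ • (γ⁻¹ • q + α • p), rfl⟩, ?_⟩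
      rw [h1, h2]
      have hα4 : α ^ 2 - 1 ≠ 0 := fun h => hα2 (by linear_combination h)
      refine Prod.ext ?_ ?_ <;> dsimp only [Prod.mk_add_mk] <;> match_scalars <;> field_simp <;>
        ring
  -- The γ-eigenspace of b is a graph over the second factor; the γ⁻¹-eigenspace is L × 0.
  · let g1 : L →ₗ[F] L × L :=
      ((γ - γ⁻¹)⁻¹ • (γ⁻¹ • W - (α + α⁻¹) • LinearMap.id)).prod LinearMap.id
    let g2 : L →ₗ[F] L × L := LinearMap.inl F L L
    have h1 : ∀ p, g1 p = ((γ - γ⁻¹)⁻¹ • (γ⁻¹ • W p - (α + α⁻¹) • p), p) := fun _ => rfl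
    rw [← fr g1 fun p q h => congrArg Prod.snd h]
    refine hasHypSplit_of_eigenspaces modelForm_isAlt (modelForm_nondegenerate hβ hnd) pb hγ2
      (one_mul 1) (LinearMap.range g1) (LinearMap.range g2) ⊥ ?_ ?_ (by simp) ?_
    · rintro _ ⟨p, rfl⟩
      rw [h1, hb]
      refine Prod.ext ?_ rfl
      have hγ4 : γ ^ 2 - 1 ≠ 0 := fun h => hγ2 (by linear_combination h)
      dsimp only [Prod.smul_mk]
      match_scalars <;> field_simp <;> ring
    · rintro _ ⟨p, rfl⟩
      simp [g2, hb]
    · rintro ⟨p, q⟩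
      rw [sup_bot_eq]
      refine Submodule.mem_sup.2 ⟨_, ⟨q, rfl⟩, _, ⟨p - (g1 q).1, rfl⟩, ?_⟩
      refine Prod.ext ?_ ?_
      · simp [g2]
      · simp [h1, g2]

end model

/-! ### Generic choice of scalars -/

section generic

variable {F : Type*} [Field F]

theorem exists_notMem_add_inv_notMem [Infinite F] (S T : Finset F) :
    ∃ m : F, m ≠ 0 ∧ m ∉ S ∧ m + m⁻¹ ∉ T := by
  classical
  open Polynomial in
  -- The condition m + m⁻¹ = t becomes m² - t m + 1 = 0. Each such quadratic is nonzero, as its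
  -- value at 0 is 1, so all exclusions together are the roots of one nonzero polynomial.
  let P : F[X] := X * (∏ t ∈ S, (X - C t)) * ∏ t ∈ T, (X ^ 2 - C t * X + 1)
  have hP : P ≠ 0 := by
    refine mul_ne_zero (mul_ne_zero Polynomial.X_ne_zero
      (Finset.prod_ne_zero_iff.2 fun t _ => Polynomial.X_sub_C_ne_zero t))
      (Finset.prod_ne_zero_iff.2 fun t _ h => ?_)
    simpa using congrArg (Polynomial.eval 0) h
  obtain ⟨m, hm⟩ : ∃ m, P.eval m ≠ 0 := by
    by_contra! h
    exact hP (Polynomial.funext fun m => by simpa using h m)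
  simp only [P, Polynomial.eval_mul, Polynomial.eval_X, Polynomial.eval_prod, ne_eq, mul_eq_zero,
    not_or, Finset.prod_eq_zero_iff, not_exists, not_and] at hm
  obtain ⟨⟨h0, h1⟩, h2⟩ := hm
  refine ⟨m, h0, fun h => h1 m h (by simp), fun h => h2 _ h ?_⟩
  simp only [Polynomial.eval_add, Polynomial.eval_sub, Polynomial.eval_pow, Polynomial.eval_X,
    Polynomial.eval_mul, Polynomial.eval_C, Polynomial.eval_one]
  field_simp
  ring

end generic

/-! ### An involution on a four-dimensional hyperbolic frame -/

section frame

variable {F V : Type*} [Field F] [AddCommGroup V] [Module F V] {s : LinearMap.BilinForm F V}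

/-- On ⟨X₁, X₂⟩ the map is a matrix of trace 0 and determinant -1, hence an involution, with the
parameter p free; on the dual plane ⟨Y₁, Y₂⟩ isometry imposes the transpose. -/
theorem exists_frame_involution (hs : s.IsAlt) {X₁ X₂ Y₁ Y₂ : V} (hXX : s X₁ X₂ = 0)
    (hYY : s Y₁ Y₂ = 0) (h11 : s X₁ Y₁ = 1) (h22 : s X₂ Y₂ = 1) (h12 : s X₁ Y₂ = 0)
    (h21 : s X₂ Y₁ = 0) (p : F) :
    ∃ i : V →ₗ[F] V, PreservesForm s i ∧ (∀ v, i (i v) = v) ∧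
      i X₁ = p • X₁ + (1 - p * p) • X₂ ∧ i X₂ = X₁ - p • X₂ ∧
      i Y₁ = p • Y₁ + Y₂ ∧ i Y₂ = (1 - p * p) • Y₁ - p • Y₂ ∧
      ∀ v, s v X₁ = 0 → s v X₂ = 0 → s v Y₁ = 0 → s v Y₂ = 0 → i v = v := by
  have k1 : s X₂ X₁ = 0 := by rw [hs.swap, hXX, neg_zero]
  have k2 : s Y₂ Y₁ = 0 := by rw [hs.swap, hYY, neg_zero]
  have k3 : s Y₁ X₁ = -1 := by rw [hs.swap, h11]
  have k4 : s Y₂ X₂ = -1 := by rw [hs.swap, h22]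
  have k5 : s Y₂ X₁ = 0 := by rw [hs.swap, h12, neg_zero]
  have k6 : s Y₁ X₂ = 0 := by rw [hs.swap, h21, neg_zero]
  have z1 := hs X₁
  have z2 := hs X₂
  have z3 := hs Y₁
  have z4 := hs Y₂
  let i : V →ₗ[F] V := LinearMap.id +
    (s.flip Y₁).smulRight ((p - 1) • X₁ + (1 - p * p) • X₂) +
    (s.flip Y₂).smulRight (X₁ - (p + 1) • X₂) -
    (s.flip X₁).smulRight ((p - 1) • Y₁ + Y₂) -
    (s.flip X₂).smulRight ((1 - p * p) • Y₁ - (p + 1) • Y₂)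
  have hi : ∀ v, i v = v + s v Y₁ • ((p - 1) • X₁ + (1 - p * p) • X₂) +
      s v Y₂ • (X₁ - (p + 1) • X₂) - s v X₁ • ((p - 1) • Y₁ + Y₂) -
      s v X₂ • ((1 - p * p) • Y₁ - (p + 1) • Y₂) := fun v => rfl
  have iX₁ : i X₁ = p • X₁ + (1 - p * p) • X₂ := by
    rw [hi, h11, h12, z1, hXX]; module
  have iX₂ : i X₂ = X₁ - p • X₂ := by
    rw [hi, h21, h22, k1, z2]; module
  have iY₁ : i Y₁ = p • Y₁ + Y₂ := by
    rw [hi, z3, hYY, k3, k6]; module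
  have iY₂ : i Y₂ = (1 - p * p) • Y₁ - p • Y₂ := by
    rw [hi, k2, z4, k5, k4]; module
  refine ⟨i, ?_, ?_, iX₁, iX₂, iY₁, iY₂, ?_⟩
  · intro v w
    simp only [hi, map_add, map_sub, map_smul, LinearMap.add_apply, LinearMap.sub_apply,
      LinearMap.smul_apply, smul_eq_mul, hXX, hYY, h11, h22, h12, h21, k1, k2, k3, k4, k5, k6,
      z1, z2, z3, z4, hs.swap X₁ w, hs.swap X₂ w, hs.swap Y₁ w, hs.swap Y₂ w]
    ring
  · intro v
    rw [hi v]
    simp only [map_add, map_sub, map_smul, iX₁, iX₂, iY₁, iY₂]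
    rw [hi v]
    module
  · intro v e1 e2 e3 e4
    rw [hi, e1, e2, e3, e4]; simp

/-- On ⟨X₁, X₂⟩ the product i a has determinant -lm and trace p(l - m). A suitable p makes its
eigenvalues 1 and -lm, so the two pairs for l and m are traded for one more pair for -lm and a plane
of fixed vectors. -/
theorem exists_involution_hasHypSplit [FiniteDimensional F V] (hs : s.IsAlt)
    (hnd : ∀ v, (∀ w, s v w = 0) → v = 0) {a : V →ₗ[F] V} (ha : PreservesForm s a) {l m : F}
    (hl : l ≠ 0) (hm : m ≠ 0) (hlm : l ≠ m) (hlm2 : (l * m) * (l * m) ≠ 1)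
    {X₁ X₂ Y₁ Y₂ : V} (hXX : s X₁ X₂ = 0)
    (hYY : s Y₁ Y₂ = 0) (h11 : s X₁ Y₁ = 1) (h22 : s X₂ Y₂ = 1) (h12 : s X₁ Y₂ = 0)
    (h21 : s X₂ Y₁ = 0) (aX₁ : a X₁ = l • X₁) (aX₂ : a X₂ = m • X₂) (aY₁ : a Y₁ = l⁻¹ • Y₁)
    (aY₂ : a Y₂ = m⁻¹ • Y₂) (A B : Submodule F V) (hA : ∀ v ∈ A, a v = (-(l * m)) • v)
    (hB : ∀ v ∈ B, a v = (-(l * m))⁻¹ • v)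
    (oA : ∀ v ∈ A, s v X₁ = 0 ∧ s v X₂ = 0 ∧ s v Y₁ = 0 ∧ s v Y₂ = 0)
    (oB : ∀ v ∈ B, s v X₁ = 0 ∧ s v X₂ = 0 ∧ s v Y₁ = 0 ∧ s v Y₂ = 0)
    (htop : ∀ S : Submodule F V, A ≤ S → B ≤ S → X₁ ∈ S → X₂ ∈ S → Y₁ ∈ S → Y₂ ∈ S → S = ⊤) :
    ∃ i : V →ₗ[F] V, PreservesForm s i ∧ (∀ v, i (i v) = v) ∧
      HasHypSplit s (-(l * m)) (i ∘ₗ a) (Module.finrank F A + 1) := by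
  have hlm' : l - m ≠ 0 := sub_ne_zero.2 hlm
  have hlm1 : 1 + l * m ≠ 0 := fun h => hlm2 (by linear_combination (l * m - 1) * h)
  -- This p gives trace 1 - lm = 1 + (-lm).
  obtain ⟨p, hp⟩ : ∃ p : F, p * (l - m) = 1 - l * m := ⟨(1 - l * m) / (l - m), by field_simp⟩
  obtain ⟨i, pi, ii, iX₁, iX₂, iY₁, iY₂, ifix⟩ :=
    exists_frame_involution hs hXX hYY h11 h22 h12 h21 p
  have hfix : ∀ v ∈ A, i v = v := fun v hv => by
    obtain ⟨e1, e2, e3, e4⟩ := oA v hv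
    exact ifix v e1 e2 e3 e4
  have hfix' : ∀ v ∈ B, i v = v := fun v hv => by
    obtain ⟨e1, e2, e3, e4⟩ := oB v hv
    exact ifix v e1 e2 e3 e4
  refine ⟨i, pi, ii, ?_⟩
  -- The condition on t is the characteristic equation of i a on ⟨X₁, X₂⟩; `EY` is its analogue on
  -- ⟨Y₁, Y₂⟩.
  have EX : ∀ t : F, t * t - p * (l - m) * t - l * m = 0 →
      i (a (m • X₁ + (t - l * p) • X₂)) = t • (m • X₁ + (t - l * p) • X₂) := by
    intro t ht
    simp only [map_add, map_smul, aX₁, aX₂, iX₁, iX₂]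
    linear_combination (norm := module) -(ht • X₂)
  have EY : ∀ t : F, l * m * t * t + p * (l - m) * t - 1 = 0 →
      i (a ((l * (t * m + p)) • Y₁ + m • Y₂)) = t • ((l * (t * m + p)) • Y₁ + m • Y₂) := by
    intro t ht
    have e1 : l * (t * m + p) * l⁻¹ = t * m + p := by field_simp
    have e2 : m * m⁻¹ = 1 := by field_simp
    simp only [map_add, map_smul, aY₁, aY₂, iY₁, iY₂]
    linear_combination (norm := module) (e1 • (p • Y₁ + Y₂)) +
      (e2 • ((1 - p * p) • Y₁ - p • Y₂)) - (ht • Y₁)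
  set α := -(l * m) with hα
  have hα0 : α ≠ 0 := neg_ne_zero.2 (mul_ne_zero hl hm)
  set x := m • X₁ + (α - l * p) • X₂ with hx
  set z := m • X₁ + (1 - l * p) • X₂ with hz
  set y := (l * (α⁻¹ * m + p)) • Y₁ + m • Y₂ with hy
  set t := (l * (1 * m + p)) • Y₁ + m • Y₂ with ht
  have hxe := EX α (by rw [hα]; linear_combination (l * m) * hp)
  have hze := EX 1 (by linear_combination - hp)
  have hte := EY 1 (by linear_combination hp)
  have hye := EY α⁻¹ (by
    have : l * m = -α := by rw [hα]; ring
    rw [hp, this]; field_simp; ring)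
  rw [← hx] at hxe
  rw [← hz] at hze
  rw [← hy] at hye
  rw [← ht] at hte
  have hxA : x ∉ A := fun h => by
    have := (oA x h).2.2.1
    simp [hx, h11, h21, hm] at this
  have fr : Module.finrank F (A ⊔ Submodule.span F {x} : Submodule F V) =
      Module.finrank F A + 1 := Submodule.finrank_sup_span_singleton hxA
  rw [← fr]
  refine hasHypSplit_of_eigenspaces hs hnd (fun v w => by
      simp only [LinearMap.comp_apply]; rw [pi, ha])
    (by rw [hα]; simpa using hlm2) (one_mul 1) _ (B ⊔ Submodule.span F {y})
    (Submodule.span F {z, t}) ?_ ?_ ?_ ?_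
  · have : A ⊔ Submodule.span F {x} ≤ LinearMap.ker (i ∘ₗ a - α • LinearMap.id) := by
      refine sup_le (fun v hv => ?_) ?_
      · simp [hA v hv, hfix v hv]
      · rw [Submodule.span_singleton_le_iff_mem]
        simp [hxe]
    intro v hv
    simpa [sub_eq_zero] using this hv
  · have : B ⊔ Submodule.span F {y} ≤ LinearMap.ker (i ∘ₗ a - α⁻¹ • LinearMap.id) := by
      refine sup_le (fun v hv => ?_) ?_
      · simp [hB v hv, hfix' v hv]
      · rw [Submodule.span_singleton_le_iff_mem]
        simp [hye]
    intro v hv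
    simpa [sub_eq_zero] using this hv
  · have : Submodule.span F {z, t} ≤ LinearMap.ker (i ∘ₗ a - (1 : F) • LinearMap.id) := by
      rw [Submodule.span_le, Set.insert_subset_iff, Set.singleton_subset_iff]
      constructor
      · simp [hze]
      · simp [hte]
    intro v hv
    simpa [sub_eq_zero] using this hv
  · set S := A ⊔ Submodule.span F {x} ⊔ (B ⊔ Submodule.span F {y}) ⊔ Submodule.span F {z, t}
    have mx : x ∈ S := Submodule.mem_sup_left (Submodule.mem_sup_left
      (Submodule.mem_sup_right (Submodule.mem_span_singleton_self x)))
    have my : y ∈ S := Submodule.mem_sup_left (Submodule.mem_sup_right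
      (Submodule.mem_sup_right (Submodule.mem_span_singleton_self y)))
    have mz : z ∈ S := Submodule.mem_sup_right (Submodule.subset_span (by simp))
    have mt : t ∈ S := Submodule.mem_sup_right (Submodule.subset_span (by simp))
    have hα1 : 1 - α ≠ 0 := by rw [hα]; simpa using hlm1
    have m2 : X₂ ∈ S := by
      have h : z - x = (1 - α) • X₂ := by rw [hx, hz]; module
      exact (S.smul_mem_iff hα1).1 (h ▸ S.sub_mem mz mx)
    have m1 : X₁ ∈ S := by
      have h : z - (1 - l * p) • X₂ = m • X₁ := by rw [hz]; module
      exact (S.smul_mem_iff hm).1 (h ▸ S.sub_mem mz (S.smul_mem _ m2))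
    have n1 : Y₁ ∈ S := by
      have h : t - y = (l * m * (1 - α⁻¹)) • Y₁ := by rw [hy, ht]; module
      refine (S.smul_mem_iff (mul_ne_zero (mul_ne_zero hl hm) fun h => hα1 ?_)).1
        (h ▸ S.sub_mem mt my)
      field_simp at h
      linear_combination -h
    have n2 : Y₂ ∈ S := by
      have h : t - (l * (1 * m + p)) • Y₁ = m • Y₂ := by rw [ht]; module
      exact (S.smul_mem_iff hm).1 (h ▸ S.sub_mem mt (S.smul_mem _ n1))
    have := htop S (le_sup_of_le_left (le_sup_of_le_left le_sup_left))
      (le_sup_of_le_left (le_sup_of_le_right le_sup_left)) m1 m2 n1 n2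
    intro v
    rw [this]
    trivial

end frame

/-! ### Anisotropic vectors of symmetric forms -/

section polarization

variable {F V : Type*} [Field F] [AddCommGroup V] [Module F V]

theorem exists_apply_self_ne_zero (h2 : (2 : F) ≠ 0) {β : LinearMap.BilinForm F V}
    (hβ : ∀ p q, β p q = β q p) {S : Submodule F V} {v w : V} (hv : v ∈ S) (hw : w ∈ S)
    (h : β v w ≠ 0) : ∃ x ∈ S, β x x ≠ 0 := by
  by_contra! H
  have h1 := H _ (S.add_mem hv hw)
  simp only [map_add, LinearMap.add_apply, H v hv, H w hw, hβ w v, zero_add, add_zero] at h1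
  exact h ((mul_eq_zero.1 (by linear_combination h1 : 2 * β v w = 0)).resolve_left h2)

/-- The first two steps of an orthogonal diagonalization: the second vector is found by polarization
inside the hyperplane orthogonal to the first. -/
theorem exists_orthogonal_pair [FiniteDimensional F V] (h2 : (2 : F) ≠ 0)
    {β : LinearMap.BilinForm F V} (hβ : ∀ p q, β p q = β q p)
    (hnd : ∀ p, (∀ q, β p q = 0) → p = 0) (hdim : 2 ≤ Module.finrank F V) :
    ∃ e₁ e₂, β e₁ e₁ ≠ 0 ∧ β e₂ e₂ ≠ 0 ∧ β e₁ e₂ = 0 := by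
  have : Nontrivial V := Module.nontrivial_of_finrank_pos (R := F) (by omega)
  obtain ⟨v, hv⟩ := exists_ne (0 : V)
  obtain ⟨w, hw⟩ : ∃ w, β v w ≠ 0 := by
    by_contra! h
    exact hv (hnd v h)
  obtain ⟨e₁, -, h1⟩ := exists_apply_self_ne_zero h2 hβ (Submodule.mem_top (x := v))
    (Submodule.mem_top (x := w)) hw
  have hf : β e₁ ≠ 0 := fun h => h1 (by rw [h]; rfl)
  have hk := Module.Dual.finrank_ker_add_one_of_ne_zero (f := β e₁) hf
  have : Nontrivial (LinearMap.ker (β e₁)) :=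
    Module.nontrivial_of_finrank_pos (R := F) (by omega)
  obtain ⟨⟨t, ht⟩, ht0⟩ := exists_ne (0 : LinearMap.ker (β e₁))
  have ht' : β e₁ t = 0 := ht
  obtain ⟨q, hq⟩ : ∃ q, β t q ≠ 0 := by
    by_contra! h
    exact ht0 (Subtype.ext (hnd t h))
  obtain ⟨e₂, h3, h4⟩ := exists_apply_self_ne_zero h2 hβ ht
    (w := q - (β e₁ q / β e₁ e₁) • e₁) (by simp [h1]) (by
      simpa [hβ t e₁, ht'] using hq)
  exact ⟨e₁, e₂, h1, h4, h3⟩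

end polarization

/-! ### The odd case: one extra involution -/

section five

variable {F L : Type*} [Field F] [AddCommGroup L] [Module F L] {β : LinearMap.BilinForm F L}

/-- The eigenvalues of b are γ⁻¹ on e⊥ × 0, γ on a graph over e⊥, and 1 on a plane. The condition
β(N e, e) = 0 rules out a Jordan block for the eigenvalue 1. -/
theorem hasHypSplit_triangular [FiniteDimensional F L] (hβ : ∀ p q, β p q = β q p)
    (hnd : ∀ p, (∀ q, β p q = 0) → p = 0) {e : L} (he : β e e ≠ 0) {γ : F} (hγ : γ ≠ 0)
    (hγ2 : γ * γ ≠ 1) {G H N : L →ₗ[F] L} (hGe : G e = e) (hHe : H e = e)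
    (hG : ∀ p, β p e = 0 → G p = γ⁻¹ • p) (hH : ∀ p, β p e = 0 → H p = γ • p)
    (hN : β (N e) e = 0) {b : L × L →ₗ[F] L × L} (hb : ∀ p, b p = (G p.1 + N p.2, H p.2))
    (pb : PreservesForm (modelForm β) b) :
    HasHypSplit (modelForm β) γ b (Module.finrank F L - 1) := by
  have hγ3 : γ - γ⁻¹ ≠ 0 := fun h => hγ2 (by field_simp at h; linear_combination h)
  have hγ1 : γ - 1 ≠ 0 := fun h => hγ2 (by linear_combination (γ + 1) * h)
  let π : L →ₗ[F] F := (β e e)⁻¹ • β.flip e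
  have hπ : ∀ p, π p = (β e e)⁻¹ * β p e := fun p => rfl
  have hπe : π e = 1 := by rw [hπ, inv_mul_cancel₀ he]
  have hπ0 : ∀ p, π p = 0 ↔ β p e = 0 := fun p => by simp [hπ, he]
  have hπN : π (N e) = 0 := (hπ0 _).2 hN
  have hG' : ∀ p, π p = 0 → G p = γ⁻¹ • p := fun p hp => hG p ((hπ0 p).1 hp)
  have hH' : ∀ p, π p = 0 → H p = γ • p := fun p hp => hH p ((hπ0 p).1 hp)
  have hk : ∀ p, π (p - π p • e) = 0 := fun p => by simp [hπe]
  -- The inverse of γ - G, so that (k (N p), p) is an eigenvector of b for γ.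
  let k : L →ₗ[F] L := (γ - γ⁻¹)⁻¹ • (LinearMap.id - π.smulRight e) + (γ - 1)⁻¹ • π.smulRight e
  have hkk : ∀ p, k p = (γ - γ⁻¹)⁻¹ • (p - π p • e) + (γ - 1)⁻¹ • π p • e := fun p => rfl
  have hGk : ∀ p, G (k p) + p = γ • k p := by
    intro p
    rw [hkk]
    simp only [map_add, map_smul (G), hGe, hG' _ (hk p)]
    linear_combination (norm := module) -((inv_mul_cancel₀ hγ3) • (p - π p • e)) -
      ((inv_mul_cancel₀ hγ1) • π p • e)
  let g1 : LinearMap.ker π →ₗ[F] L × L := (k ∘ₗ N ∘ₗ (LinearMap.ker π).subtype).prod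
    (LinearMap.ker π).subtype
  have h1 : ∀ p, g1 p = (k (N p), (p : L)) := fun p => rfl
  let g2 : LinearMap.ker π →ₗ[F] L × L := (LinearMap.inl F L L) ∘ₗ (LinearMap.ker π).subtype
  have h2 : ∀ p, g2 p = ((p : L), 0) := fun p => rfl
  have hfr : Module.finrank F L - 1 = Module.finrank F (LinearMap.range g1) := by
    rw [LinearMap.finrank_range_of_inj fun p q h => Subtype.ext (congrArg Prod.snd h)]
    have := Module.Dual.finrank_ker_add_one_of_ne_zero (f := π)
      (fun h => by rw [h] at hπe; simp at hπe)
    omega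
  rw [hfr]
  have hγ4 : 1 - γ⁻¹ ≠ 0 := fun h => hγ1 (by field_simp at h; linear_combination h)
  refine hasHypSplit_of_eigenspaces modelForm_isAlt (modelForm_nondegenerate hβ hnd) pb hγ2
    (one_mul 1) (LinearMap.range g1) (LinearMap.range g2)
    (Submodule.span F {((e, 0) : L × L), ((1 - γ⁻¹)⁻¹ • N e, e)}) ?_ ?_ ?_ ?_
  · rintro _ ⟨⟨p, hp⟩, rfl⟩
    rw [h1, hb]
    refine Prod.ext (hGk _) (hH' p hp)
  · rintro _ ⟨⟨p, hp⟩, rfl⟩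
    rw [h2, hb]
    refine Prod.ext ?_ ?_
    · simp [hG' p hp]
    · simp
  · have : Submodule.span F {((e, 0) : L × L), ((1 - γ⁻¹)⁻¹ • N e, e)} ≤
        LinearMap.ker (b - (1 : F) • LinearMap.id) := by
      rw [Submodule.span_le, Set.insert_subset_iff, Set.singleton_subset_iff]
      constructor
      · simp [hb, hGe]
      · simp only [SetLike.mem_coe, LinearMap.mem_ker, LinearMap.sub_apply, hb, map_smul (G),
          hG' _ hπN, hHe, one_smul, LinearMap.id_apply]
        refine Prod.ext ?_ ?_
        · dsimp only [Prod.fst_sub, Prod.fst_zero]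
          linear_combination (norm := module) -((inv_mul_cancel₀ hγ4) • N e)
        · simp
    intro v hv
    simpa [sub_eq_zero] using this hv
  · set S := LinearMap.range g1 ⊔ LinearMap.range g2 ⊔
      Submodule.span F {((e, 0) : L × L), ((1 - γ⁻¹)⁻¹ • N e, e)}
    have m1 : ((e, 0) : L × L) ∈ S := Submodule.mem_sup_right (Submodule.subset_span (by simp))
    have m2 : (((1 - γ⁻¹)⁻¹ • N e, e) : L × L) ∈ S :=
      Submodule.mem_sup_right (Submodule.subset_span (by simp))
    have m3 : ∀ p, ((p, 0) : L × L) ∈ S := by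
      intro p
      have : ((p, 0) : L × L) = g2 ⟨p - π p • e, hk p⟩ + π p • (e, 0) := by
        rw [h2]; simp
      rw [this]
      exact S.add_mem (Submodule.mem_sup_left (Submodule.mem_sup_right ⟨_, rfl⟩))
        (S.smul_mem _ m1)
    rintro ⟨p, q⟩
    have : ((p, q) : L × L) = g1 ⟨q - π q • e, hk q⟩ + π q • ((1 - γ⁻¹)⁻¹ • N e, e) +
        (p - k (N (q - π q • e)) - π q • (1 - γ⁻¹)⁻¹ • N e, 0) := by
      rw [h1]; refine Prod.ext ?_ ?_
      · dsimp only [Prod.mk_add_mk, Prod.smul_mk]; abel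
      · dsimp only [Prod.mk_add_mk, Prod.smul_mk]; abel
    rw [this]
    exact S.add_mem (S.add_mem (Submodule.mem_sup_left (Submodule.mem_sup_left ⟨_, rfl⟩))
        (S.smul_mem _ m2)) (m3 _)

/-- The scalar blocks of the previous factorization are modified on a plane ⟨e₁, e₂⟩. The factor b
acquires the eigenvalue 1 along e₁, and `a` acquires the eigenvalues l, m and their inverses in
place of α, α⁻¹ over the plane. With α = -lm, the frame involution then turns l, m into 1, α. Both
factors lose one pair, which makes the number of pairs even when dim L is odd. -/
theorem exists_involution_mul_model [Infinite F] [FiniteDimensional F L] (h2 : (2 : F) ≠ 0)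
    (hβ : ∀ p q, β p q = β q p) (hnd : ∀ p, (∀ q, β p q = 0) → p = 0) (W : L →ₗ[F] L)
    (hW : ∀ p q, β (W p) q = β p (W q)) (u : L × L →ₗ[F] L × L)
    (hu : ∀ p, u p = (-p.2, p.1 + W p.2)) (hdim : 2 ≤ Module.finrank F L) :
    ∃ (i a b : L × L →ₗ[F] L × L) (α γ : F), α ≠ 0 ∧ γ ≠ 0 ∧
      PreservesForm (modelForm β) i ∧ PreservesForm (modelForm β) a ∧
      PreservesForm (modelForm β) b ∧ (∀ v, i (i v) = v) ∧ (∀ v, u v = i (a (b v))) ∧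
      HasHypSplit (modelForm β) α a (Module.finrank F L - 1) ∧
      HasHypSplit (modelForm β) γ b (Module.finrank F L - 1) := by
  classical
  obtain ⟨e₁, e₂, hb1, hb2, h12⟩ := exists_orthogonal_pair h2 hβ hnd hdim
  have h21 : β e₂ e₁ = 0 := by rw [hβ, h12]
  set b₁ := β e₁ e₁
  set b₂ := β e₂ e₂
  set ω := b₁⁻¹ * β (W e₁) e₁ with hω
  obtain ⟨l, hl, hl1, hl2⟩ := exists_notMem_add_inv_notMem ({1, -1} : Finset F) {ω}
  set c := l + l⁻¹ - ω with hc
  have hc0 : c ≠ 0 := by simpa [hc, sub_eq_zero] using hl2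
  -- The exclusions on m give m ≠ m⁻¹, l ≠ m and (lm)² ≠ 1. Those on m + m⁻¹ give, in order, d ≠ 0,
  -- d ≠ c and γ² ≠ 1 for the γ defined below.
  obtain ⟨m, hm, hm1, hm2⟩ := exists_notMem_add_inv_notMem
    ({1, -1, l, l⁻¹, -l⁻¹} : Finset F) {ω, ω + c, ω + b₁ / (b₂ * c), ω - b₁ / (b₂ * c)}
  set d := m + m⁻¹ - ω with hd
  have hmd : m + m⁻¹ = ω + d := by rw [hd]; ring
  have hlc : l + l⁻¹ = ω + c := by rw [hc]; ring
  rw [hmd] at hm2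
  simp only [Finset.mem_insert, Finset.mem_singleton, not_or] at hl1 hm1 hm2
  obtain ⟨hm1a, hm1b, hm1c, hm1d, hm1e⟩ := hm1
  obtain ⟨hm2a, hm2b, hm2c, hm2d⟩ := hm2
  have hd0 : d ≠ 0 := by simpa using hm2a
  have hdc : d ≠ c := by simpa using hm2b
  -- This value is forced by the symmetry of β(W' p, H q), compared on e₁ and e₂; that symmetry
  -- makes `a` and `b` isometries.
  set γ := -b₁ / (b₂ * c * d) with hγdef
  have hγ : γ ≠ 0 := by
    rw [hγdef]
    exact div_ne_zero (neg_ne_zero.2 hb1) (mul_ne_zero (mul_ne_zero hb2 hc0) hd0)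
  have hγb : γ * b₂ * c * d = -b₁ := by rw [hγdef]; field_simp
  have hγ2 : γ * γ ≠ 1 := by
    intro h
    rcases mul_self_eq_one_iff.1 h with h | h
    · refine hm2d ?_
      rw [h] at hγb
      field_simp
      linear_combination hγb
    · refine hm2c ?_
      rw [h] at hγb
      field_simp
      linear_combination - hγb
  have hlm2 : (l * m) * (l * m) ≠ 1 := by
    intro h
    rcases mul_self_eq_one_iff.1 h with h | h
    · exact hm1d (eq_inv_of_mul_eq_one_right h)
    · refine hm1e ?_
      field_simp
      linear_combination h
  set α := -(l * m) with hα
  have hα0 : α ≠ 0 := neg_ne_zero.2 (mul_ne_zero hl hm)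
  have hα2 : α * α ≠ 1 := by rw [hα]; simpa using hlm2
  let π₁ : L →ₗ[F] F := b₁⁻¹ • β.flip e₁
  let π₂ : L →ₗ[F] F := b₂⁻¹ • β.flip e₂
  have hπ₁ : ∀ p, π₁ p = b₁⁻¹ * β p e₁ := fun p => rfl
  have hπ₂ : ∀ p, π₂ p = b₂⁻¹ * β p e₂ := fun p => rfl
  have p11 : π₁ e₁ = 1 := inv_mul_cancel₀ hb1
  have p22 : π₂ e₂ = 1 := inv_mul_cancel₀ hb2
  have p12 : π₁ e₂ = 0 := by rw [hπ₁, h21, mul_zero]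
  have p21 : π₂ e₁ = 0 := by rw [hπ₂, h12, mul_zero]
  have q1 : ∀ p, β p e₁ = b₁ * π₁ p := fun p => by rw [hπ₁]; field_simp
  have q2 : ∀ p, β p e₂ = b₂ * π₂ p := fun p => by rw [hπ₂]; field_simp
  have q1' : ∀ p, β e₁ p = b₁ * π₁ p := fun p => by rw [hβ, q1]
  have q2' : ∀ p, β e₂ p = b₂ * π₂ p := fun p => by rw [hβ, q2]
  let G : L →ₗ[F] L := γ⁻¹ • LinearMap.id + (1 - γ⁻¹) • π₁.smulRight e₁
  let H : L →ₗ[F] L := γ • LinearMap.id + (1 - γ) • π₁.smulRight e₁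
  have hG : ∀ p, G p = γ⁻¹ • p + (1 - γ⁻¹) • π₁ p • e₁ := fun p => rfl
  have hH : ∀ p, H p = γ • p + (1 - γ) • π₁ p • e₁ := fun p => rfl
  -- On the plane, W' has eigenvectors e₁ + c e₂ and e₁ + d e₂ for l + l⁻¹ and m + m⁻¹; on its
  -- complement it is the scalar α + α⁻¹. Its (e₁, e₁) coefficient is ω, as for W, so that (G W -
  -- W') e₁ is orthogonal to e₁.
  let W' : L →ₗ[F] L := (α + α⁻¹) • (LinearMap.id - π₁.smulRight e₁ - π₂.smulRight e₂) +
    π₁.smulRight (ω • e₁ - (c * d) • e₂) + π₂.smulRight (e₁ + (ω + c + d) • e₂)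
  have hW' : ∀ p, W' p = (α + α⁻¹) • (p - π₁ p • e₁ - π₂ p • e₂) +
    π₁ p • (ω • e₁ - (c * d) • e₂) + π₂ p • (e₁ + (ω + c + d) • e₂) := fun p => rfl
  have GH : ∀ p, G (H p) = p := by
    intro p
    rw [hG, hH]
    simp only [map_add, map_smul, p11, smul_eq_mul, mul_one]
    match_scalars <;> field_simp
    ring
  have HG : ∀ p, H (G p) = p := by
    intro p
    rw [hH, hG]
    simp only [map_add, map_smul, p11, smul_eq_mul, mul_one]
    match_scalars <;> field_simp
    ring
  have Gadj : ∀ p q, β (G p) q = β p (G q) := by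
    intro p q
    simp only [hG, map_add, map_smul, LinearMap.add_apply, LinearMap.smul_apply, smul_eq_mul,
      q1, q1']
    ring
  have Hadj : ∀ p q, β (H p) q = β p (H q) := by
    intro p q
    simp only [hH, map_add, map_smul, LinearMap.add_apply, LinearMap.smul_apply, smul_eq_mul,
      q1, q1']
    ring
  have W'adj : ∀ p q, β (W' p) (H q) = β (W' q) (H p) := by
    intro p q
    simp only [hW', hH, map_add, map_sub, map_smul, LinearMap.add_apply, LinearMap.sub_apply,
      LinearMap.smul_apply, smul_eq_mul, q1, q1', q2', p11, p12, hβ q p]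
    linear_combination (π₁ q * π₂ p - π₁ p * π₂ q) * hγb
  let a : L × L →ₗ[F] L × L := (-(G ∘ₗ LinearMap.snd F L L)).prod
    (H ∘ₗ LinearMap.fst F L L + H ∘ₗ W' ∘ₗ G ∘ₗ LinearMap.snd F L L)
  have ha : ∀ p, a p = (-G p.2, H p.1 + H (W' (G p.2))) := fun p => rfl
  let b : L × L →ₗ[F] L × L := (G ∘ₗ LinearMap.fst F L L +
    (G ∘ₗ W - W') ∘ₗ LinearMap.snd F L L).prod (H ∘ₗ LinearMap.snd F L L)
  have hb : ∀ p, b p = (G p.1 + (G ∘ₗ W - W') p.2, H p.2) := fun p => rfl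
  have hab : ∀ v, u v = a (b v) := by
    rintro ⟨p, q⟩
    rw [hu, ha, hb]
    refine Prod.ext ?_ ?_
    · simp [GH]
    · simp only [LinearMap.sub_apply, LinearMap.comp_apply, map_add, map_sub, HG, GH]
      abel
  have pa : PreservesForm (modelForm β) a := by
    rintro ⟨p, q⟩ ⟨p', q'⟩
    have h1 : β (G q) (H p') = β p' q := by rw [Gadj, GH, hβ]
    have h3 : β (G q') (H p) = β p q' := by rw [Gadj, GH, hβ]
    have h4 : β (G q) (H (W' (G q'))) = β (G q') (H (W' (G q))) := by
      rw [← Hadj, hβ, W'adj, hβ, Hadj]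
    simp only [ha, modelForm_apply, map_add, map_neg, LinearMap.neg_apply, h1, h3, h4]
    ring
  have pb : PreservesForm (modelForm β) b := by
    rintro ⟨p, q⟩ ⟨p', q'⟩
    have h1 : ∀ x y, β (G x) (H y) = β x y := fun x y => by rw [Gadj, GH]
    simp only [hb, modelForm_apply, map_add, map_sub, LinearMap.add_apply, LinearMap.sub_apply,
      LinearMap.comp_apply, h1, W'adj q' q, hW q' q, hβ q' (W q)]
    ring
  have hbs : HasHypSplit (modelForm β) γ b (Module.finrank F L - 1) := by
    refine hasHypSplit_triangular (e := e₁) (G := G) (H := H) (N := G ∘ₗ W - W') hβ hnd hb1 hγ hγ2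
      ?_ ?_ ?_ ?_ ?_ hb pb
    · rw [hG, p11]; module
    · rw [hH, p11]; module
    · intro p hp
      rw [hG, hπ₁, hp]; simp
    · intro p hp
      rw [hH, hπ₁, hp]; simp
    · have h1 : π₁ (W e₁) = ω := rfl
      rw [q1]
      simp only [LinearMap.sub_apply, LinearMap.comp_apply, hW', hG, p11, p12, p21, h1,
        map_add, map_sub, map_smul, smul_eq_mul]
      ring
  set f₁ := e₁ + c • e₂ with hf₁
  set f₂ := e₁ + d • e₂ with hf₂
  have W'f₁ : W' f₁ = (l + l⁻¹) • f₁ := by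
    rw [hlc, hW', hf₁]
    simp only [map_add, map_smul, p11, p12, p21, p22, smul_eq_mul]
    module
  have W'f₂ : W' f₂ = (m + m⁻¹) • f₂ := by
    rw [hmd, hW', hf₂]
    simp only [map_add, map_smul, p11, p12, p21, p22, smul_eq_mul]
    module
  -- An eigenvector of W' for t + t⁻¹ lifts to an eigenvector of `a` for t, and likewise for t⁻¹.
  have aeig : ∀ (t : F) (f : L), t ≠ 0 → W' f = (t + t⁻¹) • f →
      a (f, -t • H f) = t • ((f, -t • H f) : L × L) := by
    intro t f ht hf
    rw [ha]
    simp only [map_smul, GH, hf]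
    refine Prod.ext ?_ ?_
    · dsimp only [Prod.smul_mk]; module
    · dsimp only [Prod.smul_mk]; match_scalars; field_simp; ring
  have H12 : β f₁ (H f₂) = 0 := by
    simp only [hf₁, hf₂, hH, map_add, map_smul, LinearMap.add_apply, LinearMap.smul_apply,
      smul_eq_mul, q1, q2, p11, p12, p21, p22]
    linear_combination hγb
  have H21 : β f₂ (H f₁) = 0 := by rw [← Hadj, hβ, H12]
  have H11 : d * β f₁ (H f₁) = b₁ * (d - c) := by
    simp only [hf₁, hH, map_add, map_smul, LinearMap.add_apply, LinearMap.smul_apply,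
      smul_eq_mul, q1, q2, p11, p12, p21, p22]
    linear_combination c * hγb
  have H22 : c * β f₂ (H f₂) = b₁ * (c - d) := by
    simp only [hf₂, hH, map_add, map_smul, LinearMap.add_apply, LinearMap.smul_apply,
      smul_eq_mul, q1, q2, p11, p12, p21, p22]
    linear_combination d * hγb
  have H11' : β f₁ (H f₁) ≠ 0 := fun h => by
    rw [h, mul_zero] at H11
    exact mul_ne_zero hb1 (sub_ne_zero.2 hdc) H11.symm
  have H22' : β f₂ (H f₂) ≠ 0 := fun h => by
    rw [h, mul_zero] at H22
    exact mul_ne_zero hb1 (sub_ne_zero.2 hdc.symm) H22.symm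
  have hll : l - l⁻¹ ≠ 0 := fun h => by
    field_simp at h
    rcases mul_self_eq_one_iff.1 (by linear_combination h : l * l = 1) with h | h
    · exact hl1.1 h
    · exact hl1.2 h
  have hmm : m - m⁻¹ ≠ 0 := fun h => by
    field_simp at h
    rcases mul_self_eq_one_iff.1 (by linear_combination h : m * m = 1) with h | h
    · exact hm1a h
    · exact hm1b h
  have hαα : α - α⁻¹ ≠ 0 := fun h => hα2 (by field_simp at h; linear_combination h)
  let L₃ : Submodule F L := LinearMap.ker (π₁.prod π₂)
  have hL₃ : ∀ p ∈ L₃, π₁ p = 0 ∧ π₂ p = 0 := fun p hp => by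
    have h : ((π₁ p, π₂ p) : F × F) = 0 := hp
    exact ⟨congrArg Prod.fst h, congrArg Prod.snd h⟩
  have frL : Module.finrank F L₃ + 2 = Module.finrank F L := by
    have hsurj : LinearMap.range (π₁.prod π₂) = ⊤ := by
      rw [LinearMap.range_eq_top]
      rintro ⟨x, y⟩
      exact ⟨x • e₁ + y • e₂, by simp [p11, p12, p21, p22]⟩
    have h := LinearMap.finrank_range_add_finrank_ker (π₁.prod π₂)
    rw [hsurj, finrank_top, Module.finrank_prod, Module.finrank_self] at h
    change Module.finrank F (LinearMap.ker (π₁.prod π₂)) + 2 = _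
    omega
  have W'L : ∀ p ∈ L₃, W' p = (α + α⁻¹) • p := fun p hp => by
    rw [hW', (hL₃ p hp).1, (hL₃ p hp).2]; simp
  have HL : ∀ p ∈ L₃, H p = γ • p := fun p hp => by
    rw [hH, (hL₃ p hp).1]; simp
  have oL₁ : ∀ p ∈ L₃, β p (H f₁) = 0 := fun p hp => by
    rw [← Hadj, HL p hp, hf₁]
    simp [q1, q2, (hL₃ p hp).1, (hL₃ p hp).2]
  have oL₂ : ∀ p ∈ L₃, β p (H f₂) = 0 := fun p hp => by
    rw [← Hadj, HL p hp, hf₂]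
    simp [q1, q2, (hL₃ p hp).1, (hL₃ p hp).2]
  have hS : ∀ (t t' : F) (f g : L), modelForm β (f, -t • H f) (g, -t' • H g) =
      (t - t') * β f (H g) := by
    intro t t' f g
    have : β g (H f) = β f (H g) := by rw [← Hadj, hβ]
    simp only [modelForm_apply, map_smul, smul_eq_mul, this]
    ring
  let gr (t : F) : L₃ →ₗ[F] L × L := L₃.subtype.prod (-t • H ∘ₗ L₃.subtype)
  have hgr : ∀ t p, gr t p = ((p : L), -t • H p) := fun t p => rfl
  -- The pairing of the l- and l⁻¹-eigenvectors over f₁; dividing by it normalizes the frame.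
  set κ₁ := (l - l⁻¹) * β f₁ (H f₁)
  set κ₂ := (m - m⁻¹) * β f₂ (H f₂)
  have hκ₁ : κ₁ ≠ 0 := mul_ne_zero hll H11'
  have hκ₂ : κ₂ ≠ 0 := mul_ne_zero hmm H22'
  have orth : ∀ t, ∀ v ∈ LinearMap.range (gr t),
      modelForm β v (f₁, -l • H f₁) = 0 ∧ modelForm β v (f₂, -m • H f₂) = 0 ∧
      modelForm β v (κ₁⁻¹ • (f₁, -l⁻¹ • H f₁)) = 0 ∧
      modelForm β v (κ₂⁻¹ • (f₂, -m⁻¹ • H f₂)) = 0 := by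
    rintro t _ ⟨p, rfl⟩
    rw [hgr, map_smul, map_smul, hS, hS, hS, hS, oL₁ p p.2, oL₂ p p.2]
    simp
  obtain ⟨i, pi, ii, hi⟩ := exists_involution_hasHypSplit (X₁ := (f₁, -l • H f₁))
    (X₂ := (f₂, -m • H f₂)) (Y₁ := κ₁⁻¹ • (f₁, -l⁻¹ • H f₁)) (Y₂ := κ₂⁻¹ • (f₂, -m⁻¹ • H f₂))
    modelForm_isAlt (modelForm_nondegenerate hβ hnd) pa hl hm (Ne.symm hm1c) hlm2
    (by rw [hS, H12, mul_zero])
    (by rw [map_smul, map_smul, LinearMap.smul_apply, hS, H12]; simp)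
    (by rw [map_smul, hS]; exact inv_mul_cancel₀ hκ₁)
    (by rw [map_smul, hS]; exact inv_mul_cancel₀ hκ₂)
    (by rw [map_smul, hS, H12]; simp) (by rw [map_smul, hS, H21]; simp)
    (aeig l f₁ hl W'f₁) (aeig m f₂ hm W'f₂)
    (by rw [map_smul, aeig l⁻¹ f₁ (inv_ne_zero hl) (by rw [inv_inv, W'f₁, add_comm]), smul_comm])
    (by rw [map_smul, aeig m⁻¹ f₂ (inv_ne_zero hm) (by rw [inv_inv, W'f₂, add_comm]), smul_comm])
    (LinearMap.range (gr α)) (LinearMap.range (gr α⁻¹))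
    (by rintro _ ⟨p, rfl⟩; exact aeig α p hα0 (W'L p p.2))
    (by
      rintro _ ⟨p, rfl⟩
      exact aeig α⁻¹ p (inv_ne_zero hα0) (by rw [inv_inv, W'L p p.2, add_comm]))
    (orth _) (orth _) (by
      intro S hA hB m1 m2 m3 m4
      rw [S.smul_mem_iff (inv_ne_zero hκ₁)] at m3
      rw [S.smul_mem_iff (inv_ne_zero hκ₂)] at m4
      let Q : Submodule F L := S.comap (LinearMap.inl F L L) ⊓ S.comap (LinearMap.inr F L L ∘ₗ H)
      have key : ∀ (t : F) (f : L), t - t⁻¹ ≠ 0 → ((f, -t • H f) : L × L) ∈ S →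
          ((f, -t⁻¹ • H f) : L × L) ∈ S → f ∈ Q := by
        intro t f ht h1 h2
        have h3 : ((0, H f) : L × L) ∈ S := by
          rw [← S.smul_mem_iff ht]
          convert S.sub_mem h2 h1 using 1
          refine Prod.ext ?_ ?_
          · simp
          · dsimp only [Prod.mk_sub_mk, Prod.smul_mk]; module
        refine ⟨?_, h3⟩
        have h4 : ((f, 0) : L × L) = (f, -t • H f) + t • (0, H f) := by simp
        change ((f, 0) : L × L) ∈ S
        rw [h4]
        exact S.add_mem h1 (S.smul_mem _ h3)
      have n1 : f₁ ∈ Q := key l f₁ hll m1 m3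
      have n2 : f₂ ∈ Q := key m f₂ hmm m2 m4
      have n3 : ∀ p ∈ L₃, p ∈ Q := fun p hp =>
        key α p hαα (hA ⟨⟨p, hp⟩, rfl⟩) (hB ⟨⟨p, hp⟩, rfl⟩)
      have k2 : e₂ ∈ Q := by
        rw [← Q.smul_mem_iff (sub_ne_zero.2 hdc)]
        convert Q.sub_mem n2 n1 using 1
        rw [hf₁, hf₂]; module
      have k1 : e₁ ∈ Q := by
        have : e₁ = f₁ - c • e₂ := by rw [hf₁]; module
        rw [this]
        exact Q.sub_mem n1 (Q.smul_mem _ k2)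
      have hQ : ∀ p, p ∈ Q := by
        intro p
        have h1 : p - π₁ p • e₁ - π₂ p • e₂ ∈ L₃ := by
          simp [L₃, p11, p12, p21, p22]
        have h2 : p = (p - π₁ p • e₁ - π₂ p • e₂) + π₁ p • e₁ + π₂ p • e₂ := by abel
        rw [h2]
        exact Q.add_mem (Q.add_mem (n3 _ h1) (Q.smul_mem _ k1)) (Q.smul_mem _ k2)
      rw [eq_top_iff]
      rintro ⟨p, q⟩ -
      have h1 : ((p, 0) : L × L) ∈ S := (hQ p).1
      have h2 : ((0, H (G q)) : L × L) ∈ S := (hQ (G q)).2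
      rw [HG] at h2
      simpa using S.add_mem h1 h2)
  have hfr : Module.finrank F (LinearMap.range (gr α)) + 1 = Module.finrank F L - 1 := by
    rw [LinearMap.finrank_range_of_inj fun p q h => Subtype.ext (congrArg Prod.fst h)]
    omega
  rw [hfr] at hi
  refine ⟨i, i ∘ₗ a, b, α, γ, hα0, hγ, pi, fun v w => ?_, pb, ii, fun v => ?_, hi, hbs⟩
  · simp only [LinearMap.comp_apply]
    rw [pi, pa]
  · simp only [LinearMap.comp_apply]
    rw [ii, hab]

end five

/-! ### Hyperbolic extensions to E × E* -/

/-- The hyperbolic form on `E × Dual E`. -/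
def hypForm (F E : Type*) [Field F] [AddCommGroup E] [Module F E] :
    LinearMap.BilinForm F (E × Module.Dual F E) :=
  ((Module.Dual.eval F E).compl₁₂ (LinearMap.fst F E (Module.Dual F E))
    (LinearMap.snd F E (Module.Dual F E))) -
  ((Module.Dual.eval F E).compl₁₂ (LinearMap.fst F E (Module.Dual F E))
    (LinearMap.snd F E (Module.Dual F E))).flip

/-- The hyperbolic extension of an automorphism of `E` to `E × Dual E`. -/
def hypMap {F E : Type*} [Field F] [AddCommGroup E] [Module F E] (g : E ≃ₗ[F] E) :
    E × Module.Dual F E →ₗ[F] E × Module.Dual F E :=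
  g.toLinearMap.prodMap g.symm.toLinearMap.dualMap

section hyperbolic

variable {F E : Type*} [Field F] [AddCommGroup E] [Module F E]

@[simp] theorem hypForm_apply (p q : E × Module.Dual F E) :
    hypForm F E p q = q.2 p.1 - p.2 q.1 := rfl

theorem hypForm_isAlt : (hypForm F E).IsAlt := fun p => by simp

theorem hypMap_apply (g : E ≃ₗ[F] E) (p : E × Module.Dual F E) :
    hypMap g p = (g p.1, p.2 ∘ₗ g.symm.toLinearMap) := rfl

theorem preservesForm_hypMap (g : E ≃ₗ[F] E) : PreservesForm (hypForm F E) (hypMap g) := by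
  intro p q
  simp [hypMap_apply]

theorem isReversible_hypMap {g : E ≃ₗ[F] E} {σ : E →ₗ[F] E} (hσ : ∀ v, σ (σ v) = v)
    (hg : ∀ v, σ (g (σ (g v))) = v) : IsReversible (hypForm F E) (hypMap g) := by
  refine ⟨σ.prodMap σ.dualMap, fun p q => ?_, fun p => ?_, fun p => ?_⟩
  · simp
  · refine Prod.ext ?_ (LinearMap.ext fun v => ?_)
    · simp [hσ]
    · simp [hσ]
  · have hg' : ∀ v, g.symm (σ (g.symm (σ v))) = v := by
      intro v
      rw [LinearEquiv.symm_apply_eq]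
      have := hg (g.symm (σ v))
      rw [g.apply_symm_apply, hσ] at this
      rw [← this, hσ]
    refine Prod.ext ?_ (LinearMap.ext fun v => ?_)
    · simp [hypMap_apply, hg]
    · simp [hypMap_apply, hg']

/-- C preserves the decomposition E = Fx ⊕ ker φ, and σ is a reversal of C on ker φ. The pair is (x,
0), (0, φ), and σ acts on the dual through its transpose. -/
theorem hasHypSplit_hypMap {C : E ≃ₗ[F] E} {θ : F} (hθ : θ ≠ 0) {x : E} {φ : Module.Dual F E}
    (hx : φ x = 1) (hCx : C x = θ • x) (hφ : ∀ v, φ (C v) = θ * φ v) {σ : E →ₗ[F] E}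
    (hσx : σ x = 0) (hφσ : ∀ v, φ (σ v) = 0) (hσσ : ∀ v, σ (σ v) = v - φ v • x)
    (hσC : ∀ v, σ (C (σ (C v))) = v - φ v • x) : HasHypSplit (hypForm F E) θ (hypMap C) 1 := by
  have hC' : ∀ v, φ (C.symm v) = θ⁻¹ * φ v := fun v => by
    have := hφ (C.symm v)
    rw [C.apply_symm_apply] at this
    rw [this]; field_simp
  have h1 : ∀ v, C (σ (C v)) = σ v := by
    intro v
    have h := congrArg σ (hσC v)
    rw [hσσ, hφ, hφσ, mul_zero, zero_smul, sub_zero, map_sub, map_smul, hσx, smul_zero,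
      sub_zero] at h
    exact h
  have h2 : ∀ v, C.symm (σ (C.symm (σ v))) = v - φ v • x := by
    intro v
    rw [← hσσ, LinearEquiv.symm_apply_eq]
    have := h1 (C.symm (σ v))
    rw [C.apply_symm_apply] at this
    exact this.symm
  have hP : ∀ p, hypProj (hypForm F E) (fun _ : Unit => ((x, 0) : E × Module.Dual F E))
      (fun _ => (0, φ)) p = (φ p.1 • x, p.2 x • φ) := by
    intro p
    simp [hypProj]
  refine ⟨Unit, inferInstance, inferInstance, by simp, ⟨⟨fun _ => (x, 0), fun _ => (0, φ),
    σ.prodMap σ.dualMap, by simp, by simp, by simp [hx], ?_, ?_, ?_, ?_, ?_, ?_, ?_⟩⟩⟩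
  · intro _; simp [hypMap_apply, hCx]
  · intro _
    refine Prod.ext ?_ (LinearMap.ext fun v => ?_)
    · simp [hypMap_apply]
    · simp [hypMap_apply, hC']
  · intro p q; simp
  · intro _; simp [hσx]
  · intro _
    refine Prod.ext ?_ (LinearMap.ext fun v => ?_)
    · simp
    · simp [hφσ]
  · intro p
    rw [hP]
    refine Prod.ext ?_ (LinearMap.ext fun v => ?_)
    · simp [hσσ]
    · simp [hσσ, mul_comm]
  · intro p
    rw [hP]
    refine Prod.ext ?_ (LinearMap.ext fun v => ?_)
    · simp [hypMap_apply, hσC]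
    · simp [hypMap_apply, h2, mul_comm]

/-- Let C agree with g modulo the fixed line Fx, but multiply φ and x by α⁻¹. Then g C⁻¹ is the
identity plus a rank-one map onto Fx, with eigenvalue α on x. On a complement of Fx, the first
factor is the identity, and C looks like g on E/Fx, where σ still reverses it since σ preserves Fx.
-/
theorem hasFactorization_hypMap [FiniteDimensional F E] {g : E ≃ₗ[F] E} {σ : E →ₗ[F] E}
    (hσ : ∀ v, σ (σ v) = v) (hg : ∀ v, σ (g (σ (g v))) = v) {x : E} (hx : x ≠ 0)
    (hgx : g x = x) {c : F} (hσx : σ x = c • x) {α : F} (hα : α ≠ 0) (hα1 : α ≠ 1) :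
    HasFactorization (hypForm F E) (hypMap g) α α 1 := by
  obtain ⟨φ, hφ⟩ : ∃ φ : Module.Dual F E, φ x = 1 := by
    obtain ⟨f, hf⟩ : ∃ f : Module.Dual F E, f x ≠ 0 := by
      by_contra! h
      exact hx ((Module.forall_dual_apply_eq_zero_iff F x).1 h)
    exact ⟨(f x)⁻¹ • f, by simp [hf]⟩
  let C₀ : E →ₗ[F] E := g.toLinearMap - (φ ∘ₗ g.toLinearMap).smulRight x + (α⁻¹ • φ).smulRight x
  have hC₀ : ∀ v, C₀ v = g v - φ (g v) • x + (α⁻¹ * φ v) • x := fun v => rfl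
  have hφC₀ : ∀ v, φ (C₀ v) = α⁻¹ * φ v := fun v => by simp [hC₀, hφ]
  have iC : Function.Injective C₀ := by
    rw [injective_iff_map_eq_zero]
    intro v hv
    have h1 : φ v = 0 := by
      have := hφC₀ v
      rw [hv, map_zero] at this
      simpa [hα] using this.symm
    rw [hC₀, h1, mul_zero, zero_smul, add_zero, sub_eq_zero] at hv
    have h2 : v = φ (g v) • x := by
      apply g.injective
      rw [map_smul, hgx, hv]
      simp [hφ]
    have h3 := h1
    rw [h2, map_smul, hφ, smul_eq_mul, mul_one] at h3
    rw [h2, h3, zero_smul]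
  let C : E ≃ₗ[F] E := LinearEquiv.ofInjectiveEndo C₀ iC
  have hC : ∀ v, C v = g v - φ (g v) • x + (α⁻¹ * φ v) • x := fun v => rfl
  have hφC : ∀ v, φ (C v) = α⁻¹ * φ v := hφC₀
  have hCx : C x = α⁻¹ • x := by rw [hC, hgx, hφ]; simp
  let A : E ≃ₗ[F] E := C.symm.trans g
  have hAC : ∀ v, A (C v) = g v := fun v => by simp [A]
  have hAx : A x = α • x := by
    have := hAC x
    rw [hCx, map_smul, hgx] at this
    conv_rhs => rw [← this]
    rw [smul_smul, mul_inv_cancel₀ hα, one_smul]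
  let ψ : Module.Dual F E := (φ ∘ₗ g.toLinearMap - α⁻¹ • φ) ∘ₗ C.symm.toLinearMap
  have hψ : ∀ v, ψ (C v) = φ (g v) - α⁻¹ * φ v := fun v => by simp [ψ]
  -- A is a homology: it scales x by α and fixes the hyperplane ker ψ, which does not contain x
  -- because ψ x = α - 1.
  have hA : ∀ v, A v = v + ψ v • x := by
    intro v
    obtain ⟨t, rfl⟩ := C.surjective v
    rw [hAC, hψ, hC]; module
  have hψx : ψ x = α - 1 := by
    have h := hA x
    rw [hAx] at h
    have := congrArg φ h
    simp only [map_add, map_smul, hφ, smul_eq_mul, mul_one] at this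
    linear_combination -this
  have hα1' : α - 1 ≠ 0 := sub_ne_zero.2 hα1
  refine ⟨hypMap A, hypMap C, preservesForm_hypMap A, preservesForm_hypMap C, ?_, ?_, ?_⟩
  · intro p
    refine Prod.ext ?_ (LinearMap.ext fun v => ?_)
    · simp [hypMap_apply, hAC]
    · simp [hypMap_apply, A]
  · have h1 : ∀ v, (α - 1)⁻¹ * ψ v * (α - 1) = ψ v := fun v => by field_simp
    refine hasHypSplit_hypMap hα (x := x) (φ := (α - 1)⁻¹ • ψ)
      (σ := LinearMap.id - ((α - 1)⁻¹ • ψ).smulRight x) ?_ hAx ?_ ?_ ?_ ?_ ?_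
    · simp [hψx, hα1']
    · intro v
      rw [hA]
      simp only [LinearMap.smul_apply, map_add, map_smul, hψx, smul_eq_mul]
      ring
    · simp [hψx, hα1']
    · intro v
      simp only [LinearMap.smul_apply, LinearMap.sub_apply, LinearMap.id_apply,
        LinearMap.smulRight_apply, map_sub, map_smul, hψx, smul_eq_mul]
      linear_combination -(h1 v) * (α - 1)⁻¹
    · intro v
      simp only [LinearMap.smul_apply, LinearMap.sub_apply, LinearMap.id_apply,
        LinearMap.smulRight_apply, map_sub, map_smul, hψx, smul_eq_mul]
      match_scalars
      · ring
      · field_simp; ring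
    · intro v
      simp only [LinearMap.smul_apply, LinearMap.sub_apply, LinearMap.id_apply,
        LinearMap.smulRight_apply, map_sub, map_add, map_smul, hA, hψx, smul_eq_mul]
      match_scalars
      · ring
      · field_simp; ring
  · refine HasHypSplit.inv hypForm_isAlt ?_
    -- Projection onto ker φ along x. As g and σ preserve Fx, compressing them by Q amounts to
    -- working in E/Fx.
    let Q : E →ₗ[F] E := LinearMap.id - φ.smulRight x
    have hQ : ∀ v, Q v = v - φ v • x := fun v => rfl
    have Qx : Q x = 0 := by rw [hQ, hφ]; simp
    have φQ : ∀ v, φ (Q v) = 0 := fun v => by simp [hQ, hφ]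
    have QσQ : ∀ v, Q (σ (Q v)) = Q (σ v) := fun v => by
      rw [hQ v, map_sub, map_sub, map_smul, hσx]; simp [Qx]
    have QgQ : ∀ v, Q (g (Q v)) = Q (g v) := fun v => by
      rw [hQ v, map_sub, map_sub, map_smul, hgx]; simp [Qx]
    have QC : ∀ v, Q (C v) = Q (g v) := fun v => by
      rw [hC, map_add, map_sub, map_smul, map_smul, Qx]; simp
    refine hasHypSplit_hypMap (inv_ne_zero hα) (x := x) (φ := φ) (σ := Q ∘ₗ σ ∘ₗ Q) hφ hCx hφC
      ?_ ?_ ?_ ?_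
    · simp [Qx]
    · intro v; simp [φQ]
    · intro v
      simp only [LinearMap.comp_apply]
      rw [QσQ, QσQ, hσ, hQ (Q v), φQ, zero_smul, sub_zero, hQ]
    · intro v
      simp only [LinearMap.comp_apply]
      rw [QC v, QσQ (g v), QC (Q _), QgQ, QσQ, hg, hQ]

end hyperbolic

/-! ### Invariant orthogonal splittings, model spaces and hyperbolic spaces -/

section splitting

variable {F V : Type*} [Field F] [AddCommGroup V] [Module F V] {s : LinearMap.BilinForm F V}

theorem PreservesForm.symm {u : V ≃ₗ[F] V} (hu : PreservesForm s u.toLinearMap) (x y : V) :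
    s (u.symm x) y = s x (u y) := by
  have := hu (u.symm x) y
  simpa using this.symm

theorem PreservesForm.symm_right {u : V ≃ₗ[F] V} (hu : PreservesForm s u.toLinearMap) (x y : V) :
    s x (u.symm y) = s (u x) y := by
  have := hu x (u.symm y)
  simpa using this.symm

theorem symm_mem_of_forall_mem [FiniteDimensional F V] {u : V ≃ₗ[F] V} {U : Submodule F V}
    (hU : ∀ x ∈ U, u x ∈ U) (x : V) (hx : x ∈ U) : u.symm x ∈ U := by
  have hle : U.map u.toLinearMap ≤ U := by
    rintro _ ⟨y, hy, rfl⟩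
    exact hU y hy
  have heq : U.map u.toLinearMap = U :=
    Submodule.eq_of_le_of_finrank_eq hle (LinearEquiv.finrank_map_eq u U)
  rw [← heq] at hx
  obtain ⟨y, hy, rfl⟩ := hx
  simpa using hy

/-- The restriction of an automorphism to an invariant subspace. -/
theorem exists_restrict_equiv [FiniteDimensional F V] {u : V ≃ₗ[F] V} {U : Submodule F V}
    (hU : ∀ x ∈ U, u x ∈ U) : ∃ u₁ : U ≃ₗ[F] U, ∀ x, (u₁ x : V) = u x :=
  ⟨LinearEquiv.ofLinearMap (u.toLinearMap.restrict hU)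
    (u.symm.toLinearMap.restrict (symm_mem_of_forall_mem hU))
    (LinearMap.ext fun x => Subtype.ext (by simp))
    (LinearMap.ext fun x => Subtype.ext (by simp)), fun _ => rfl⟩

theorem exists_orthogonal_splitting [FiniteDimensional F V] (hs : s.IsAlt)
    (hnd : ∀ v, (∀ w, s v w = 0) → v = 0) {u : V ≃ₗ[F] V} (hu : PreservesForm s u.toLinearMap)
    {U : Submodule F V} (hU : ∀ x ∈ U, u x ∈ U) (hUn : ∀ x ∈ U, (∀ y ∈ U, s x y = 0) → x = 0) :
    ∃ U' : Submodule F V, ∃ e : (U × U') ≃ₗ[F] V,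
      (∀ x ∈ U', ∀ y ∈ U, s x y = 0) ∧ (∀ x ∈ U', u x ∈ U') ∧
      (∀ x ∈ U', (∀ y ∈ U', s x y = 0) → x = 0) ∧
      (∀ p, e p = p.1 + p.2) ∧
      (∀ p q, s (e p) (e q) = prodForm (s.restrict U) (s.restrict U') p q) := by
  let U' := s.orthogonal U
  have hU' : ∀ x, x ∈ U' ↔ ∀ y ∈ U, s y x = 0 := fun x => Iff.rfl
  have ho : ∀ x ∈ U', ∀ y ∈ U, s x y = 0 := fun x hx y hy => by
    rw [hs.swap, (hU' x).1 hx y hy, neg_zero]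
  have hc : IsCompl U U' := by
    refine LinearMap.BilinForm.isCompl_orthogonal_of_restrict_nondegenerate hs.isRefl ?_
    refine ⟨fun x hx => Subtype.ext (hUn x x.2 fun y hy => hx ⟨y, hy⟩),
      fun x hx => Subtype.ext (hUn x x.2 fun y hy => ?_)⟩
    rw [hs.swap, neg_eq_zero]
    exact hx ⟨y, hy⟩
  let e := Submodule.prodEquivOfIsCompl U U' hc
  have he : ∀ p, e p = p.1 + p.2 := fun p => Submodule.coe_prodEquivOfIsCompl' U U' hc p
  refine ⟨U', e, ho, ?_, ?_, he, ?_⟩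
  · intro x hx
    rw [hU']
    intro y hy
    rw [← hu.symm]
    exact (hU' x).1 hx _ (symm_mem_of_forall_mem hU y hy)
  · intro x hx h
    refine hnd x fun w => ?_
    obtain ⟨p, rfl⟩ := e.surjective w
    rw [he, map_add, ho x hx _ p.1.2, h _ p.2.2, add_zero]
  · intro p q
    simp only [he, map_add, LinearMap.add_apply, prodForm_apply, LinearMap.BilinForm.restrict_apply,
      ho _ p.2.2 _ q.1.2, (hU' _).1 q.2.2 _ p.1.2]
    simp

/-- The space of a form is isometric to a model space as soon as it contains a totally isotropic
subspace stable under `u + u⁻¹` which generates it under `u`. -/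
theorem exists_model (hs : s.IsAlt) (hnd : ∀ v, (∀ w, s v w = 0) → v = 0) {u : V ≃ₗ[F] V}
    (hu : PreservesForm s u.toLinearMap) {L : Submodule F V} (hL : ∀ x ∈ L, ∀ y ∈ L, s x y = 0)
    (hw : ∀ x ∈ L, u x + u.symm x ∈ L) (htop : ∀ v, ∃ p ∈ L, ∃ q ∈ L, p + u q = v) :
    ∃ (β : LinearMap.BilinForm F L) (W : L →ₗ[F] L) (e : (L × L) ≃ₗ[F] V),
      (∀ p q, β p q = β q p) ∧ (∀ p, (∀ q, β p q = 0) → p = 0) ∧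
      (∀ p q, β (W p) q = β p (W q)) ∧ (∀ x y, s (e x) (e y) = modelForm β x y) ∧
      ∀ p, u (e p) = e (-p.2, p.1 + W p.2) := by
  let β : LinearMap.BilinForm F L := s.compl₁₂ L.subtype (u.toLinearMap ∘ₗ L.subtype)
  have hβ : ∀ p q : L, β p q = s p (u q) := fun _ _ => rfl
  let W : L →ₗ[F] L := (u.toLinearMap + u.symm.toLinearMap).restrict hw
  have hW : ∀ p : L, (W p : V) = u p + u.symm p := fun _ => rfl
  let f : L × L →ₗ[F] V := L.subtype.coprod (u.toLinearMap ∘ₗ L.subtype)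
  have hf : ∀ p, f p = p.1 + u p.2 := fun _ => rfl
  -- Symmetry comes from isotropy: p is orthogonal to u q + u⁻¹ q, which lies in L.
  have symm : ∀ p q, β p q = β q p := by
    intro p q
    have h := hL p p.2 _ (hw q q.2)
    rw [map_add, hu.symm_right, hs.swap (u p) q] at h
    rw [hβ, hβ]
    linear_combination h
  have nd : ∀ x ∈ L, (∀ y ∈ L, s x (u y) = 0) → x = 0 := by
    intro x hx h
    refine hnd x fun w => ?_
    obtain ⟨p, hp, q, hq, rfl⟩ := htop w
    rw [map_add, hL x hx p hp, h q hq, add_zero]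
  have inj : Function.Injective f := by
    rw [injective_iff_map_eq_zero]
    rintro ⟨p, q⟩ h
    rw [hf] at h
    have hq : (q : V) = 0 := by
      refine nd q q.2 fun y hy => ?_
      have h1 := congrArg (s y) h
      rw [map_add, map_zero, hL y hy p p.2, zero_add] at h1
      have := symm ⟨y, hy⟩ q
      rw [hβ, hβ] at this
      rw [← this]
      exact h1
    have hq' : q = 0 := Subtype.ext hq
    subst hq'
    refine Prod.ext (Subtype.ext ?_) rfl
    simpa using h
  have surj : Function.Surjective f := by
    intro v
    obtain ⟨p, hp, q, hq, rfl⟩ := htop v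
    exact ⟨(⟨p, hp⟩, ⟨q, hq⟩), rfl⟩
  let e : (L × L) ≃ₗ[F] V := LinearEquiv.ofBijective f ⟨inj, surj⟩
  have he : ∀ p, e p = p.1 + u p.2 := fun _ => rfl
  refine ⟨β, W, e, symm, ?_, ?_, ?_, ?_⟩
  · intro p hp
    exact Subtype.ext (nd p p.2 fun y hy => hp ⟨y, hy⟩)
  · intro p q
    rw [hβ, hβ, hW, hW, map_add, map_add, LinearMap.add_apply, map_add, hu.symm,
      LinearEquiv.apply_symm_apply, ← hu.symm_right, LinearEquiv.symm_apply_apply]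
    exact add_comm _ _
  · intro x y
    simp only [he, map_add, LinearMap.add_apply, modelForm_apply,
      hβ, hL _ x.1.2 _ y.1.2]
    have h1 : s (u x.2) (u y.2) = s x.2 y.2 := hu _ _
    rw [h1, hL _ x.2.2 _ y.2.2, hs.swap (u x.2) y.1]
    ring
  · intro p
    simp only [he, map_add, Submodule.coe_add, Submodule.coe_neg,
      hW, LinearEquiv.apply_symm_apply]
    abel

/-- The sum of two totally isotropic subspaces in duality is a hyperbolic space. -/
theorem exists_hyperbolic_equiv [FiniteDimensional F V] (hs : s.IsAlt) {A B : Submodule F V}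
    (hA : ∀ x ∈ A, ∀ y ∈ A, s x y = 0) (hB : ∀ x ∈ B, ∀ y ∈ B, s x y = 0)
    (nA : ∀ x ∈ A, (∀ y ∈ B, s x y = 0) → x = 0) (nB : ∀ y ∈ B, (∀ x ∈ A, s x y = 0) → y = 0)
    {u : V ≃ₗ[F] V} (hu : PreservesForm s u.toLinearMap)
    (uB : ∀ x ∈ B, u x ∈ B) {g : A ≃ₗ[F] A} (hg : ∀ x, (g x : V) = u x)
    {u₁ : (A ⊔ B : Submodule F V) ≃ₗ[F] (A ⊔ B : Submodule F V)} (hu₁ : ∀ x, (u₁ x : V) = u x) :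
    ∃ e : (A × Module.Dual F A) ≃ₗ[F] (A ⊔ B : Submodule F V),
      (∀ p q, s.restrict (A ⊔ B) (e p) (e q) = hypForm F A p q) ∧
      ∀ p, u₁ (e p) = e (hypMap g p) := by
  let f : A × B →ₗ[F] (A ⊔ B : Submodule F V) :=
    (Submodule.inclusion le_sup_left).coprod (Submodule.inclusion le_sup_right)
  have hf : ∀ p, (f p : V) = p.1 + p.2 := fun _ => rfl
  have bf : Function.Bijective f := by
    constructor
    · rw [injective_iff_map_eq_zero]
      rintro ⟨a, b⟩ h
      have h0 : (a : V) + b = 0 := congrArg Subtype.val h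
      have ha : (a : V) = 0 := nA a a.2 fun y hy => by
        rw [eq_neg_of_add_eq_zero_left h0, map_neg, LinearMap.neg_apply, hB b b.2 y hy, neg_zero]
      rw [ha, zero_add] at h0
      exact Prod.ext (Subtype.ext ha) (Subtype.ext h0)
    · rintro ⟨v, hv⟩
      obtain ⟨a, ha, b, hb, rfl⟩ := Submodule.mem_sup.1 hv
      exact ⟨(⟨a, ha⟩, ⟨b, hb⟩), rfl⟩
  let D : B ≃ₗ[F] Module.Dual F A := LinearEquiv.ofBijective _ (bijective_domRestrict₁₂ A B nA nB)
  have hD : ∀ (b : B) (a : A), D b a = s a b := fun _ _ => rfl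
  have hD' : ∀ (φ : Module.Dual F A) (a : A), s a (D.symm φ) = φ a := fun φ a => by
    rw [← hD, LinearEquiv.apply_symm_apply]
  let e := (LinearEquiv.prodCongr (LinearEquiv.refl F A) D.symm).trans (LinearEquiv.ofBijective f bf)
  have he : ∀ p, (e p : V) = p.1 + D.symm p.2 := fun _ => rfl
  refine ⟨e, ?_, ?_⟩
  · intro p q
    rw [LinearMap.BilinForm.restrict_apply, LinearMap.domRestrict_apply, he, he]
    simp only [map_add, LinearMap.add_apply, hypForm_apply, hA _ p.1.2 _ q.1.2,
      hB _ (D.symm p.2).2 _ (D.symm q.2).2, hs.swap (D.symm p.2 : V) q.1, hD']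
    ring
  · intro p
    apply Subtype.ext
    rw [hu₁, he, he, hypMap_apply, map_add, hg]
    congr 1
    have : (⟨u (D.symm p.2), uB _ (D.symm p.2).2⟩ : B) =
        D.symm (p.2 ∘ₗ g.symm.toLinearMap) := by
      rw [LinearEquiv.eq_symm_apply]
      ext a
      obtain ⟨a, rfl⟩ := g.surjective a
      rw [hD, hg]
      have h1 : s (u a) (u (D.symm p.2)) = s a (D.symm p.2) := hu _ _
      simp only [h1, hD', LinearMap.comp_apply, LinearEquiv.coe_coe, LinearEquiv.symm_apply_apply]
    exact congrArg Subtype.val this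

end splitting

/-! ### Cyclic subspaces and the operators u + u⁻¹, u - u⁻¹ -/

open Polynomial in
/-- The linear map `p ↦ p(T) x`. -/
noncomputable def cyclicMap {F V : Type*} [Field F] [AddCommGroup V] [Module F V] (T : Module.End F V) (x : V) :
    F[X] →ₗ[F] V :=
  LinearMap.applyₗ x ∘ₗ (aeval T).toLinearMap

/-- The element `u + u⁻¹`. -/
def addInv {F V : Type*} [Field F] [AddCommGroup V] [Module F V] (u : V ≃ₗ[F] V) :
    Module.End F V := u.toLinearMap + u.symm.toLinearMap

/-- The element `u - u⁻¹`. -/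
def subInv {F V : Type*} [Field F] [AddCommGroup V] [Module F V] (u : V ≃ₗ[F] V) :
    Module.End F V := u.toLinearMap - u.symm.toLinearMap

section cyclic

open Polynomial

variable {F V : Type*} [Field F] [AddCommGroup V] [Module F V] {s : LinearMap.BilinForm F V}

theorem cyclicMap_apply (T : Module.End F V) (x : V) (p : F[X]) :
    cyclicMap T x p = aeval T p x := rfl

theorem addInv_apply (u : V ≃ₗ[F] V) (x : V) : addInv u x = u x + u.symm x := rfl

theorem subInv_apply (u : V ≃ₗ[F] V) (x : V) : subInv u x = u x - u.symm x := rfl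

theorem aeval_adjoint {T T' : Module.End F V} (h : ∀ x y, s (T x) y = s x (T' y)) (p : F[X])
    (x y : V) : s (aeval T p x) y = s x (aeval T' p y) := by
  have hpow : ∀ n x y, s ((T ^ n) x) y = s x ((T' ^ n) y) := by
    intro n
    induction n with
    | zero => intro x y; rfl
    | succ n ih =>
      intro x y
      rw [pow_succ, pow_succ', Module.End.mul_apply, Module.End.mul_apply, ih, h]
  induction p using Polynomial.induction_on' with
  | add p q hp hq => simp [hp, hq]
  | monomial n a => simp [aeval_monomial, hpow, Module.algebraMap_end_apply]

/-- p(T) is self-adjoint, so s(x, p(T)x) equals its own opposite. -/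
theorem apply_aeval_self (hs : s.IsAlt) (h2 : (2 : F) ≠ 0) {T : Module.End F V}
    (h : ∀ x y, s (T x) y = s x (T y)) (p : F[X]) (x : V) : s x (aeval T p x) = 0 := by
  have h1 := aeval_adjoint h p x x
  rw [hs.swap] at h1
  exact (mul_eq_zero.1 (by linear_combination -h1 : 2 * s x (aeval T p x) = 0)).resolve_left h2

/-- The gcd of f and q^(k+1) is a power q^j with j ≤ k. -/
theorem exists_mul_add_mul_eq_pow {q : F[X]} (hq : Irreducible q) {k : ℕ} {f : F[X]}
    (hf : ¬ q ^ (k + 1) ∣ f) : ∃ a b, a * f + b * q ^ (k + 1) = q ^ k := by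
  have hf0 : f ≠ 0 := fun h => hf (h ▸ dvd_zero _)
  obtain ⟨j, g, hg, rfl⟩ := WfDvdMonoid.max_power_factor hf0 hq
  have hj : j ≤ k := by
    by_contra! h
    exact hf (dvd_mul_of_dvd_left (pow_dvd_pow q h) g)
  obtain ⟨a, b, hab⟩ : IsCoprime g (q ^ (k + 1)) :=
    (((hq.coprime_iff_not_dvd).2 hg).symm).pow_right
  refine ⟨a * q ^ (k - j), b * q ^ k, ?_⟩
  have : q ^ k = q ^ (k - j) * q ^ j := by rw [← pow_add, Nat.sub_add_cancel hj]
  linear_combination q ^ k * hab - a * g * this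

theorem exists_aeval_mul_eq {T : Module.End F V} {q : F[X]} (hq : Irreducible q) {k : ℕ} {x : V}
    (hx : aeval T (q ^ (k + 1)) x = 0) {f : F[X]} (hf : aeval T f x ≠ 0) :
    ∃ a, aeval T (a * f) x = aeval T (q ^ k) x := by
  obtain ⟨a, b, hab⟩ := exists_mul_add_mul_eq_pow hq (k := k) (f := f) (by
    rintro ⟨g, rfl⟩
    rw [mul_comm, map_mul, Module.End.mul_apply, hx, map_zero] at hf
    exact hf rfl)
  refine ⟨a, ?_⟩
  rw [← hab, map_add, map_mul (aeval T) b, LinearMap.add_apply, Module.End.mul_apply, hx, map_zero,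
    add_zero]

theorem pow_dvd_of_aeval_eq_zero {T : Module.End F V} {q : F[X]} (hq : Irreducible q) {k : ℕ}
    {x : V} (hx : aeval T (q ^ (k + 1)) x = 0) (hx' : aeval T (q ^ k) x ≠ 0) {f : F[X]}
    (hf : aeval T f x = 0) : q ^ (k + 1) ∣ f := by
  by_contra h
  obtain ⟨a, b, hab⟩ := exists_mul_add_mul_eq_pow hq h
  apply hx'
  rw [← hab, map_add, map_mul, map_mul, LinearMap.add_apply, Module.End.mul_apply,
    Module.End.mul_apply, hx, hf, map_zero, map_zero, add_zero]

theorem aeval_apply_mem {T : Module.End F V} {U : Submodule F V} (hU : ∀ v ∈ U, T v ∈ U)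
    (p : F[X]) {v : V} (hv : v ∈ U) : aeval T p v ∈ U := by
  have hpow : ∀ n, (T ^ n) v ∈ U := by
    intro n
    induction n with
    | zero => exact hv
    | succ n ih => rw [pow_succ', Module.End.mul_apply]; exact hU _ ih
  induction p using Polynomial.induction_on' with
  | add p q hp hq => simpa using U.add_mem hp hq
  | monomial n a =>
    simpa [aeval_monomial, Module.algebraMap_end_apply] using U.smul_mem a (hpow n)

/-- The obstructions s(x, δ z^j x) vanish for j ≥ k and are removed from j = k - 1 downwards. Adding
c δ z^i y with i = k - 1 - j moves the j-th one by 8c s(x, z^k y), because δ² = z² + 4z, and leaves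
the higher ones unchanged. -/
theorem exists_isotropic_correction (h2 : (2 : F) ≠ 0) (hs : s.IsAlt) {z δ : Module.End F V}
    (hz : ∀ x y, s (z x) y = s x (z y)) (hδ : ∀ x y, s (δ x) y = - s x (δ y))
    (hc : ∀ v, z (δ v) = δ (z v)) (hδδ : ∀ v, δ (δ v) = z (z v) + (4 : F) • z v) {k : ℕ} {x y : V}
    (hx : (z ^ (k + 1)) x = 0) (hx' : δ ((z ^ k) x) = 0) (hy : (z ^ (k + 1)) y = 0)
    (hy' : δ ((z ^ k) y) = 0) (hxy : s x ((z ^ k) y) ≠ 0) :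
    ∃ x', (z ^ (k + 1)) x' = 0 ∧ δ ((z ^ k) x') = 0 ∧ s x' ((z ^ k) y) ≠ 0 ∧
      ∀ j, s x' (δ ((z ^ j) x')) = 0 := by
  have hcp : ∀ n v, (z ^ n) (δ v) = δ ((z ^ n) v) := by
    intro n
    induction n with
    | zero => intro v; rfl
    | succ n ih =>
      intro v
      rw [pow_succ, Module.End.mul_apply, hc, ih, Module.End.mul_apply]
  have hzp : ∀ n x y, s ((z ^ n) x) y = s x ((z ^ n) y) := by
    intro n x y
    simpa using aeval_adjoint hz (X ^ n) x y
  have hadd : ∀ a b v, (z ^ a) ((z ^ b) v) = (z ^ (a + b)) v := fun a b v => by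
    rw [pow_add, Module.End.mul_apply]
  have hz1 : ∀ n v, z ((z ^ n) v) = (z ^ (n + 1)) v := fun n v => by
    rw [pow_succ', Module.End.mul_apply]
  have vanish : ∀ v n, (z ^ (k + 1)) v = 0 → k + 1 ≤ n → (z ^ n) v = 0 := by
    intro v n hv hn
    obtain ⟨m, rfl⟩ := Nat.exists_eq_add_of_le' hn
    rw [← hadd, hv, map_zero]
  have vanish' : ∀ v n, δ ((z ^ k) v) = 0 → k ≤ n → δ ((z ^ n) v) = 0 := by
    intro v n hv hn
    obtain ⟨m, rfl⟩ := Nat.exists_eq_add_of_le' hn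
    rw [← hadd, ← hcp, hv, map_zero]
  suffices H : ∀ i ≤ k, ∃ x', (z ^ (k + 1)) x' = 0 ∧ δ ((z ^ k) x') = 0 ∧ s x' ((z ^ k) y) ≠ 0 ∧
      ∀ j, k - i ≤ j → s x' (δ ((z ^ j) x')) = 0 by
    obtain ⟨x', h1, h3, h4, h5⟩ := H k le_rfl
    exact ⟨x', h1, h3, h4, fun j => h5 j (by omega)⟩
  intro i
  induction i with
  | zero =>
    intro _
    exact ⟨x, hx, hx', hxy, fun j hj => by rw [vanish' x j hx' (by omega), map_zero]⟩
  | succ i ih =>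
    intro hi
    obtain ⟨x', h1, h3, h4, h5⟩ := ih (by omega)
    set t := k - (i + 1) with ht
    have h8 : (8 : F) ≠ 0 := by
      have : (8 : F) = 2 * 2 * 2 := by norm_num
      rw [this]
      exact mul_ne_zero (mul_ne_zero h2 h2) h2
    obtain ⟨c, hcc⟩ : ∃ c : F, s x' (δ ((z ^ t) x')) + 8 * c * s x' ((z ^ k) y) = 0 :=
      ⟨-s x' (δ ((z ^ t) x')) / (8 * s x' ((z ^ k) y)), by field_simp; ring⟩
    -- Both cross terms contribute 4c, whence the 8; the term in c² vanishes because δ z^k y = 0.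
    have expand : ∀ j, t ≤ j → s (x' + c • δ ((z ^ i) y)) (δ ((z ^ j) (x' + c • δ ((z ^ i) y)))) =
        s x' (δ ((z ^ j) x')) + 8 * c * s x' ((z ^ (i + j + 1)) y) := by
      intro j hj
      have e1 : δ ((z ^ j) (δ ((z ^ i) y))) =
          (z ^ (j + i + 2)) y + (4 : F) • (z ^ (j + i + 1)) y := by
        rw [hcp, hadd, hδδ, hz1, hz1]
      have e2 : (z ^ (j + i + 2)) y = 0 := vanish y _ hy (by omega)
      have e3 : s (δ ((z ^ i) y)) (δ ((z ^ j) x')) = 4 * s x' ((z ^ (j + i + 1)) y) := by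
        rw [hδ, hδδ, hz1, hz1, hs.swap, neg_neg, map_add, LinearMap.add_apply, map_smul,
          LinearMap.smul_apply, hzp, hzp, hadd, hadd, show j + 1 + 1 + i = j + i + 2 by omega, e2,
          map_zero, zero_add, smul_eq_mul, show j + 1 + i = j + i + 1 by omega]
      have e4 : s (δ ((z ^ i) y)) ((z ^ (j + i + 1)) y) = 0 := by
        rw [hδ, vanish' y _ hy' (by omega), map_zero, neg_zero]
      simp only [map_add, map_smul, LinearMap.add_apply, LinearMap.smul_apply, smul_eq_mul, e1, e2,
        e3, e4, zero_add]
      rw [show i + j + 1 = j + i + 1 by omega]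
      ring
    refine ⟨x' + c • δ ((z ^ i) y), ?_, ?_, ?_, ?_⟩
    · rw [map_add, map_smul, h1, hcp, hadd, vanish' y _ hy' (by omega), smul_zero, add_zero]
    · rw [map_add, map_smul, map_add, map_smul, h3, hcp, hadd, vanish' y _ hy' (by omega), map_zero,
        smul_zero, add_zero]
    · rw [map_add, map_smul, LinearMap.add_apply, LinearMap.smul_apply, hδ, hy', map_zero, neg_zero,
        smul_zero, add_zero]
      exact h4
    · intro j hj
      rw [expand j hj]
      rcases hj.eq_or_lt with rfl | hj
      · rw [show i + t + 1 = k by omega]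
        exact hcc
      · rw [h5 j (by omega), vanish y _ hy (by omega), map_zero, mul_zero, add_zero]

end cyclic

/-! ### Reversal of cyclic unipotent maps -/

section unipotent

open Polynomial

variable {F E : Type*} [Field F] [AddCommGroup E] [Module F E]

theorem aeval_intertwine {T T' σ : Module.End F E} (h : ∀ v, σ (T v) = T' (σ v)) (f : F[X]) (v : E) :
    σ (aeval T f v) = aeval T' f (σ v) := by
  have hpow : ∀ n v, σ ((T ^ n) v) = (T' ^ n) (σ v) := by
    intro n
    induction n with
    | zero => intro v; rfl
    | succ n ih =>
      intro v
      rw [pow_succ', pow_succ', Module.End.mul_apply, Module.End.mul_apply, h, ih]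
  induction f using Polynomial.induction_on' with
  | add p q hp hq => simp [hp, hq]
  | monomial n a => simp [aeval_monomial, hpow, Module.algebraMap_end_apply]

/-- A cyclic unipotent automorphism is reversed by an involution. -/
theorem exists_reversal_of_cyclic {g : E ≃ₗ[F] E} {x : E} {N : ℕ}
    (hgen : ∀ v, ∃ f : F[X], aeval g.toLinearMap f x = v)
    (hx : aeval g.toLinearMap ((X - C 1) ^ (N + 1) : F[X]) x = 0)
    (hx' : aeval g.toLinearMap ((X - C 1) ^ N : F[X]) x ≠ 0) :
    ∃ σ : E →ₗ[F] E, (∀ v, σ (σ v) = v) ∧ (∀ v, σ (g (σ (g v))) = v) ∧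
      ∃ x₀ ≠ 0, g x₀ = x₀ ∧ σ x₀ = (-1 : F) ^ N • x₀ := by
  let φ := cyclicMap g.toLinearMap x
  let ψ := cyclicMap g.symm.toLinearMap x
  have hsub : ∀ v, aeval g.symm.toLinearMap (X - C 1 : F[X]) v =
      -(g.symm (aeval g.toLinearMap (X - C 1 : F[X]) v)) := by
    intro v; simp
  have hpow : ∀ n v, aeval g.symm.toLinearMap ((X - C 1) ^ n : F[X]) v =
      (-1 : F) ^ n • (g.symm.toLinearMap ^ n) (aeval g.toLinearMap ((X - C 1) ^ n : F[X]) v) := by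
    intro n
    induction n with
    | zero => intro v; simp
    | succ n ih =>
      intro v
      have hcomm := aeval_intertwine (T := g.toLinearMap) (T' := g.toLinearMap)
        (σ := g.symm.toLinearMap) (by simp) ((X - C 1) ^ n : F[X])
        (aeval g.toLinearMap (X - C 1 : F[X]) v)
      rw [pow_succ, map_mul, Module.End.mul_apply, hsub, map_neg, ih, map_mul, Module.End.mul_apply]
      rw [LinearEquiv.coe_coe] at hcomm
      rw [← hcomm, pow_succ, pow_succ (g.symm.toLinearMap), Module.End.mul_apply,
        LinearEquiv.coe_coe, mul_neg_one, neg_smul]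
  -- As g⁻¹ - 1 = -g⁻¹(g - 1), whatever annihilates x through g also does through g⁻¹. Hence f(g)x ↦
  -- f(g⁻¹)x is well defined, and this is σ.
  have hker : LinearMap.ker φ ≤ LinearMap.ker ψ := by
    intro f hf
    obtain ⟨r, rfl⟩ := pow_dvd_of_aeval_eq_zero (irreducible_X_sub_C (1 : F)) hx hx' hf
    rw [LinearMap.mem_ker, cyclicMap_apply, mul_comm, map_mul, Module.End.mul_apply, hpow, hx, map_zero, smul_zero, map_zero]
  obtain ⟨ρ, hρ⟩ := φ.exists_rightInverse_of_surjective
    (LinearMap.range_eq_top.2 fun v => hgen v)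
  let σ : E →ₗ[F] E := ψ ∘ₗ ρ
  have hσ : ∀ f : F[X], σ (aeval g.toLinearMap f x) = aeval g.symm.toLinearMap f x := by
    intro f
    have h1 : φ (ρ (φ f) - f) = 0 := by
      rw [map_sub, sub_eq_zero]
      exact LinearMap.congr_fun hρ (φ f)
    have h2 : ψ (ρ (φ f) - f) = 0 := hker h1
    rw [map_sub, sub_eq_zero] at h2
    exact h2
  have hσx : σ x = x := by simpa using hσ 1
  have hσg : ∀ v, σ (g v) = g.symm (σ v) := by
    intro v
    obtain ⟨f, rfl⟩ := hgen v
    have := hσ (X * f)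
    rwa [map_mul, map_mul, aeval_X, aeval_X, Module.End.mul_apply, Module.End.mul_apply, ← hσ] at this
  have hσg' : ∀ v, σ (g.symm v) = g (σ v) := by
    intro v
    rw [← g.symm_apply_eq, ← hσg, g.apply_symm_apply]
  have hσσ : ∀ v, σ (σ v) = v := by
    intro v
    obtain ⟨f, rfl⟩ := hgen v
    rw [hσ, aeval_intertwine (T' := g.toLinearMap) hσg', hσx]
  refine ⟨σ, hσσ, fun v => ?_, _, hx', ?_, ?_⟩
  · rw [hσg, hσσ, g.symm_apply_apply]
  · rw [pow_succ', map_mul, Module.End.mul_apply] at hx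
    simpa [sub_eq_zero] using hx
  · rw [hσ, hpow]
    congr 1
    have hfix : g.symm (aeval g.toLinearMap ((X - C 1) ^ N : F[X]) x) =
        aeval g.toLinearMap ((X - C 1) ^ N : F[X]) x := by
      rw [g.symm_apply_eq]
      rw [pow_succ', map_mul, Module.End.mul_apply] at hx
      refine (sub_eq_zero.1 ?_).symm
      simpa using hx
    have : ∀ n, (g.symm.toLinearMap ^ n) (aeval g.toLinearMap ((X - C 1) ^ N : F[X]) x) =
        aeval g.toLinearMap ((X - C 1) ^ N : F[X]) x := by
      intro n
      induction n with
      | zero => rfl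
      | succ n ih => rw [pow_succ, Module.End.mul_apply, LinearEquiv.coe_coe, hfix, ih]
    exact this N

end unipotent

/-! ### Hyperbolic pieces on which u is unipotent -/

section unipotent_pair

open Polynomial

variable {F V : Type*} [Field F] [AddCommGroup V] [Module F V] {s : LinearMap.BilinForm F V}

/-- Since 2u = z + 2 + δ, the space F[z]x + δF[z]x is stable under u. It is orthogonal to x by
hypothesis and by self-adjointness of z, and invariance of s carries this to all of F[u]x. -/
theorem isotropic_range_cyclicMap [FiniteDimensional F V] (h2 : (2 : F) ≠ 0) (hs : s.IsAlt)
    {u : V ≃ₗ[F] V} (hu : PreservesForm s u.toLinearMap) {z δ : Module.End F V}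
    (huz : ∀ v, z v = u v + u.symm v - (2 : F) • v) (huδ : ∀ v, δ v = u v - u.symm v)
    {x : V} (hx : ∀ j, s x (δ ((z ^ j) x)) = 0) :
    ∀ v ∈ LinearMap.range (cyclicMap u.toLinearMap x),
      ∀ w ∈ LinearMap.range (cyclicMap u.toLinearMap x), s v w = 0 := by
  have hz : ∀ x y, s (z x) y = s x (z y) := by
    intro x y
    simp [huz, hu.symm, hu.symm_right, add_comm]
  have hc : ∀ v, δ (z v) = z (δ v) := by
    intro v
    simp [huz, huδ, smul_sub]; abel
  have hδδ : ∀ v, δ (δ v) = z (z v) + (4 : F) • z v := by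
    intro v
    simp only [huz, huδ, map_sub, map_add, map_smul, LinearEquiv.apply_symm_apply,
      LinearEquiv.symm_apply_apply]
    module
  have hδf : ∀ f : F[X], s x (δ (aeval z f x)) = 0 := by
    intro f
    induction f using Polynomial.induction_on' with
    | add p q hp hq => simp [hp, hq]
    | monomial n a => simp [aeval_monomial, hx, Module.algebraMap_end_apply]
  let K : Submodule F V :=
    LinearMap.range ((cyclicMap z x).coprod (δ ∘ₗ cyclicMap z x))
  have hK : ∀ v ∈ K, u v ∈ K := by
    rintro _ ⟨⟨a, b⟩, rfl⟩
    -- The product of a + δb by (z + 2 + δ)/2, reduced with δ² = z² + 4z.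
    refine ⟨((2 : F)⁻¹ • ((X + 2) * a + (X ^ 2 + 4 * X) * b), (2 : F)⁻¹ • (a + (X + 2) * b)), ?_⟩
    have key : ∀ v, u v = (2 : F)⁻¹ • (z v + (2 : F) • v + δ v) := by
      intro v
      rw [huz, huδ, show u v + u.symm v - (2 : F) • v + (2 : F) • v + (u v - u.symm v) =
        (2 : F) • u v by module, smul_smul, inv_mul_cancel₀ h2, one_smul]
    have e2 : ∀ v, (aeval z (2 : F[X])) v = (2 : F) • v := fun v => by
      rw [show (2 : F[X]) = C 2 from rfl, aeval_C, Module.algebraMap_end_apply]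
    have e4 : ∀ v, (aeval z (4 : F[X])) v = (4 : F) • v := fun v => by
      rw [show (4 : F[X]) = C 4 from rfl, aeval_C, Module.algebraMap_end_apply]
    simp only [LinearMap.coprod_apply, LinearMap.comp_apply, cyclicMap_apply, map_smul, map_add,
      map_mul, aeval_X, LinearMap.add_apply, Module.End.mul_apply, pow_two, e2, e4, key,
      hδδ, hc, smul_add]
    module
  have hxK : ∀ v ∈ K, s x v = 0 := by
    rintro _ ⟨⟨a, b⟩, rfl⟩
    simp [cyclicMap_apply, hδf, apply_aeval_self hs h2 hz]
  have hx0 : x ∈ K := ⟨(1, 0), by simp [cyclicMap_apply]⟩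
  rintro _ ⟨f, rfl⟩ _ ⟨g, rfl⟩
  rw [cyclicMap_apply, aeval_adjoint (T' := u.symm.toLinearMap) (fun x y => (hu.symm_right x y).symm)]
  exact hxK _ (aeval_apply_mem (symm_mem_of_forall_mem hK) f (aeval_apply_mem hK g hx0))

/-- Every nonzero vector of F[u]x has q^N(u)x among its multiples. If it were orthogonal to F[u]y,
then q^N(u)x would be orthogonal to y. -/
theorem separating_range_cyclicMap [FiniteDimensional F V] {u : V ≃ₗ[F] V}
    (hu : PreservesForm s u.toLinearMap) {q : F[X]} (hq : Irreducible q) {N : ℕ} {x y : V}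
    (hx : aeval u.toLinearMap (q ^ (N + 1)) x = 0)
    (hxy : s (aeval u.toLinearMap (q ^ N) x) y ≠ 0) :
    ∀ v ∈ LinearMap.range (cyclicMap u.toLinearMap x),
      (∀ w ∈ LinearMap.range (cyclicMap u.toLinearMap y), s v w = 0) → v = 0 := by
  rintro _ ⟨f, rfl⟩ h
  by_contra hne
  obtain ⟨a, ha⟩ := exists_aeval_mul_eq hq hx hne
  apply hxy
  rw [← ha, map_mul, Module.End.mul_apply,
    aeval_adjoint (T' := u.symm.toLinearMap) (fun x y => (hu.symm_right x y).symm)]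
  refine h _ (aeval_apply_mem (symm_mem_of_forall_mem ?_) a ⟨1, by simp [cyclicMap_apply]⟩)
  rintro _ ⟨g, rfl⟩
  exact ⟨X * g, by simp [cyclicMap_apply]⟩

/-- Two dual isotropic cyclic subspaces on which `u` is unipotent span a space on which `u` is
reversible and has a factorization with one hyperbolic pair. -/
theorem exists_unipotent_piece [FiniteDimensional F V] (h2 : (2 : F) ≠ 0) (hs : s.IsAlt)
    {u : V ≃ₗ[F] V} (hu : PreservesForm s u.toLinearMap) {z δ : Module.End F V}
    (huz : ∀ v, z v = u v + u.symm v - (2 : F) • v) (huδ : ∀ v, δ v = u v - u.symm v)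
    {k : ℕ} {x y : V} (hx : (z ^ (k + 1)) x = 0) (hx' : δ ((z ^ k) x) = 0)
    (hy : (z ^ (k + 1)) y = 0) (hy' : δ ((z ^ k) y) = 0) (hxy : s x ((z ^ k) y) ≠ 0) :
    ∃ (P : Submodule F V) (u₁ : P ≃ₗ[F] P), P ≠ ⊥ ∧ (∀ v : P, (u₁ v : V) = u v) ∧
      (∀ v ∈ P, (∀ w ∈ P, s v w = 0) → v = 0) ∧
      IsReversible (s.restrict P) u₁.toLinearMap ∧
      ∀ α : F, α ≠ 0 → α ≠ 1 → HasFactorization (s.restrict P) u₁.toLinearMap α α 1 := by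
  have hz : ∀ x y, s (z x) y = s x (z y) := by
    intro x y
    simp [huz, hu.symm, hu.symm_right, add_comm]
  have hδ : ∀ x y, s (δ x) y = - s x (δ y) := by
    intro x y
    simp [huδ, hu.symm, hu.symm_right]
  have hc : ∀ v, z (δ v) = δ (z v) := by
    intro v
    simp [huz, huδ, smul_sub]; abel
  have hδδ : ∀ v, δ (δ v) = z (z v) + (4 : F) • z v := by
    intro v
    simp only [huz, huδ, map_sub, map_add, map_smul, LinearEquiv.apply_symm_apply,
      LinearEquiv.symm_apply_apply]
    module
  have hzp : ∀ n x y, s ((z ^ n) x) y = s x ((z ^ n) y) := by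
    intro n x y
    simpa using aeval_adjoint hz (X ^ n) x y
  obtain ⟨x, hx, hx', hxy, hxi⟩ := exists_isotropic_correction h2 hs hz hδ hc hδδ hx hx' hy hy' hxy
  have hyx : s y ((z ^ k) x) ≠ 0 := by
    rw [hs.swap, hzp]
    exact neg_ne_zero.2 hxy
  obtain ⟨y, hy, hy', hyx, hyi⟩ := exists_isotropic_correction h2 hs hz hδ hc hδδ hy hy' hx hx' hyx
  have hfix : ∀ x, (z ^ (k + 1)) x = 0 → δ ((z ^ k) x) = 0 → u ((z ^ k) x) = (z ^ k) x := by
    intro x h h'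
    rw [pow_succ', Module.End.mul_apply, huz] at h
    rw [huδ] at h'
    have : (2 : F) • (u ((z ^ k) x) - (z ^ k) x) = 0 := by
      calc _ = (u ((z ^ k) x) + u.symm ((z ^ k) x) - (2 : F) • (z ^ k) x) +
            (u ((z ^ k) x) - u.symm ((z ^ k) x)) := by module
        _ = 0 := by rw [h, h', add_zero]
    exact sub_eq_zero.1 ((smul_eq_zero.1 this).resolve_left h2)
  -- From (u - 1)² = u z. As z^k x is fixed by u, the vector x is annihilated by (u - 1)^(2k+1) but
  -- not by (u - 1)^(2k).
  have hsq : ∀ n x, aeval u.toLinearMap ((X - C 1) ^ (2 * n) : F[X]) x =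
      (u.toLinearMap ^ n) ((z ^ n) x) := by
    intro n
    induction n with
    | zero => intro x; simp
    | succ n ih =>
      intro x
      have h1 : aeval u.toLinearMap ((X - C 1) ^ 2 : F[X]) x = z (u x) := by
        simp only [huz, pow_two, map_mul, map_sub, aeval_X, Module.End.mul_apply, map_one,
          LinearMap.sub_apply, Module.End.one_apply, LinearEquiv.coe_coe,
          LinearEquiv.symm_apply_apply]
        module
      have h3 : ∀ n v, (z ^ n) (u v) = u ((z ^ n) v) := by
        intro n
        induction n with
        | zero => intro v; rfl
        | succ n ih =>
          intro v
          have : z (u v) = u (z v) := by simp [huz]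
          rw [pow_succ, Module.End.mul_apply, this, ih, Module.End.mul_apply]
      rw [mul_add, mul_one, pow_add, map_mul, Module.End.mul_apply, h1, ih, pow_succ, pow_succ z,
        Module.End.mul_apply, Module.End.mul_apply, ← Module.End.mul_apply (z ^ n) z, ← pow_succ, h3,
        pow_succ, Module.End.mul_apply, LinearEquiv.coe_coe]
  have hpow : ∀ x, (z ^ (k + 1)) x = 0 → δ ((z ^ k) x) = 0 →
      aeval u.toLinearMap ((X - C 1) ^ (2 * k) : F[X]) x = (z ^ k) x := by
    intro x h h'
    rw [hsq]
    generalize k = m at h h' hfix ⊢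
    have : ∀ n, (u.toLinearMap ^ n) ((z ^ m) x) = (z ^ m) x := by
      intro n
      induction n with
      | zero => rfl
      | succ n ih => rw [pow_succ, Module.End.mul_apply, LinearEquiv.coe_coe, hfix x h h', ih]
    exact this m
  have hpow' : ∀ x, (z ^ (k + 1)) x = 0 → δ ((z ^ k) x) = 0 →
      aeval u.toLinearMap ((X - C 1) ^ (2 * k + 1) : F[X]) x = 0 := by
    intro x h h'
    rw [pow_succ', map_mul, Module.End.mul_apply, hpow x h h']
    simp [hfix x h h']
  let A := LinearMap.range (cyclicMap u.toLinearMap x)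
  let B := LinearMap.range (cyclicMap u.toLinearMap y)
  have hst : ∀ y, ∀ v ∈ LinearMap.range (cyclicMap u.toLinearMap y),
      u v ∈ LinearMap.range (cyclicMap u.toLinearMap y) := by
    rintro y _ ⟨g, rfl⟩
    exact ⟨X * g, by simp [cyclicMap_apply]⟩
  have hirr := irreducible_X_sub_C (1 : F)
  have hsxy : s ((z ^ k) x) y ≠ 0 := by
    rw [hs.swap]
    exact neg_ne_zero.2 hyx
  have hsyx : s ((z ^ k) y) x ≠ 0 := by
    rw [hzp]
    exact hyx
  have nA : ∀ v ∈ A, (∀ w ∈ B, s v w = 0) → v = 0 :=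
    separating_range_cyclicMap hu hirr (hpow' x hx hx') (by rwa [hpow x hx hx'])
  have nB : ∀ v ∈ B, (∀ w ∈ A, s v w = 0) → v = 0 :=
    separating_range_cyclicMap hu hirr (hpow' y hy hy') (by rwa [hpow y hy hy'])
  have iA := isotropic_range_cyclicMap h2 hs hu huz huδ hxi
  have iB := isotropic_range_cyclicMap h2 hs hu huz huδ hyi
  have hP : ∀ v ∈ A ⊔ B, u v ∈ A ⊔ B := by
    intro v hv
    obtain ⟨a, ha, b, hb, rfl⟩ := Submodule.mem_sup.1 hv
    rw [map_add]
    exact Submodule.add_mem_sup (hst x a ha) (hst y b hb)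
  obtain ⟨u₁, hu₁⟩ := exists_restrict_equiv hP
  obtain ⟨g, hg⟩ := exists_restrict_equiv (hst x)
  obtain ⟨e, he, heg⟩ := exists_hyperbolic_equiv hs iA iB nA
    (fun v hv h => nB v hv fun w hw => by rw [hs.swap, h w hw, neg_zero]) hu (hst y) hg hu₁
  have hxA : x ∈ A := ⟨1, by simp [cyclicMap_apply]⟩
  have hcoe : ∀ f : F[X], ((aeval g.toLinearMap f ⟨x, hxA⟩ : A) : V) = aeval u.toLinearMap f x := by
    intro f
    have hp : ∀ n, (((g.toLinearMap ^ n) ⟨x, hxA⟩ : A) : V) = (u.toLinearMap ^ n) x := by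
      intro n
      induction n with
      | zero => rfl
      | succ n ih =>
        rw [pow_succ', pow_succ', Module.End.mul_apply, Module.End.mul_apply, ← ih]
        exact hg _
    induction f using Polynomial.induction_on' with
    | add p q hp hq => simp [hp, hq]
    | monomial n a => simp [aeval_monomial, hp, Module.algebraMap_end_apply]
  have hzx : (z ^ k) x ≠ 0 := fun h => hyx (by rw [h, map_zero])
  obtain ⟨σ, hσ, hσg, x₀, hx₀, hgx₀, hσx₀⟩ := exists_reversal_of_cyclic (g := g) (x := ⟨x, hxA⟩)
    (N := 2 * k)
    (by
      rintro ⟨_, f, rfl⟩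
      exact ⟨f, Subtype.ext (hcoe f)⟩)
    (Subtype.ext (by rw [hcoe, hpow' x hx hx']; rfl))
    (fun h => hzx (by rw [← hpow x hx hx', ← hcoe, h]; rfl))
  refine ⟨A ⊔ B, u₁, ?_, hu₁, ?_, (isReversible_hypMap hσ hσg).congr e he heg, fun α h0 h1 =>
    (hasFactorization_hypMap hσ hσg hx₀ hgx₀ hσx₀ h0 h1).congr e he heg⟩
  · intro h
    have : x ∈ A ⊔ B := Submodule.mem_sup_left hxA
    rw [h, Submodule.mem_bot] at this
    exact hzx (by rw [this, map_zero])
  · intro v hv h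
    obtain ⟨a, ha, b, hb, rfl⟩ := Submodule.mem_sup.1 hv
    have ha0 : a = 0 := nA a ha fun w hw => by
      simpa [iB b hb w hw] using h w (Submodule.mem_sup_right hw)
    have hb0 : b = 0 := nB b hb fun w hw => by
      simpa [iA a ha w hw] using h w (Submodule.mem_sup_left hw)
    rw [ha0, hb0, add_zero]

end unipotent_pair

/-! ### Model subspaces and what their absence implies -/

/-- A totally isotropic subspace `L`, stable under `u + u⁻¹`, such that `L + u L` is
nondegenerate. -/
structure IsModelSubspace {F V : Type*} [Field F] [AddCommGroup V] [Module F V]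
    (s : LinearMap.BilinForm F V) (u : V ≃ₗ[F] V) (L : Submodule F V) : Prop where
  isotropic : ∀ x ∈ L, ∀ y ∈ L, s x y = 0
  add_symm_mem : ∀ x ∈ L, u x + u.symm x ∈ L
  nondegenerate : ∀ x ∈ L ⊔ L.map u.toLinearMap,
    (∀ y ∈ L ⊔ L.map u.toLinearMap, s x y = 0) → x = 0

section model_subspaces

variable {F V : Type*} [Field F] [AddCommGroup V] [Module F V] {s : LinearMap.BilinForm F V}
  {u : V ≃ₗ[F] V}

theorem isModelSubspace_bot : IsModelSubspace s u ⊥ where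
  isotropic := by simp
  add_symm_mem := by simp
  nondegenerate := by simp

theorem IsModelSubspace.apply_mem {L : Submodule F V} (h : IsModelSubspace s u L) :
    ∀ x ∈ L ⊔ L.map u.toLinearMap, u x ∈ L ⊔ L.map u.toLinearMap := by
  intro x hx
  obtain ⟨a, ha, _, ⟨b, hb, rfl⟩, rfl⟩ := Submodule.mem_sup.1 hx
  have h1 : u a ∈ L ⊔ L.map u.toLinearMap := Submodule.mem_sup_right ⟨a, ha, rfl⟩
  have h2 : u (u b) = u (u b + u.symm b) - b := by simp
  have h3 : u (u b + u.symm b) ∈ L ⊔ L.map u.toLinearMap :=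
    Submodule.mem_sup_right ⟨_, h.add_symm_mem b hb, rfl⟩
  rw [map_add, LinearEquiv.coe_coe, h2]
  exact add_mem h1 (sub_mem h3 (Submodule.mem_sup_left hb))

theorem IsModelSubspace.map_subtype {U : Submodule F V} {u' : U ≃ₗ[F] U}
    (hu' : ∀ x, (u' x : V) = u x) {L : Submodule F U} (h : IsModelSubspace (s.restrict U) u' L) :
    IsModelSubspace s u (L.map U.subtype) := by
  have hsymm : ∀ x, (u'.symm x : V) = u.symm x := by
    intro x
    rw [LinearEquiv.eq_symm_apply, ← hu', u'.apply_symm_apply]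
  have hmap : L.map U.subtype ⊔ (L.map U.subtype).map u.toLinearMap =
      (L ⊔ L.map u'.toLinearMap).map U.subtype := by
    rw [Submodule.map_sup, ← Submodule.map_comp, ← Submodule.map_comp]
    congr 2
    ext x
    exact (hu' x).symm
  refine ⟨?_, ?_, ?_⟩
  · rintro _ ⟨x, hx, rfl⟩ _ ⟨y, hy, rfl⟩
    exact h.isotropic x hx y hy
  · rintro _ ⟨x, hx, rfl⟩
    exact ⟨_, h.add_symm_mem x hx, by simp [hu', hsymm]⟩
  · rw [hmap]
    rintro _ ⟨x, hx, rfl⟩ hy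
    rw [h.nondegenerate x hx fun y hy' => hy y ⟨y, hy', rfl⟩, map_zero]

theorem IsModelSubspace.sup (hs : s.IsAlt) {L M : Submodule F V} (hL : IsModelSubspace s u L)
    (hM : IsModelSubspace s u M)
    (h : ∀ x ∈ M ⊔ M.map u.toLinearMap, ∀ y ∈ L ⊔ L.map u.toLinearMap, s x y = 0) :
    IsModelSubspace s u (L ⊔ M) := by
  have h' : ∀ y ∈ L ⊔ L.map u.toLinearMap, ∀ x ∈ M ⊔ M.map u.toLinearMap, s y x = 0 :=
    fun y hy x hx => by rw [hs.swap, h x hx y hy, neg_zero]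
  have hmap : L ⊔ M ⊔ (L ⊔ M).map u.toLinearMap =
      (L ⊔ L.map u.toLinearMap) ⊔ (M ⊔ M.map u.toLinearMap) := by
    rw [Submodule.map_sup, sup_sup_sup_comm]
  refine ⟨?_, ?_, ?_⟩
  · intro x hx y hy
    obtain ⟨a, ha, b, hb, rfl⟩ := Submodule.mem_sup.1 hx
    obtain ⟨c, hc, d, hd, rfl⟩ := Submodule.mem_sup.1 hy
    simp [hL.isotropic a ha c hc, hM.isotropic b hb d hd,
      h b (Submodule.mem_sup_left hb) c (Submodule.mem_sup_left hc),
      h' a (Submodule.mem_sup_left ha) d (Submodule.mem_sup_left hd)]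
  · intro x hx
    obtain ⟨a, ha, b, hb, rfl⟩ := Submodule.mem_sup.1 hx
    rw [map_add, map_add, add_add_add_comm]
    exact Submodule.add_mem_sup (hL.add_symm_mem a ha) (hM.add_symm_mem b hb)
  · rw [hmap]
    intro x hx hy
    obtain ⟨a, ha, b, hb, rfl⟩ := Submodule.mem_sup.1 hx
    rw [hL.nondegenerate a ha fun y hy' => by
        simpa [h b hb y hy'] using hy y (Submodule.mem_sup_left hy'),
      hM.nondegenerate b hb fun y hy' => by
        simpa [h' a ha y hy'] using hy y (Submodule.mem_sup_right hy'), add_zero]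

-- Isotropy holds because w = u + u⁻¹ is self-adjoint. On an isotropic w-stable space s(v, (u -
-- u⁻¹)v') = 2 s(v, u v'); a vector in the radical of this pairing would have q^k(w)x as a multiple,
-- contrary to `hx'`.
open Polynomial in
theorem isModelSubspace_range_cyclicMap (h2 : (2 : F) ≠ 0) (hs : s.IsAlt)
    (hu : PreservesForm s u.toLinearMap) {q : F[X]} (hq : Irreducible q) {k : ℕ} {x : V}
    (hx : aeval (addInv u) (q ^ (k + 1)) x = 0)
    (hx' : s x (subInv u (aeval (addInv u) (q ^ k) x)) ≠ 0) :
    IsModelSubspace s u (LinearMap.range (cyclicMap (addInv u) x)) := by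
  have hw : ∀ x y, s (addInv u x) y = s x (addInv u y) := by
    intro x y
    simp [addInv_apply, hu.symm, hu.symm_right, add_comm]
  have hc : ∀ v, subInv u (addInv u v) = addInv u (subInv u v) := by
    intro v
    simp [addInv_apply, subInv_apply]
    abel
  have iso : ∀ v ∈ LinearMap.range (cyclicMap (addInv u) x),
      ∀ w ∈ LinearMap.range (cyclicMap (addInv u) x), s v w = 0 := by
    rintro _ ⟨f, rfl⟩ _ ⟨g, rfl⟩
    rw [cyclicMap_apply, cyclicMap_apply, aeval_adjoint hw, ← Module.End.mul_apply, ← map_mul]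
    exact apply_aeval_self hs h2 hw _ x
  have stable : ∀ v ∈ LinearMap.range (cyclicMap (addInv u) x),
      u v + u.symm v ∈ LinearMap.range (cyclicMap (addInv u) x) := by
    rintro _ ⟨f, rfl⟩
    exact ⟨X * f, by rw [cyclicMap_apply, map_mul, aeval_X]; rfl⟩
  have nd : ∀ v ∈ LinearMap.range (cyclicMap (addInv u) x),
      (∀ w ∈ LinearMap.range (cyclicMap (addInv u) x), s v (u w) = 0) → v = 0 := by
    rintro _ ⟨f, rfl⟩ h
    by_contra hne
    obtain ⟨a, ha⟩ := exists_aeval_mul_eq hq hx hne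
    apply hx'
    have h1 : s (cyclicMap (addInv u) x f) (subInv u (aeval (addInv u) a x)) = 0 := by
      have e1 := h (aeval (addInv u) a x) ⟨a, rfl⟩
      have e2 := iso _ ⟨f, rfl⟩ _ (stable (aeval (addInv u) a x) ⟨a, rfl⟩)
      rw [map_add, e1, zero_add] at e2
      rw [subInv_apply, map_sub, e1, e2, sub_zero]
    rw [aeval_intertwine hc, ← aeval_adjoint hw, ← ha, map_mul, Module.End.mul_apply,
      aeval_adjoint hw, ← aeval_intertwine hc]
    exact h1
  refine ⟨iso, stable, ?_⟩
  intro v hv h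
  obtain ⟨p, hp, _, ⟨r, hr, rfl⟩, rfl⟩ := Submodule.mem_sup.1 hv
  have hr0 : r = 0 := nd r hr fun w hw' => by
    have := h w (Submodule.mem_sup_left hw')
    rw [map_add, LinearMap.add_apply, iso p hp w hw', zero_add] at this
    have h1 := iso _ (stable r hr) w hw'
    rwa [map_add, LinearMap.add_apply, ← LinearEquiv.coe_coe, this, zero_add, hu.symm] at h1
  subst hr0
  rw [map_zero, add_zero] at h ⊢
  exact nd p hp fun w hw' => h _ (Submodule.mem_sup_right ⟨w, hw', rfl⟩)

open Polynomial in
/-- If `u` has no nontrivial model subspace then `u` or `-u` has a unipotent part, which carries a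
pair of vectors in duality. -/
theorem exists_dual_pair [FiniteDimensional F V] [Nontrivial V] (h2 : (2 : F) ≠ 0) (hs : s.IsAlt)
    (hnd : ∀ v, (∀ w, s v w = 0) → v = 0) (hu : PreservesForm s u.toLinearMap)
    (hL : ∀ L, IsModelSubspace s u L → L = ⊥) :
    ∃ ε : F, (ε = 1 ∨ ε = -1) ∧ ∃ (k : ℕ) (x y : V),
      ((addInv u - algebraMap F _ (2 * ε)) ^ (k + 1)) x = 0 ∧
      subInv u (((addInv u - algebraMap F _ (2 * ε)) ^ k) x) = 0 ∧
      ((addInv u - algebraMap F _ (2 * ε)) ^ (k + 1)) y = 0 ∧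
      subInv u (((addInv u - algebraMap F _ (2 * ε)) ^ k) y) = 0 ∧
      s x (((addInv u - algebraMap F _ (2 * ε)) ^ k) y) ≠ 0 := by
  have hw : ∀ x y, s (addInv u x) y = s x (addInv u y) := by
    intro x y
    simp [addInv_apply, hu.symm, hu.symm_right, add_comm]
  have hδ : ∀ x y, s (subInv u x) y = - s x (subInv u y) := by
    intro x y
    simp [subInv_apply, hu.symm, hu.symm_right]
  have hc : ∀ v, subInv u (addInv u v) = addInv u (subInv u v) := by
    intro v
    simp [addInv_apply, subInv_apply]
    abel
  have hδδ : ∀ v, subInv u (subInv u v) = aeval (addInv u) (X ^ 2 - C 4 : F[X]) v := by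
    intro v
    simp [addInv_apply, subInv_apply, pow_two, Module.algebraMap_end_apply]
    module
  have hnd' : ∀ v, (∀ w, s w v = 0) → v = 0 := fun v h => hnd v fun w => by
    rw [hs.swap, h, neg_zero]
  set w := addInv u with hwdef
  have hint : IsIntegral F w := Algebra.IsIntegral.isIntegral w
  obtain ⟨q, hqm, hq, hqd⟩ := exists_monic_irreducible_factor (minpoly F w) (minpoly.not_isUnit F w)
  obtain ⟨m, c, hqc, hμ⟩ := WfDvdMonoid.max_power_factor (minpoly.ne_zero hint) hq
  obtain ⟨k, rfl⟩ : ∃ k, m = k + 1 := by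
    refine Nat.exists_eq_succ_of_ne_zero ?_
    rintro rfl
    rw [pow_zero, one_mul] at hμ
    exact hqc (hμ ▸ hqd)
  have hkill : ∀ f v, minpoly F w ∣ f → aeval w f v = 0 := by
    intro f v hf
    rw [(minpoly.dvd_iff).1 hf, LinearMap.zero_apply]
  have hmul : ∀ (f g : F[X]) v, aeval w f (aeval w g v) = aeval w (f * g) v := fun f g v => by
    rw [map_mul, Module.End.mul_apply]
  -- c is invertible modulo q^(k+1), so c² q^k(w) and c q^k(w) vanish together.
  obtain ⟨a, b, hab⟩ : IsCoprime c (q ^ (k + 1)) := (((hq.coprime_iff_not_dvd).2 hqc).symm).pow_right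
  have hred : ∀ v, aeval w (c * q ^ k) v = aeval w a (aeval w (c * c * q ^ k) v) := by
    intro v
    have : c * q ^ k = a * (c * c * q ^ k) + minpoly F w * (b * q ^ k) := by
      rw [hμ]
      linear_combination -(c * q ^ k) * hab
    rw [this, map_add, LinearMap.add_apply, hkill _ v (Dvd.intro _ rfl), add_zero, hmul]
  have hzero : ∀ v, subInv u (aeval w (c * c * q ^ k) v) = 0 := by
    by_contra! hne
    obtain ⟨v, hv⟩ := hne
    obtain ⟨v', hv'⟩ : ∃ v', s v' (subInv u (aeval w (c * c * q ^ k) v)) ≠ 0 := by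
      by_contra! h
      exact hv (hnd' _ h)
    -- This form is symmetric, u - u⁻¹ being skew-adjoint and commuting with w. If nonzero, it has a
    -- non-isotropic x, and c(w)x generates a nontrivial model subspace.
    let β : LinearMap.BilinForm F V := s.compl₂ (subInv u ∘ₗ aeval w (c * c * q ^ k))
    have hβ : ∀ x y, β x y = s x (subInv u (aeval w (c * c * q ^ k) y)) := fun _ _ => rfl
    obtain ⟨x, -, hx⟩ := exists_apply_self_ne_zero (β := β) (S := ⊤) h2 (fun x y => by
      rw [hβ, hβ, ← neg_neg (s x _), ← hδ, ← aeval_adjoint hw, ← aeval_intertwine hc, hs.swap,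
        neg_neg]) (v := v') (w := v) trivial trivial hv'
    have h1 : aeval w (q ^ (k + 1)) (aeval w c x) = 0 := by
      rw [hmul, ← hμ]
      exact hkill _ _ dvd_rfl
    have h3 : s (aeval w c x) (subInv u (aeval w (q ^ k) (aeval w c x))) ≠ 0 := by
      rw [aeval_adjoint hw, ← aeval_intertwine hc, hmul, hmul]
      rwa [hβ, show c * c * q ^ k = c * q ^ k * c by ring] at hx
    have h4 := hL _ (isModelSubspace_range_cyclicMap h2 hs hu hq h1 h3)
    have h5 : aeval w c x ∈ LinearMap.range (cyclicMap w (aeval w c x)) :=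
      ⟨1, by simp [cyclicMap_apply]⟩
    rw [h4, Submodule.mem_bot] at h5
    exact h3 (by rw [h5, map_zero, LinearMap.zero_apply])
  have hzero' : ∀ v, subInv u (aeval w (c * q ^ k) v) = 0 := by
    intro v
    rw [hred, aeval_intertwine hc, hzero, map_zero]
  -- Multiplying by u - u⁻¹ once more gives (w² - 4) c q^k(w) = 0; hence q divides X² - 4.
  have hdvd : minpoly F w ∣ (X ^ 2 - C 4) * (c * q ^ k) := by
    refine (minpoly.dvd_iff).2 (LinearMap.ext fun v => ?_)
    rw [← hmul, ← hδδ, hzero', map_zero, LinearMap.zero_apply]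
  have hq4 : q ∣ (X - C 2) * (X - C (-2)) := by
    rw [hμ, show (X ^ 2 - C 4) * (c * q ^ k) = q ^ k * ((X ^ 2 - C 4) * c) by ring, pow_succ,
      mul_assoc] at hdvd
    have h1 := (mul_dvd_mul_iff_left (pow_ne_zero k hq.ne_zero)).1 hdvd
    have h3 := (hq.prime.dvd_or_dvd ((dvd_mul_right q c).trans h1)).resolve_right hqc
    have : (X - C 2) * (X - C (-2)) = (X ^ 2 - C 4 : F[X]) := by
      simp only [map_neg, map_ofNat]; ring
    rwa [this]
  obtain ⟨ε, hε, rfl⟩ : ∃ ε : F, (ε = 1 ∨ ε = -1) ∧ q = X - C (2 * ε) := by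
    have key : ∀ r : F, q ∣ X - C r → q = X - C r := fun r hr =>
      eq_of_monic_of_associated hqm (monic_X_sub_C r)
        (hq.associated_of_dvd (irreducible_X_sub_C r) hr)
    rcases hq.prime.dvd_or_dvd hq4 with h | h
    · exact ⟨1, Or.inl rfl, by rw [mul_one]; exact key _ h⟩
    · exact ⟨-1, Or.inr rfl, by rw [mul_neg_one]; exact key _ h⟩
  have hcq : ∃ v, aeval w (c * c * (X - C (2 * ε)) ^ k) v ≠ 0 := by
    by_contra! h
    have h1 : minpoly F w ∣ c * (X - C (2 * ε)) ^ k := (minpoly.dvd_iff).2 (LinearMap.ext fun v => by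
      rw [hred, h, map_zero, LinearMap.zero_apply])
    rw [hμ, mul_comm c, pow_succ, mul_assoc] at h1
    have h3 := (mul_dvd_mul_iff_left (pow_ne_zero k hq.ne_zero)).1 h1
    have hc0 : c ≠ 0 := fun h => hqc (h ▸ dvd_zero _)
    obtain ⟨r, hr⟩ := h3
    have : (X - C (2 * ε)) * r = 1 := mul_right_cancel₀ hc0 (by linear_combination -hr)
    exact hq.not_isUnit (IsUnit.of_mul_eq_one _ this)
  obtain ⟨y, hy⟩ := hcq
  obtain ⟨x, hxy⟩ : ∃ x, s x (aeval w (c * c * (X - C (2 * ε)) ^ k) y) ≠ 0 := by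
    by_contra! h
    exact hy (hnd' _ h)
  have hae : ∀ n, (w - algebraMap F _ (2 * ε)) ^ n = aeval w ((X - C (2 * ε)) ^ n : F[X]) := by
    intro n
    simp only [map_pow, map_sub, aeval_X, aeval_C]
  have h1 : ∀ x, aeval w ((X - C (2 * ε)) ^ (k + 1) : F[X]) (aeval w c x) = 0 := by
    intro x
    rw [hmul, ← hμ]
    exact hkill _ _ dvd_rfl
  have h3 : ∀ x, subInv u (aeval w ((X - C (2 * ε)) ^ k : F[X]) (aeval w c x)) = 0 := by
    intro x
    rw [hmul, mul_comm, hzero']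
  refine ⟨ε, hε, k, aeval w c x, aeval w c y, ?_⟩
  simp only [hae]
  refine ⟨h1 x, h3 x, h1 y, h3 y, ?_⟩
  rw [aeval_adjoint hw, hmul, hmul]
  rwa [mul_right_comm] at hxy

end model_subspaces

/-! ### Splitting off a piece where u or -u is unipotent -/

section no_model_subspace

variable {F V : Type*} [Field F] [AddCommGroup V] [Module F V] {s : LinearMap.BilinForm F V}
  {u : V ≃ₗ[F] V}

theorem exists_signed_unipotent_piece [FiniteDimensional F V] [Nontrivial V] (h2 : (2 : F) ≠ 0)
    (hs : s.IsAlt) (hnd : ∀ v, (∀ w, s v w = 0) → v = 0) (hu : PreservesForm s u.toLinearMap)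
    (hL : ∀ L, IsModelSubspace s u L → L = ⊥) :
    ∃ (P : Submodule F V) (u₁ : P ≃ₗ[F] P), P ≠ ⊥ ∧ (∀ v : P, (u₁ v : V) = u v) ∧
      (∀ v ∈ P, (∀ w ∈ P, s v w = 0) → v = 0) ∧
      IsReversible (s.restrict P) u₁.toLinearMap ∧
      ∀ α : F, α ≠ 0 → α * α ≠ 1 → ∃ γ : F, γ ≠ 0 ∧ γ * γ ≠ 1 ∧
        HasFactorization (s.restrict P) u₁.toLinearMap α γ 1 := by
  obtain ⟨ε, rfl | rfl, k, x, y, hx, hx', hy, hy', hxy⟩ := exists_dual_pair h2 hs hnd hu hL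
  · obtain ⟨P, u₁, hP, hu₁, hPn, hr, hf⟩ := exists_unipotent_piece h2 hs hu
      (z := addInv u - algebraMap F _ (2 * 1)) (δ := subInv u)
      (fun v => by simp [addInv_apply, Module.algebraMap_end_apply]) (fun v => rfl)
      hx hx' hy hy' hxy
    exact ⟨P, u₁, hP, hu₁, hPn, hr, fun α h0 h1 => ⟨α, h0, h1, hf α h0 (by
      rintro rfl
      simp at h1)⟩⟩
  -- The case ε = -1 is the case ε = 1 for -u; the sign is absorbed in the second factor, as γ = -α.
  · have hneg : PreservesForm s (u.trans (LinearEquiv.neg F)).toLinearMap := fun x y => by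
      simpa using hu x y
    set Q := addInv u - algebraMap F (Module.End F V) (2 * -1) with hQ
    have hpow : ∀ n v, ((-Q) ^ n) v = (-1 : F) ^ n • (Q ^ n) v := by
      intro n v
      have : -Q = (-1 : F) • Q := by simp
      rw [this, smul_pow, LinearMap.smul_apply]
    obtain ⟨P, u₁, hP, hu₁, hPn, hr, hf⟩ := exists_unipotent_piece h2 hs hneg
      (z := -Q) (δ := -subInv u) (k := k) (x := x) (y := y)
      (fun v => by
        simp [hQ, addInv_apply, Module.algebraMap_end_apply]
        abel)
      (fun v => by simp [subInv_apply]; abel)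
      (by rw [hpow, hx, smul_zero])
      (by rw [hpow, map_smul, LinearMap.neg_apply, hx', neg_zero, smul_zero])
      (by rw [hpow, hy, smul_zero])
      (by rw [hpow, map_smul, LinearMap.neg_apply, hy', neg_zero, smul_zero])
      (by rw [hpow, map_smul]; exact smul_ne_zero (by simp) hxy)
    refine ⟨P, u₁.trans (LinearEquiv.neg F), hP, fun v => by simp [hu₁], hPn, ?_,
      fun α h0 h1 => ⟨-α, neg_ne_zero.2 h0, by simpa using h1, ?_⟩⟩
    · exact hr.neg
    · exact (hf α h0 (by rintro rfl; simp at h1)).neg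

end no_model_subspace

/-! ### Assembling orthogonal summands -/

section orthogonal_products

variable {F V : Type*} [Field F] [AddCommGroup V] [Module F V] {s : LinearMap.BilinForm F V}
  {u : V ≃ₗ[F] V} {U U' : Submodule F V} {e : (U × U') ≃ₗ[F] V}
  {u₁ : U ≃ₗ[F] U} {u₂ : U' ≃ₗ[F] U'}

theorem apply_prodEquiv (he : ∀ p, e p = p.1 + p.2) (hu₁ : ∀ v : U, (u₁ v : V) = u v)
    (hu₂ : ∀ v : U', (u₂ v : V) = u v) (p : U × U') :
    u (e p) = e (u₁.toLinearMap.prodMap u₂.toLinearMap p) := by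
  rw [he, he, map_add, ← hu₁, ← hu₂]
  rfl

theorem preservesForm_restrict (hu : PreservesForm s u.toLinearMap)
    (hu₁ : ∀ v : U, (u₁ v : V) = u v) : PreservesForm (s.restrict U) u₁.toLinearMap := by
  intro x y
  change s (u₁ x : V) (u₁ y : V) = s x y
  rw [hu₁, hu₁]
  exact hu x y

end orthogonal_products

/-- An isometry without nontrivial model subspaces is reversible, and has factorizations with one
hyperbolic pair. -/
theorem isReversible_and_hasFactorization_of_no_model {F : Type*} [Field F] (h2 : (2 : F) ≠ 0)
    (n : ℕ) : ∀ {V : Type*} [AddCommGroup V] [Module F V] [FiniteDimensional F V]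
      {s : LinearMap.BilinForm F V} {u : V ≃ₗ[F] V}, Module.finrank F V = n → s.IsAlt →
      (∀ v, (∀ w, s v w = 0) → v = 0) → PreservesForm s u.toLinearMap →
      (∀ L, IsModelSubspace s u L → L = ⊥) →
      IsReversible s u.toLinearMap ∧ (0 < n → ∀ α : F, α ≠ 0 → α * α ≠ 1 →
        ∃ γ : F, γ ≠ 0 ∧ γ * γ ≠ 1 ∧ HasFactorization s u.toLinearMap α γ 1) := by
  induction n using Nat.strong_induction_on with
  | _ n ih =>
    intro V _ _ _ s u hn hs hnd hu hL
    rcases Nat.eq_zero_or_pos n with rfl | hpos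
    · have := Module.finrank_zero_iff.1 hn
      exact ⟨⟨LinearMap.id, fun _ _ => rfl, fun _ => rfl, fun _ => Subsingleton.elim _ _⟩,
        fun h => absurd h (lt_irrefl 0)⟩
    · have : Nontrivial V := Module.nontrivial_of_finrank_pos (R := F) (by omega)
      obtain ⟨P, u₁, hP, hu₁, hPn, hr, hf⟩ := exists_signed_unipotent_piece h2 hs hnd hu hL
      have hPu : ∀ x ∈ P, u x ∈ P := fun x hx => hu₁ ⟨x, hx⟩ ▸ (u₁ ⟨x, hx⟩).2
      obtain ⟨P', e, ho, hP', hPn', he, hes⟩ := exists_orthogonal_splitting hs hnd hu hPu hPn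
      obtain ⟨u₂, hu₂⟩ := exists_restrict_equiv hP'
      have hlt : Module.finrank F P' < n := by
        have h1 := e.finrank_eq
        rw [Module.finrank_prod] at h1
        have h3 : 0 < Module.finrank F P := by
          have := Submodule.nontrivial_iff_ne_bot.2 hP
          exact Module.finrank_pos
        omega
      have hr' := (ih _ hlt (s := s.restrict P') (u := u₂) rfl (fun x => hs x)
        (fun v hv => Subtype.ext (hPn' v v.2 fun y hy => hv ⟨y, hy⟩)) (preservesForm_restrict hu hu₂)
        (fun L hL' => by
          have := hL _ (hL'.map_subtype hu₂)
          exact Submodule.map_injective_of_injective P'.injective_subtype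
            (this.trans (Submodule.map_bot _).symm))).1
      have hue := apply_prodEquiv (u := u) he hu₁ hu₂
      refine ⟨(hr.prod hr').congr e hes hue, fun _ α h0 h1 => ?_⟩
      -- Only the first piece contributes a hyperbolic pair; the rest enters as reversible, with d =
      -- 0.
      obtain ⟨γ, hγ, hγ1, h⟩ := hf α h0 h1
      exact ⟨γ, hγ, hγ1, (h.prod (hr'.hasFactorization (preservesForm_restrict hu hu₂))).congr e
        hes hue⟩

/-! ### Padding products of involutions -/

section reflectional

variable {G : Type*} [Group G]

theorem IsReflectional.succ {k : ℕ} {g : G} (h : IsReflectional k g) : IsReflectional (k + 1) g := by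
  obtain ⟨i, hi, rfl⟩ := h
  refine ⟨Fin.cons 1 i, fun j => ?_, ?_⟩
  · refine Fin.cases ?_ (fun j => ?_) j
    · simp
    · simpa using hi j
  · rw [List.ofFn_cons, List.prod_cons, one_mul]

theorem IsReflectional.mono {k l : ℕ} (hkl : k ≤ l) {g : G} (h : IsReflectional k g) :
    IsReflectional l g := by
  induction hkl with
  | refl => exact h
  | step _ ih => exact ih.succ

end reflectional

/-! ### Transvections need four involutions -/

section lower_bound

variable {F V : Type*} [Field F] [AddCommGroup V] [Module F V] {s : LinearMap.BilinForm F V}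

/-- A vector space is not the union of two proper subspaces. -/
theorem eq_zero_or_eq_zero_of_forall_mul_eq_zero (f g : V →ₗ[F] F) (h : ∀ y, f y * g y = 0) :
    f = 0 ∨ g = 0 := by
  by_contra! hne
  obtain ⟨a, ha⟩ := DFunLike.ne_iff.1 hne.1
  obtain ⟨b, hb⟩ := DFunLike.ne_iff.1 hne.2
  have ga := (mul_eq_zero.1 (h a)).resolve_left ha
  have fb := (mul_eq_zero.1 (h b)).resolve_right hb
  have := h (a + b)
  rw [map_add, map_add, ga, fb, zero_add, add_zero] at this
  exact (mul_ne_zero ha hb) this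

/-- On the hyperplane orthogonal to x, the product of the forms s(·, a) and s(·, b) is zero, so one
of them vanishes there and is proportional to s(·, x). -/
theorem eq_smul_or_eq_smul_of_mul_eq (hnd : ∀ v, (∀ w, s w v = 0) → v = 0) {x a b c : V}
    (hx : x ≠ 0) (h : ∀ y, s y a * s y b + s y x * s y c = 0) :
    (∃ r : F, a = r • x) ∨ ∃ r : F, b = r • x := by
  let K := LinearMap.ker (s.flip x)
  obtain ⟨y₀, hy₀⟩ : ∃ y, s y x ≠ 0 := by
    by_contra! H
    exact hx (hnd x H)
  have key : ∀ a, (s.flip a) ∘ₗ K.subtype = 0 → ∃ r : F, a = r • x := by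
    intro a ha
    refine ⟨s y₀ a / s y₀ x, sub_eq_zero.1 (hnd _ fun y => ?_)⟩
    have hm : y - (s y x / s y₀ x) • y₀ ∈ K := by
      change s (y - (s y x / s y₀ x) • y₀) x = 0
      simp [hy₀]
    have := LinearMap.congr_fun ha ⟨_, hm⟩
    have h1 : s (y - (s y x / s y₀ x) • y₀) a = 0 := this
    simp only [map_sub, map_smul, LinearMap.sub_apply, LinearMap.smul_apply, smul_eq_mul] at h1 ⊢
    linear_combination h1
  rcases eq_zero_or_eq_zero_of_forall_mul_eq_zero (s.flip a ∘ₗ K.subtype) (s.flip b ∘ₗ K.subtype)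
    (fun y => by
      have := h y
      have hy : s (y : V) x = 0 := y.2
      rw [hy, zero_mul, add_zero] at this
      exact this) with h | h
  · exact Or.inl (key a h)
  · exact Or.inr (key b h)

/-- A symplectic transvection is not the product of three involutions. -/
theorem not_isReflectional_transvection (h2 : (2 : F) ≠ 0) (hs : s.IsAlt)
    (hnd : ∀ v, (∀ w, s w v = 0) → v = 0) {x : V} (hx : x ≠ 0) {T : Sp s}
    (hT : ∀ y, (T : V ≃ₗ[F] V) y = y + s x y • x) : ¬ IsReflectional 3 T := by
  rintro ⟨I, hI, hprod⟩
  have hII : ∀ n v, (I n : V ≃ₗ[F] V) ((I n : V ≃ₗ[F] V) v) = v := by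
    intro n v
    have := congrArg (fun g : Sp s => (g : V ≃ₗ[F] V) v) (hI n)
    simpa [pow_two] using this
  have hadj : ∀ n v w, s ((I n : V ≃ₗ[F] V) v) w = s v ((I n : V ≃ₗ[F] V) w) := by
    intro n v w
    have := (I n).2 v ((I n : V ≃ₗ[F] V) w)
    rwa [hII] at this
  obtain ⟨i, hi⟩ : ∃ i, i = (I 0 : V ≃ₗ[F] V) := ⟨_, rfl⟩
  obtain ⟨j, hj⟩ : ∃ j, j = (I 1 : V ≃ₗ[F] V) := ⟨_, rfl⟩
  obtain ⟨k, hk⟩ : ∃ k, k = (I 2 : V ≃ₗ[F] V) := ⟨_, rfl⟩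
  have hijk : ∀ y, y + s x y • x = i (j (k y)) := by
    intro y
    rw [← hT, hprod]
    simp [List.ofFn_succ, hi, hj, hk]
  have ii : ∀ v, i (i v) = v := hi ▸ hII 0
  have kk : ∀ v, k (k v) = v := hk ▸ hII 2
  have ia : ∀ v w, s (i v) w = s v (i w) := hi ▸ hadj 0
  have ja : ∀ v w, s (j v) w = s v (j w) := hj ▸ hadj 1
  have ka : ∀ v w, s (k v) w = s v (k w) := hk ▸ hadj 2
  have hjy : ∀ y, s y (j y) = 0 := by
    intro y
    have := ja y y
    rw [hs.swap] at this
    exact (mul_eq_zero.1 (by linear_combination -this : 2 * s y (j y) = 0)).resolve_left h2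
  -- This is s(y, j y) = 0 with j = i T k, where T is the transvection.
  have base : ∀ y, s y (i (k y)) = s y (k x) * s y (i x) := by
    intro y
    have h1 := hijk (k y)
    rw [kk] at h1
    have h3 := hjy y
    rw [← ii (j y), ← h1, ← ia, map_add, map_smul, smul_eq_mul, ia, ia, ← ka, hs.swap (k x) y] at h3
    linear_combination h3
  have hanti : ∀ y, s y (k (i y)) = - s y (i (k y)) := by
    intro y
    rw [← ka, ← ia, hs.swap, ← ia, ← ka]
  -- `base` at i y, combined with the antisymmetry `hanti`; `hB` is the same at k y. They force k x
  -- or i x to be a multiple of x, and substituting back yields a vanishing product of two nonzero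
  -- linear forms.
  have hA : ∀ y, s y (k x) * s y (i x) + s y x * s y (i (k x)) = 0 := by
    intro y
    have := base (i y)
    rw [ia, ia, ia, ii, ii, hanti, base] at this
    linear_combination -this
  have hB : ∀ y, s y (k x) * s y (i x) + s y x * s y (k (i x)) = 0 := by
    intro y
    have := base (k y)
    rw [kk, ka, ka, ka, kk, hanti, base] at this
    linear_combination -this
  have contra : ∀ g : V ≃ₗ[F] V, ¬ ∀ y, s y x * s y (g x) = 0 := by
    intro g h
    rcases eq_zero_or_eq_zero_of_forall_mul_eq_zero (s.flip x) (s.flip (g x)) h with h | h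
    · exact hx (hnd x fun w => LinearMap.congr_fun h w)
    · have := hnd (g x) fun w => LinearMap.congr_fun h w
      exact hx (by simpa using this)
  have nz : ∀ (g : V ≃ₗ[F] V) (r : F), g x = r • x → 2 * r ≠ 0 := by
    rintro g r h
    refine mul_ne_zero h2 ?_
    rintro rfl
    rw [zero_smul] at h
    exact hx (by simpa using h)
  rcases eq_smul_or_eq_smul_of_mul_eq hnd hx hA with ⟨r, hr⟩ | ⟨r, hr⟩
  · refine contra i fun y => ?_
    have := hA y
    rw [hr, map_smul, map_smul, map_smul, smul_eq_mul, smul_eq_mul] at this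
    refine (mul_eq_zero.1 ?_).resolve_left (nz k r hr)
    linear_combination this
  · refine contra k fun y => ?_
    have := hB y
    rw [hr, map_smul, map_smul, map_smul, smul_eq_mul, smul_eq_mul] at this
    refine (mul_eq_zero.1 ?_).resolve_left (nz i r hr)
    linear_combination this

theorem exists_forall_not_isReflectional [Nontrivial V] (h2 : (2 : F) ≠ 0) (hs : s.IsAlt)
    (hnd : ∀ v, (∀ w, s w v = 0) → v = 0) : ∃ u : Sp s, ∀ k < 4, ¬ IsReflectional k u := by
  obtain ⟨x, hx⟩ := exists_ne (0 : V)
  let f : V →ₗ[F] V := LinearMap.id + (s x).smulRight x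
  let g : V →ₗ[F] V := LinearMap.id - (s x).smulRight x
  let T : V ≃ₗ[F] V := LinearEquiv.ofLinearMap f g
    (LinearMap.ext fun v => by simp [f, g, hs.self_eq_zero])
    (LinearMap.ext fun v => by simp [f, g, hs.self_eq_zero])
  have hT : ∀ y, T y = y + s x y • x := fun _ => rfl
  have hTs : T ∈ Sp s := by
    intro y z
    simp [hT, hs.self_eq_zero, hs.swap y x]
    ring
  exact ⟨⟨T, hTs⟩, fun k hk h =>
    not_isReflectional_transvection h2 hs hnd hx hT (h.mono (by omega))⟩

end lower_bound

/-! ### From factorizations to four or five involutions -/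

section upper_bound

variable {F V : Type*} [Field F] [AddCommGroup V] [Module F V] {s : LinearMap.BilinForm F V}

theorem exists_mem_Sp_of_involution {i : V →ₗ[F] V} (hi : PreservesForm s i)
    (hii : ∀ v, i (i v) = v) : ∃ g : Sp s, g ^ 2 = 1 ∧ ∀ v, (g : V ≃ₗ[F] V) v = i v :=
  ⟨⟨LinearEquiv.ofInvolutive i hii, hi⟩, Subtype.ext (LinearEquiv.ext fun v => by
    rw [pow_two]
    exact hii v), fun _ => rfl⟩

/-- The decomposition is a = j (j a), both factors being involutions. -/
theorem IsReversible.exists_involutions {a : V →ₗ[F] V} (h : IsReversible s a)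
    (ha : PreservesForm s a) :
    ∃ g k : Sp s, g ^ 2 = 1 ∧ k ^ 2 = 1 ∧
      ∀ v, a v = (g : V ≃ₗ[F] V) ((k : V ≃ₗ[F] V) v) := by
  obtain ⟨j, hj, hjj, hja⟩ := h
  have hjp : PreservesForm s j := fun x y => by rw [hj, hjj]
  obtain ⟨g, hg, hgj⟩ := exists_mem_Sp_of_involution hjp hjj
  obtain ⟨k, hk, hkj⟩ := exists_mem_Sp_of_involution (i := j ∘ₗ a)
    (fun x y => (hjp _ _).trans (ha x y)) hja
  exact ⟨g, k, hg, hk, fun v => by rw [hkj, hgj, LinearMap.comp_apply, hjj]⟩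

theorem isReflectional_four_of_isReversible {u : Sp s} {a b : V →ₗ[F] V} (ha : PreservesForm s a)
    (hb : PreservesForm s b) (hab : ∀ v, (u : V ≃ₗ[F] V) v = a (b v)) (ra : IsReversible s a)
    (rb : IsReversible s b) : IsReflectional 4 u := by
  obtain ⟨g₁, g₂, h₁, h₂, hg⟩ := ra.exists_involutions ha
  obtain ⟨k₁, k₂, h₃, h₄, hk⟩ := rb.exists_involutions hb
  refine ⟨![g₁, g₂, k₁, k₂], fun j => ?_, Subtype.ext (LinearEquiv.ext fun v => ?_)⟩
  · fin_cases j
    exacts [h₁, h₂, h₃, h₄]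
  · rw [hab, hg, hk]
    simp [List.ofFn_succ]

theorem HasFactorization.isReflectional_four (hs : s.IsAlt) {u : Sp s} {α γ : F} (hα : α ≠ 0)
    (hγ : γ ≠ 0) {d : ℕ} (hd : Even d)
    (h : HasFactorization s (u : V ≃ₗ[F] V).toLinearMap α γ d) : IsReflectional 4 u := by
  obtain ⟨a, b, ha, hb, hab, h1, h3⟩ := h
  exact isReflectional_four_of_isReversible ha hb hab (h1.isReversible hs hα ha hd)
    (h3.isReversible hs hγ hb hd)

theorem isReflectional_five_of_model [Infinite F] [FiniteDimensional F V] (h2 : (2 : F) ≠ 0)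
    (hs : s.IsAlt) (hnd : ∀ v, (∀ w, s v w = 0) → v = 0) {u : Sp s} {L : Submodule F V}
    (hL : IsModelSubspace s (u : V ≃ₗ[F] V) L)
    (htop : ∀ v, v ∈ L ⊔ L.map (u : V ≃ₗ[F] V).toLinearMap) (hodd : Odd (Module.finrank F L))
    (hdim : 2 ≤ Module.finrank F L) : IsReflectional 5 u := by
  obtain ⟨β, W, e, hβ, hβn, hW, he, hue⟩ := exists_model hs hnd u.2 hL.isotropic hL.add_symm_mem
    (fun v => by
      obtain ⟨p, hp, _, ⟨q, hq, rfl⟩, h⟩ := Submodule.mem_sup.1 (htop v)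
      exact ⟨p, hp, q, hq, h⟩)
  let u' : L × L →ₗ[F] L × L := (-LinearMap.snd F L L).prod
    (LinearMap.fst F L L + W ∘ₗ LinearMap.snd F L L)
  have hu' : ∀ p, u' p = (-p.2, p.1 + W p.2) := fun _ => rfl
  obtain ⟨i, a, b, α, γ, hα, hγ, hi, ha, hb, hii, huv, hsa, hsb⟩ :=
    exists_involution_mul_model h2 hβ hβn W hW u' hu' hdim
  have heven : Even (Module.finrank F L - 1) := hodd.tsub_odd odd_one
  have hma : (modelForm β).IsAlt := modelForm_isAlt
  have key : ∀ c : L × L →ₗ[F] L × L, ∀ v,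
      (e.toLinearMap ∘ₗ c ∘ₗ e.symm.toLinearMap) (e v) = e (c v) := fun c v => by simp
  obtain ⟨g₀, h₀, hg₀⟩ := exists_mem_Sp_of_involution (hi.congr e he) (fun v => by simp [hii])
  obtain ⟨g₁, g₂, h₁, h₂, hg⟩ := ((hsa.isReversible hma hα ha heven).congr e he
    (key a)).exists_involutions (ha.congr e he)
  obtain ⟨k₁, k₂, h₃, h₄, hk⟩ := ((hsb.isReversible hma hγ hb heven).congr e he
    (key b)).exists_involutions (hb.congr e he)
  refine ⟨![g₀, g₁, g₂, k₁, k₂], fun j => ?_, Subtype.ext (LinearEquiv.ext fun v => ?_)⟩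
  · fin_cases j
    exacts [h₀, h₁, h₂, h₃, h₄]
  · obtain ⟨p, rfl⟩ := e.surjective v
    rw [hue, ← hu', huv, ← key i, ← key a, ← key b, hk, hg, ← hg₀]
    simp [List.ofFn_succ]

theorem exists_maximal_isModelSubspace [FiniteDimensional F V] (hs : s.IsAlt)
    (hnd : ∀ v, (∀ w, s v w = 0) → v = 0) {u : V ≃ₗ[F] V} (hu : PreservesForm s u.toLinearMap) :
    ∃ (L U' : Submodule F V) (e : ((L ⊔ L.map u.toLinearMap : Submodule F V) × U') ≃ₗ[F] V)
      (u₁ : (L ⊔ L.map u.toLinearMap : Submodule F V) ≃ₗ[F]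
        (L ⊔ L.map u.toLinearMap : Submodule F V)) (u₂ : U' ≃ₗ[F] U'),
      IsModelSubspace s u L ∧ (∀ v, (u₁ v : V) = u v) ∧ (∀ v, (u₂ v : V) = u v) ∧
      (∀ x ∈ U', (∀ y ∈ U', s x y = 0) → x = 0) ∧
      (∀ p, e p = p.1 + p.2) ∧
      (∀ p q, s (e p) (e q) =
        prodForm (s.restrict (L ⊔ L.map u.toLinearMap)) (s.restrict U') p q) ∧
      ∀ M, IsModelSubspace (s.restrict U') u₂ M → M = ⊥ := by
  -- Finite dimension gives a maximal model subspace, since the zero subspace is one.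
  obtain ⟨L, hL, hmax⟩ := (wellFounded_gt (α := Submodule F V)).has_min
    {L | IsModelSubspace s u L} ⟨⊥, isModelSubspace_bot⟩
  obtain ⟨U', e, ho, hU', hn', he, hes⟩ :=
    exists_orthogonal_splitting hs hnd hu hL.apply_mem hL.nondegenerate
  obtain ⟨u₁, hu₁⟩ := exists_restrict_equiv hL.apply_mem
  obtain ⟨u₂, hu₂⟩ := exists_restrict_equiv hU'
  refine ⟨L, U', e, u₁, u₂, hL, hu₁, hu₂, hn', he, hes, fun M hM => ?_⟩
  have hM' := hM.map_subtype hu₂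
  have hle : M.map U'.subtype ≤ U' := Submodule.map_subtype_le U' M
  have hle' : M.map U'.subtype ⊔ (M.map U'.subtype).map u.toLinearMap ≤ U' := by
    refine sup_le hle ?_
    rintro _ ⟨x, hx, rfl⟩
    exact hU' x (hle hx)
  have hsup := hL.sup hs hM' fun x hx y hy => ho x (hle' hx) y hy
  -- A model subspace of the complement could be added to L. By maximality it lies in L, and being
  -- orthogonal to L + uL it is zero.
  have heq : M.map U'.subtype ≤ L := by
    by_contra h
    exact hmax _ hsup (left_lt_sup.2 h)
  refine (Submodule.eq_bot_iff M).2 fun x hx => Subtype.ext ?_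
  have hx1 : (x : V) ∈ M.map U'.subtype := ⟨x, hx, rfl⟩
  exact hL.nondegenerate _ (Submodule.mem_sup_left (heq hx1)) fun y hy => ho x x.2 y hy

theorem IsModelSubspace.hasFactorization [FiniteDimensional F V] (hs : s.IsAlt) {u : V ≃ₗ[F] V}
    (hu : PreservesForm s u.toLinearMap) {L U : Submodule F V} (hL : IsModelSubspace s u L)
    (hU : U = L ⊔ L.map u.toLinearMap) {u₁ : U ≃ₗ[F] U} (hu₁ : ∀ v, (u₁ v : V) = u v) :
    Module.finrank F U = 2 * Module.finrank F L ∧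
    ∀ α γ : F, α ≠ 0 → α * α ≠ 1 → γ ≠ 0 → γ * γ ≠ 1 →
      HasFactorization (s.restrict U) u₁.toLinearMap α γ (Module.finrank F L) := by
  have hLU : L ≤ U := hU ▸ le_sup_left
  have hsymm : ∀ x, (u₁.symm x : V) = u.symm x := by
    intro x
    rw [LinearEquiv.eq_symm_apply, ← hu₁, u₁.apply_symm_apply]
  have hrank : Module.finrank F (L.submoduleOf U) = Module.finrank F L :=
    (Submodule.submoduleOfEquivOfLe hLU).finrank_eq
  obtain ⟨β, W, e, hβ, hβn, hW, he, hue⟩ := exists_model (s := s.restrict U) (u := u₁)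
    (L := L.submoduleOf U) (fun x => hs x)
    (fun v hv => Subtype.ext (hL.nondegenerate v (hU ▸ v.2) fun y hy => hv ⟨y, hU ▸ hy⟩))
    (preservesForm_restrict hu hu₁) (fun x hx y hy => hL.isotropic x hx y hy)
    (fun x hx => by
      have := hL.add_symm_mem x hx
      rw [← hu₁, ← hsymm] at this
      exact this)
    (fun v => by
      obtain ⟨p, hp, _, ⟨q, hq, rfl⟩, h⟩ := Submodule.mem_sup.1 (hU.le v.2)
      exact ⟨⟨p, hLU hp⟩, hp, ⟨q, hLU hq⟩, hq,
        Subtype.ext (by rw [Submodule.coe_add, hu₁]; exact h)⟩)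
  constructor
  · rw [← e.finrank_eq, Module.finrank_prod, hrank, two_mul]
  · intro α γ hα hα2 hγ hγ2
    let u' : L.submoduleOf U × L.submoduleOf U →ₗ[F] L.submoduleOf U × L.submoduleOf U :=
      (-LinearMap.snd F _ _).prod (LinearMap.fst F _ _ + W ∘ₗ LinearMap.snd F _ _)
    have hu' : ∀ p, u' p = (-p.2, p.1 + W p.2) := fun _ => rfl
    rw [← hrank]
    exact (hasFactorization_model hβ hβn W hW u' hu' hα hα2 hγ hγ2).congr e he
      fun v => by rw [hu']; exact hue v

/-- Over an infinite field of characteristic not `2`, every symplectic isometry is a product of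
four involutions, or a product of five involutions in a space whose dimension is twice an odd
number, at least `3`. -/
theorem isReflectional_four_or [Infinite F] [FiniteDimensional F V] (h2 : (2 : F) ≠ 0)
    (hs : s.IsAlt) (hnd : ∀ v, (∀ w, s v w = 0) → v = 0) (u : Sp s) :
    IsReflectional 4 u ∨ Module.finrank F V % 4 = 2 ∧
      (2 < Module.finrank F V → IsReflectional 5 u) := by
  classical
  obtain ⟨L, U', e, u₁, u₂, hL, hu₁, hu₂, hn', he, hes, hM⟩ :=
    exists_maximal_isModelSubspace hs hnd (u := (u : V ≃ₗ[F] V)) u.2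
  obtain ⟨hrank, hfac⟩ := hL.hasFactorization hs u.2 rfl hu₁
  obtain ⟨hr, hf⟩ := isReversible_and_hasFactorization_of_no_model h2 _ (s := s.restrict U')
    (u := u₂) rfl (fun x => hs x)
    (fun v hv => Subtype.ext (hn' v v.2 fun y hy => hv ⟨y, hy⟩)) (preservesForm_restrict u.2 hu₂) hM
  have hue := apply_prodEquiv he hu₁ hu₂
  obtain ⟨α, hα, hαS, -⟩ := exists_notMem_add_inv_notMem ({1, -1} : Finset F) ∅
  have hα2 : α * α ≠ 1 := by
    intro h
    apply hαS
    simpa using mul_self_eq_one_iff.1 h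
  have hV := e.finrank_eq
  rw [Module.finrank_prod, hrank] at hV
  -- The parity count: dim L even uses reversibility on U'; dim L odd with U' ≠ 0 uses the extra
  -- pair from U'; dim L odd with U' = 0 leaves n = 2 dim L and the fifth involution.
  rcases Nat.even_or_odd (Module.finrank F L) with heven | hodd
  · exact Or.inl (HasFactorization.isReflectional_four hs hα hα heven
      (((hfac α α hα hα2 hα hα2).prod
        (hr.hasFactorization (preservesForm_restrict u.2 hu₂))).congr e hes hue))
  · rcases Nat.eq_zero_or_pos (Module.finrank F U') with hzero | hpos
    · refine Or.inr ⟨?_, fun hlt => isReflectional_five_of_model h2 hs hnd hL (fun v => ?_) hodd ?_⟩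
      · obtain ⟨r, hr⟩ := hodd
        omega
      · obtain ⟨p, rfl⟩ := e.surjective v
        have := Module.finrank_zero_iff.1 hzero
        rw [he, Subsingleton.elim p.2 0, Submodule.coe_zero, add_zero]
        exact p.1.2
      · omega
    · obtain ⟨γ, hγ, hγ2, h⟩ := hf hpos α hα hα2
      exact Or.inl (HasFactorization.isReflectional_four hs hα hγ (hodd.add_odd odd_one)
        (((hfac α γ hα hα2 hγ hγ2).prod h).congr e hes hue))

end upper_bound

theorem mainTheorem1 {F V : Type*} [Field F] [Infinite F] (hF : ringChar F ≠ 2)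
    [AddCommGroup V] [Module F V] [FiniteDimensional F V]
    (s : LinearMap.BilinForm F V) (hs : IsSymplecticForm s)
    (n : ℕ) (hn : Module.finrank F V = n) (hpos : 0 < n) :
    (4 ∣ n →
      (∀ u : Sp s, IsReflectional 4 u) ∧ ∃ u : Sp s, ∀ k < 4, ¬ IsReflectional k u) ∧
    (n % 4 = 2 → 2 < n →
      (∀ u : Sp s, IsReflectional 5 u) ∧ ∃ u : Sp s, ∀ k < 4, ¬ IsReflectional k u) := by
  have h2 : (2 : F) ≠ 0 := Ring.two_ne_zero hF
  have hnd : ∀ v, (∀ w, s v w = 0) → v = 0 := hs.nondegenerate.1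
  have hnd' : ∀ v, (∀ w, s w v = 0) → v = 0 := hs.nondegenerate.2
  have : Nontrivial V := Module.nontrivial_of_finrank_pos (R := F) (by omega)
  have hlower := exists_forall_not_isReflectional h2 hs.alt hnd'
  have hupper := isReflectional_four_or h2 hs.alt hnd
  rw [hn] at hupper
  refine ⟨fun h4 => ⟨fun u => ?_, hlower⟩, fun _ hlt => ⟨fun u => ?_, hlower⟩⟩
  -- The exceptional case has n ≡ 2 mod 4.
  · exact (hupper u).resolve_right fun h => by omega
  · rcases hupper u with h | h
    · exact h.succ
    · exact h.2 hlt
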